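/- Let $m\ge 0$ and let $\tilde\Sigma^m$ be a finite simplicial complex such that (i) $|\tilde\Sigma^m|$ is a union of $m$-simplices and every $(m-1)$-simplex is a face of an even number of $m$-simplices, and (ii) $a\colon|\tilde\Sigma^m|\to|\tilde\Sigma^m|$ is a free (continuous) involution. By (i) the sum of all $m$-simplices is a cycle mod 2; let $[\tilde\sigma]\in H_m(\tilde\Sigma^m;\mathbb Z_2)$ be its class. For a continuous map $\varphi\colon|\tilde\Sigma^m|\to S^m$ let $\deg_2(\varphi)\in\mathbb Z_2$ be its degree mod 2, i.e. $\deg_2(\varphi)=1$ if $\varphi_*[\tilde\sigma]\ne 0$ in $H_m(S^m;\mathbb Z_2)$ and $\deg_2(\varphi)=0$ otherwise. Call $\varphi$ equivariant if $\varphi(a(x))=-\varphi(x)$ for all $x$. The pair $(\tilde\Sigma^m,a)$ is called an essential $\mathbb Z_2$-$m$-cycle if, in addition to (i) and (ii), (iii) there is an equivariant map $|\tilde\Sigma^m|\to S^m$ with $\deg_2=1$. Proposition. If $(\tilde\Sigma^m,a)$ is an essential $\mathbb Z_2$-$m$-cycle, then every equivariant map $\varphi\colon|\tilde\Sigma^m|\to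 S^m$ satisfies $\deg_2(\varphi)=1$. More generally, if $(\tilde\Sigma^m,a)$ satisfies (i) and (ii), then any two equivariant maps $\varphi,\psi\colon|\tilde\Sigma^m|\to S^m$ satisfy $\deg_2(\varphi)=\deg_2(\psi)$; that is, $\deg_2$ does not depend on the equivariant map chosen. -/

import Mathlib

noncomputable section

open CategoryTheory

/-! ### Finite simplicial complexes and their geometric realizations -/

/-- The geometric realization `|K|` of a simplicial complex `K` with finite vertex set `V`, in
barycentric coordinates: the points of the standard simplex on `V` whose support lies in a face
of `K`, with the topology induced from `V → ℝ`. -/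
abbrev Realization {V : Type} [Fintype V] (K : AbstractSimplicialComplex V) : Type :=
  {x : stdSimplex ℝ V // ∃ s ∈ K.faces, ∀ v, x v ≠ 0 → v ∈ s}

/-- The `m`-simplices of `K` (the faces with `m + 1` vertices). -/
abbrev Simplices {V : Type} (K : AbstractSimplicialComplex V) (m : ℕ) : Type :=
  {s : Finset V // s ∈ K.faces ∧ s.card = m + 1}

instance {V : Type} [Finite V] (K : AbstractSimplicialComplex V) (m : ℕ) :
    Fintype (Simplices K m) :=
  Fintype.ofFinite _

/-- `K` is a union of `m`-simplices (every face is a face of an `m`-simplex) and every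
`(m - 1)`-simplex, i.e. every face with `m` vertices, is a face of an even number of
`m`-simplices. -/
structure IsModTwoCycle {V : Type} (K : AbstractSimplicialComplex V) (m : ℕ) : Prop where
  exists_simplex : ∀ s ∈ K.faces, ∃ t ∈ K.faces, s ⊆ t ∧ t.card = m + 1
  even_ncard : ∀ t ∈ K.faces, t.card = m →
    Even {s : Finset V | s ∈ K.faces ∧ s.card = m + 1 ∧ t ⊆ s}.ncard

/-! ### Singular homology with `ℤ/2` coefficients and the fundamental class -/

/-- The coefficient module `ℤ/2`. -/
abbrev Coeff : ModuleCat.{0} (ZMod 2) := ModuleCat.of (ZMod 2) (ZMod 2)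

/-- The singular chain complex of `X` with `ℤ/2` coefficients (by definition, the value at `X` of
Mathlib's `AlgebraicTopology.singularChainComplexFunctor`). -/
abbrev singularChains (X : TopCat.{0}) : ChainComplex (ModuleCat.{0} (ZMod 2)) ℕ :=
  (TopCat.toSSet.obj X).chainComplex Coeff

/-- The singular homology `H_m(X; ℤ/2)`. -/
abbrev singularHomology (m : ℕ) (X : TopCat.{0}) : ModuleCat.{0} (ZMod 2) :=
  ((AlgebraicTopology.singularHomologyFunctor (ModuleCat.{0} (ZMod 2)) m).obj Coeff).obj X

/-- The map `f_* : H_m(X; ℤ/2) → H_m(Y; ℤ/2)` induced by a continuous map `f`. -/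
def singularHomologyMap (m : ℕ) {X Y : Type} [TopologicalSpace X] [TopologicalSpace Y]
    (f : C(X, Y)) : singularHomology m (TopCat.of X) →ₗ[ZMod 2] singularHomology m (TopCat.of Y) :=
  (((AlgebraicTopology.singularHomologyFunctor (ModuleCat.{0} (ZMod 2)) m).obj Coeff).map
    (TopCat.ofHom f)).hom

section

variable {V : Type} [Fintype V] [LinearOrder V]

/-- The affine parametrization `Δ^m → |K|` of an `m`-simplex of `K` which sends the vertices of
`Δ^m` to those of the simplex in increasing order. -/
def simplexMap (K : AbstractSimplicialComplex V) (m : ℕ) (s : Simplices K m) :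
    C(stdSimplex ℝ (Fin (m + 1)), Realization K) where
  toFun x := ⟨stdSimplex.map (s.1.orderEmbOfFin s.2.2) x, s.1, s.2.1, fun v hv => by
    by_contra hvs
    apply hv
    rw [stdSimplex.map_coe, FunOnFinite.linearMap_apply_apply]
    refine Finset.sum_eq_zero fun i hi => ?_
    rw [Finset.mem_filter] at hi
    exact absurd (hi.2 ▸ s.1.orderEmbOfFin_mem s.2.2 i) hvs⟩
  continuous_toFun := (stdSimplex.continuous_map _).subtype_mk _

/-- The `m`-simplex of `K`, as a singular `m`-simplex of `|K|`. -/
def singularSimplex (K : AbstractSimplicialComplex V) (m : ℕ) (s : Simplices K m) :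
    (TopCat.toSSet.obj (TopCat.of (Realization K))).obj (.op (SimplexCategory.mk m)) :=
  (TopCat.toSSetObjEquiv (TopCat.of (Realization K)) (.op (SimplexCategory.mk m))).symm (simplexMap K m s)

/-- The sum of all `m`-simplices of `K`, as a singular chain of `|K|` (a chain being given by a
homomorphism from `ℤ/2` to the chain group). -/
def fundamentalChain (K : AbstractSimplicialComplex V) (m : ℕ) :
    Coeff ⟶ (singularChains (TopCat.of (Realization K))).X m :=
  ∑ s : Simplices K m, SSet.ιChainComplex (TopCat.toSSet.obj (TopCat.of (Realization K))) (singularSimplex K m s)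

/-- The codimension one face of an `(m + 1)`-simplex opposite to its `i`-th vertex. -/
def Simplices.face {K : AbstractSimplicialComplex V} {m : ℕ} (s : Simplices K (m + 1))
    (i : Fin (m + 2)) : Simplices K m :=
  ⟨s.1.erase (s.1.orderEmbOfFin s.2.2 i), by
    have hc : (s.1.erase (s.1.orderEmbOfFin s.2.2 i)).card = m + 1 := by
      rw [Finset.card_erase_of_mem (s.1.orderEmbOfFin_mem s.2.2 i), s.2.2]; rfl
    exact ⟨(K.isRelLowerSet_faces s.2.1).2 (Finset.erase_subset _ _)
      (Finset.card_pos.1 (by omega)), hc⟩⟩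

theorem Simplices.orderEmbOfFin_face {K : AbstractSimplicialComplex V} {m : ℕ}
    (s : Simplices K (m + 1)) (i : Fin (m + 2)) (j : Fin (m + 1)) :
    (s.face i).1.orderEmbOfFin (s.face i).2.2 j = s.1.orderEmbOfFin s.2.2 (i.succAbove j) := by
  have h := Finset.orderEmbOfFin_unique (s.face i).2.2
    (f := fun j => s.1.orderEmbOfFin s.2.2 (i.succAbove j))
    (fun x => by
      simp only [Simplices.face, Finset.mem_erase]
      exact ⟨fun h => Fin.succAbove_ne i x ((s.1.orderEmbOfFin s.2.2).injective h),
        s.1.orderEmbOfFin_mem s.2.2 _⟩)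
    (fun a b hab => (s.1.orderEmbOfFin s.2.2).strictMono (Fin.strictMono_succAbove i hab))
  exact (congrFun h j).symm

theorem singularSimplex_face (K : AbstractSimplicialComplex V) (m : ℕ)
    (s : Simplices K (m + 1)) (i : Fin (m + 2)) :
    (TopCat.toSSet.obj (TopCat.of (Realization K))).δ i (singularSimplex K (m + 1) s) =
      singularSimplex K m (s.face i) := by
  apply (TopCat.toSSetObjEquiv (TopCat.of (Realization K)) (.op (SimplexCategory.mk m))).injective
  rw [singularSimplex, singularSimplex, Equiv.apply_symm_apply]
  ext x : 2
  change stdSimplex.map (s.1.orderEmbOfFin s.2.2) (stdSimplex.map i.succAbove x) =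
    stdSimplex.map ((s.face i).1.orderEmbOfFin (s.face i).2.2) x
  rw [stdSimplex.map_comp_apply]
  congr 1
  funext j
  exact (s.orderEmbOfFin_face i j).symm

/-- The sum of all `m`-simplices is a cycle. -/
theorem fundamentalChain_comp_d {K : AbstractSimplicialComplex V} {m : ℕ}
    (hK : IsModTwoCycle K m) :
    fundamentalChain K m ≫ (singularChains (TopCat.of (Realization K))).d m
      ((ComplexShape.down ℕ).next m) = 0 := by
  cases m with
  | zero => rw [(singularChains _).shape _ _ (by simp), Limits.comp_zero]
  | succ m =>
    rw [ChainComplex.next_nat_succ]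
    have two : ∀ {A : ModuleCat.{0} (ZMod 2)} (g : Coeff ⟶ A), (2 : ℕ) • g = 0 := by
      intro A g
      ext
      simp only [two_nsmul, ModuleCat.hom_add, LinearMap.add_apply, ModuleCat.hom_zero,
        LinearMap.zero_apply]
      rw [← two_smul (ZMod 2), show (2 : ZMod 2) = 0 from rfl, zero_smul]
    have sgn : ∀ {A : ModuleCat.{0} (ZMod 2)} (g : Coeff ⟶ A) (k : ℕ),
        ((-1 : ℤ) ^ k) • g = g := by
      intro A g k
      rcases neg_one_pow_eq_or ℤ k with h | h
      · rw [h, one_smul]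
      · rw [h, neg_smul, one_smul, neg_eq_iff_add_eq_zero, ← two_nsmul, two]
    rw [fundamentalChain, Preadditive.sum_comp]
    have step : ∀ s : Simplices K (m + 1),
        SSet.ιChainComplex (TopCat.toSSet.obj (TopCat.of (Realization K)))
          (singularSimplex K (m + 1) s) ≫
          (singularChains (TopCat.of (Realization K))).d (m + 1) m =
        ∑ i : Fin (m + 2), SSet.ιChainComplex (R := Coeff)
          (TopCat.toSSet.obj (TopCat.of (Realization K))) (singularSimplex K m (s.face i)) := by
      intro s
      refine (SSet.ιChainComplex_d _ _ _).trans (Finset.sum_congr rfl fun i _ => ?_)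
      rw [sgn, singularSimplex_face]
    rw [Finset.sum_congr rfl fun s _ => step s, ← Finset.sum_product',
      ← Finset.sum_fiberwise (g := fun p : Simplices K (m + 1) × Fin (m + 2) => p.1.face p.2)]
    refine Finset.sum_eq_zero fun t _ => ?_
    rw [Finset.sum_congr rfl (g := fun _ => SSet.ιChainComplex (R := Coeff)
      (TopCat.toSSet.obj (TopCat.of (Realization K))) (singularSimplex K m t))
      (fun p hp => by rw [(Finset.mem_filter.1 hp).2]), Finset.sum_const]
    have hcard : (Finset.filter (fun p : Simplices K (m + 1) × Fin (m + 2) => p.1.face p.2 = t)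
        (Finset.univ ×ˢ Finset.univ)).card =
        {s : Finset V | s ∈ K.faces ∧ s.card = m + 1 + 1 ∧ t.1 ⊆ s}.ncard := by
      rw [← Set.ncard_coe_finset]
      refine Set.ncard_congr (fun p _ => p.1.1) ?_ ?_ ?_
      · rintro ⟨s, i⟩ h
        simp only [Finset.coe_filter, Finset.mem_product, Finset.mem_univ, true_and] at h
        refine ⟨s.2.1, s.2.2, ?_⟩
        have h' : s.face i = t := h
        rw [← h']
        exact Finset.erase_subset _ _
      · rintro ⟨s, i⟩ ⟨s', i'⟩ h h' hs
        obtain rfl : s = s' := Subtype.ext hs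
        simp only [Finset.coe_filter, Finset.mem_product, Finset.mem_univ, true_and] at h h'
        have e : s.1.erase (s.1.orderEmbOfFin s.2.2 i) = s.1.erase (s.1.orderEmbOfFin s.2.2 i') :=
          congrArg Subtype.val ((show s.face i = t from h).trans (show s.face i' = t from h').symm)
        have := (Finset.erase_injOn s.1) (s.1.orderEmbOfFin_mem s.2.2 i)
          (s.1.orderEmbOfFin_mem s.2.2 i') e
        rw [(s.1.orderEmbOfFin s.2.2).injective this]
      · rintro s ⟨hs, hc, hts⟩
        have h1 : (s \ t.1).card = 1 := by
          rw [Finset.card_sdiff_of_subset hts, hc, t.2.2]; omega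
        obtain ⟨v, hv⟩ := Finset.card_eq_one.1 h1
        have hvs : v ∈ s \ t.1 := hv ▸ Finset.mem_singleton_self v
        rw [Finset.mem_sdiff] at hvs
        have hr : v ∈ Set.range (s.orderEmbOfFin hc) := by
          rw [Finset.range_orderEmbOfFin]; exact hvs.1
        obtain ⟨i, hi⟩ := hr
        refine ⟨(⟨s, hs, hc⟩, i), ?_, rfl⟩
        simp only [Finset.coe_filter, Finset.mem_product, Finset.mem_univ, true_and]
        change Simplices.face ⟨s, hs, hc⟩ i = t
        apply Subtype.ext
        change s.erase (s.orderEmbOfFin hc i) = t.1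
        rw [hi, Finset.erase_eq, ← hv, Finset.sdiff_sdiff_eq_self hts]
    rw [hcard]
    obtain ⟨r, hr⟩ := hK.even_ncard t.1 t.2.1 t.2.2
    rw [hr, ← two_mul, mul_comm, mul_smul, two, smul_zero]

/-- The fundamental class `[K] ∈ H_m(|K|; ℤ/2)`, represented by the sum of all `m`-simplices. -/
def fundamentalClass {K : AbstractSimplicialComplex V} {m : ℕ} (hK : IsModTwoCycle K m) :
    singularHomology m (TopCat.of (Realization K)) :=
  ((singularChains (TopCat.of (Realization K))).liftCycles (fundamentalChain K m) _ rfl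
      (fundamentalChain_comp_d hK) ≫
    (singularChains (TopCat.of (Realization K))).homologyπ m).hom (1 : ZMod 2)

/-! ### Degree modulo two -/

/-- The unit sphere `S^m` in `ℝ^{m+1}`. -/
abbrev Sphere (m : ℕ) : Type := Metric.sphere (0 : EuclideanSpace ℝ (Fin (m + 1))) 1

open Classical in
/-- The degree modulo two of a map `φ : |K| → S^m`: the image `φ_*[K] ∈ H_m(S^m; ℤ/2)` of the
fundamental class, where `H_m(S^m; ℤ/2) ≅ ℤ/2` has exactly one nonzero element for `m ≥ 1`.
For `m = 0` and `K` with an even number of points, `φ_*[K]` is a multiple of the generator of the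
reduced homology group `H̃_0(S^0; ℤ/2) ≅ ℤ/2`, that is, of the sum of the two points of `S^0`. -/
def degTwo {K : AbstractSimplicialComplex V} {m : ℕ} (hK : IsModTwoCycle K m)
    (φ : C(Realization K, Sphere m)) : ZMod 2 :=
  if singularHomologyMap m φ (fundamentalClass hK) = 0 then 0 else 1

/-! ### Essential cycles -/

/-- A fixed point free (continuous) involution of `X`. -/
structure IsFreeInvolution {X : Type} [TopologicalSpace X] (a : C(X, X)) : Prop where
  involutive : ∀ x, a (a x) = x
  free : ∀ x, a x ≠ x

/-- `φ` is equivariant for the involution `a` and the antipodal involution of `S^m`. -/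
def IsEquivariant {X : Type} [TopologicalSpace X] (a : C(X, X)) {m : ℕ} (φ : C(X, Sphere m)) :
    Prop :=
  ∀ x, φ (a x) = -φ x

/-- `(K, a)` is an essential `ℤ/2`-`m`-cycle. -/
structure IsEssentialCycle (K : AbstractSimplicialComplex V) (a : C(Realization K, Realization K))
    (m : ℕ) : Prop where
  isModTwoCycle : IsModTwoCycle K m
  isFreeInvolution : IsFreeInvolution a
  exists_odd : ∃ φ : C(Realization K, Sphere m),
    IsEquivariant a φ ∧ degTwo isModTwoCycle φ = 1

end

end

/-!
The degree modulo two of an equivariant map is computed combinatorially, and the result does not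
depend on the map.

*Labels.* An equivariant map `φ` to the sphere `S^m` assigns to each point `x` of `|K|` a signed
label `±i`, where `i` is a coordinate in which `φ x` is large, with its sign; the label of the
image of `x` under the involution `A` is the opposite one (`sphereLabel_neg`), and nearby points
do not have opposite labels. If `z` is a fine subdivision of the sum of all `m`-simplices (`fund K
m`), then the labels map `z` to a cycle in the boundary of the cross-polytope with vertices `±eᵢ`,
and the singular cycle `φ_* z` is homologous to the realization of this cycle, because `φ x` and
the vertex `±eᵢ` given by the label of `x` are on the same side of a hyperplane
(`exists_d_eq_add_toSingular_label`). In the boundary of the cross-polytope, an `m`-cycle whose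
alternation number (Fan's count of the alternating simplices, here the cochain `Label.fan`)
vanishes is a boundary (`Label.exists_bdry_of_fan_eq_zero`). So it is enough that the alternation
numbers of `z` for two equivariant labellings agree (`fan_map_fund_eq`).

*Comparison of two labellings.* The alternation cochain satisfies `fan (∂ c) = fan c + fan (-c)`
(`Label.fan_bdry`). Let `D` be the chain homotopy between two labellings with disjoint sets of
absolute values, so that small chains `c` still yield lists in `D c` without opposite labels; it
is equivariant. Applied to `D c`, the formula shows that `f c = fan (D c)` satisfies `f (c + A c)
= fan (ℓ₁ c) + fan (ℓ₂ c) + f (∂ c)`. The fundamental class is invariant under `A`, so that `z + A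
z = ∂ w` for a small chain `w`; hence `fan (ℓ₁ z) + fan (ℓ₂ z) = f (∂ w) = f (w + A w)`, the
labels of `w` contributing nothing for reasons of dimension. Now `w + A w` is a cycle of dimension
above `m`, therefore again a boundary `∂ w'`, and `f (w + A w) = f (w' + A w')`. Continuing, one
reaches the dimensions in which `f` vanishes, as a long list of finitely many labels, without
opposite pairs, has alternation number zero (`fan_labelHomotopy_add_eq_zero`).

*Invariance of the fundamental class.* If `z` and `A z` were not homologous, then `A z` would be
homologous to a simplicial cycle missing some `m`-simplex `τ`, and, applying `A`, the cycle `z`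
would be homologous to a cycle missing the interior of `A τ`. A local degree, defined through
Sperner's lemma, excludes this (`exists_localCochain`, `InvolutionOn.exists_bdry_eq_fund`).

All chains, except in the passage to singular homology, are chains on lists of points, with the
empty list in the degree of the augmentation; subdivisions and homotopies are built by coning.
Small cycles of `|K|` are compared with simplicial chains by `exists_simplicial_approx`.
-/

noncomputable section

open CategoryTheory

set_option linter.unusedSectionVars false

/-! ### Chains of lists modulo two -/

/-- Chains with `ℤ/2` coefficients on finite lists of points of `P`. A list of length `n` plays the
role of an (ordered, possibly degenerate) simplex of dimension `n - 1`, and the empty list that of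
the augmentation. All degrees are collected in one module. -/
abbrev ListChain (P : Type*) := List P →₀ ZMod 2

namespace ListChain

variable {P Q R : Type*}

/-- The basis element of a list. -/
abbrev of (l : List P) : ListChain P := Finsupp.single l 1

/-- The linear extension of a function on lists. -/
abbrev lift {M : Type*} [AddCommMonoid M] [Module (ZMod 2) M] (f : List P → M) :
    ListChain P →ₗ[ZMod 2] M :=
  Finsupp.linearCombination (ZMod 2) f

theorem lift_of {M : Type*} [AddCommMonoid M] [Module (ZMod 2) M] (f : List P → M) (l : List P) :
    lift f (of l) = f l := by
  simp [lift, of]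

theorem hom_ext {M : Type*} [AddCommMonoid M] [Module (ZMod 2) M]
    {f g : ListChain P →ₗ[ZMod 2] M} (h : ∀ l, f (of l) = g (of l)) : f = g := by
  ext l
  simpa using h l

theorem add_self {M : Type*} [AddCommGroup M] [Module (ZMod 2) M] (c : M) : c + c = 0 := by
  rw [← two_smul (ZMod 2), show (2 : ZMod 2) = 0 from rfl, zero_smul]

theorem add_eq_zero_iff {M : Type*} [AddCommGroup M] [Module (ZMod 2) M] {a b : M} :
    a + b = 0 ↔ a = b := by
  constructor
  · intro h
    have : a + b + b = b := by rw [h, zero_add]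
    rwa [add_assoc, add_self, add_zero] at this
  · rintro rfl
    exact add_self a

/-- Prepending the point `x` to all lists. -/
def cone (x : P) : ListChain P →ₗ[ZMod 2] ListChain P := lift fun l => of (x :: l)

@[simp] theorem cone_of (x : P) (l : List P) : cone x (of l) = of (x :: l) := lift_of _ _

/-- The map of chains induced by a map of points. -/
def map (f : P → Q) : ListChain P →ₗ[ZMod 2] ListChain Q := lift fun l => of (l.map f)

@[simp] theorem map_of (f : P → Q) (l : List P) : map f (of l) = of (l.map f) := lift_of _ _

theorem map_map (g : Q → R) (f : P → Q) (c : ListChain P) : map g (map f c) = map (g ∘ f) c := by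
  have : (map g).comp (map f) = map (g ∘ f) := hom_ext fun l => by simp
  exact LinearMap.congr_fun this c

theorem map_id (c : ListChain P) : map (id : P → P) c = c := by
  have : map (id : P → P) = LinearMap.id := hom_ext fun l => by simp
  exact LinearMap.congr_fun this c

theorem map_cone (f : P → Q) (x : P) (c : ListChain P) :
    map f (cone x c) = cone (f x) (map f c) := by
  have : (map f).comp (cone x) = (cone (f x)).comp (map f) := hom_ext fun l => by simp
  exact LinearMap.congr_fun this c

/-- The boundary operator: the sum of all faces. The boundary of a list of length one is the
empty list, so that the complexes obtained are augmented. -/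
def bdry : ListChain P →ₗ[ZMod 2] ListChain P :=
  lift fun l => ∑ i : Fin l.length, of (l.eraseIdx i)

theorem bdry_of (l : List P) : bdry (of l) = ∑ i : Fin l.length, of (l.eraseIdx i) := lift_of _ _

@[simp] theorem bdry_nil : bdry (of ([] : List P)) = 0 := by simp [bdry_of]

theorem bdry_cons (x : P) (l : List P) :
    bdry (of (x :: l)) = of l + cone x (bdry (of l)) := by
  simp only [bdry_of, map_sum, cone_of]
  rw [List.length_cons, Fin.sum_univ_succ]
  simp

theorem bdry_cone (x : P) (c : ListChain P) : bdry (cone x c) = c + cone x (bdry c) := by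
  have : bdry.comp (cone x) = LinearMap.id + (cone x).comp bdry := hom_ext fun l => by
    simp [bdry_cons]
  exact LinearMap.congr_fun this c

theorem bdry_bdry (c : ListChain P) : bdry (bdry c) = 0 := by
  have : (bdry (P := P)).comp bdry = 0 := hom_ext fun l => by
    induction l with
    | nil => simp
    | cons x l ih =>
      simp only [LinearMap.comp_apply, LinearMap.zero_apply] at ih ⊢
      rw [bdry_cons, map_add, bdry_cone, ih, map_zero, add_zero, add_self]
  exact LinearMap.congr_fun this c

theorem bdry_map (f : P → Q) (c : ListChain P) : bdry (map f c) = map f (bdry c) := by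
  have : bdry.comp (map f) = (map f).comp bdry := hom_ext fun l => by
    induction l with
    | nil => simp
    | cons x l ih =>
      simp only [LinearMap.comp_apply, map_of] at ih ⊢
      rw [List.map_cons, bdry_cons, bdry_cons, ih, map_add, map_of, map_cone]
  exact LinearMap.congr_fun this c

/-! ### Supports -/

/-- The chains all of whose lists satisfy `p`. -/
abbrev On (p : List P → Prop) : Submodule (ZMod 2) (ListChain P) :=
  Finsupp.supported (ZMod 2) (ZMod 2) {l | p l}

theorem of_mem_on {p : List P → Prop} {l : List P} (h : p l) : of l ∈ On p :=
  Finsupp.single_mem_supported _ _ h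

/-- To check that a linear map sends the chains on `p` into a submodule, it suffices to look at
the lists satisfying `p`. -/
theorem map_mem_of_on {M : Type*} [AddCommMonoid M] [Module (ZMod 2) M] {p : List P → Prop}
    (f : ListChain P →ₗ[ZMod 2] M) (S : Submodule (ZMod 2) M) (h : ∀ l, p l → f (of l) ∈ S)
    {c : ListChain P} (hc : c ∈ On p) : f c ∈ S := by
  rw [On, Finsupp.supported_eq_span_single] at hc
  refine Submodule.span_induction (p := fun c _ => f c ∈ S) ?_ ?_ ?_ ?_ hc
  · rintro _ ⟨l, hl, rfl⟩
    exact h l hl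
  · simp
  · intro x y _ _ hx hy
    rw [map_add]
    exact S.add_mem hx hy
  · intro a x _ hx
    rw [map_smul]
    exact S.smul_mem a hx

theorem eqOn_of_on {M : Type*} [AddCommGroup M] [Module (ZMod 2) M] {p : List P → Prop}
    (f g : ListChain P →ₗ[ZMod 2] M) (h : ∀ l, p l → f (of l) = g (of l))
    {c : ListChain P} (hc : c ∈ On p) : f c = g c := by
  have := map_mem_of_on (f - g) ⊥ (p := p) (fun l hl => by simp [h l hl]) hc
  simpa [sub_eq_zero] using this

theorem apply_eq_zero_of_on {M : Type*} [AddCommGroup M] [Module (ZMod 2) M] {p : List P → Prop}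
    (f : ListChain P →ₗ[ZMod 2] M) (h : ∀ l, p l → f (of l) = 0)
    {c : ListChain P} (hc : c ∈ On p) : f c = 0 := by
  rw [eqOn_of_on f 0 (fun l hl => by rw [h l hl, LinearMap.zero_apply]) hc, LinearMap.zero_apply]

theorem on_mono {p q : List P → Prop} (h : ∀ l, p l → q l) {c : ListChain P} (hc : c ∈ On p) :
    c ∈ On q :=
  Finsupp.supported_mono h hc

theorem on_and {p q : List P → Prop} {c : ListChain P} (hp : c ∈ On p) (hq : c ∈ On q) :
    c ∈ On fun l => p l ∧ q l := by
  rw [Finsupp.mem_supported] at *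
  exact fun l hl => ⟨hp hl, hq hl⟩

theorem map_mem_on {p : List P → Prop} {q : List Q → Prop} (f : P → Q)
    (h : ∀ l, p l → q (l.map f)) {c : ListChain P} (hc : c ∈ On p) : map f c ∈ On q :=
  map_mem_of_on _ _ (fun l hl => by rw [map_of]; exact of_mem_on (h l hl)) hc

theorem cone_mem_on {p q : List P → Prop} (x : P)
    (h : ∀ l, p l → q (x :: l)) {c : ListChain P} (hc : c ∈ On p) : cone x c ∈ On q :=
  map_mem_of_on _ _ (fun l hl => by rw [cone_of]; exact of_mem_on (h l hl)) hc

theorem bdry_mem_on {p q : List P → Prop}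
    (h : ∀ l, p l → ∀ i < l.length, q (l.eraseIdx i)) {c : ListChain P} (hc : c ∈ On p) :
    bdry c ∈ On q :=
  map_mem_of_on _ _ (fun l hl => by
    rw [bdry_of]
    exact Submodule.sum_mem _ fun i _ => of_mem_on (h l hl i i.2)) hc

/-- The lists of points of the set `C`. -/
abbrev InSet (C : Set P) (l : List P) : Prop := ∀ x ∈ l, x ∈ C

theorem inSet_nil (C : Set P) : InSet C [] := fun _ h => absurd h List.not_mem_nil

theorem InSet.eraseIdx {C : Set P} {l : List P} (h : InSet C l) (i : ℕ) :
    InSet C (l.eraseIdx i) :=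
  fun x hx => h x (List.mem_of_mem_eraseIdx hx)

theorem length_eraseIdx_add_one {l : List P} {i : ℕ} (h : i < l.length) :
    (l.eraseIdx i).length + 1 = l.length := by
  rw [List.length_eraseIdx, if_pos h]
  omega

/-! ### Operators defined by coning -/

/-- The operator defined on nonempty lists by the recursion `R l = x(l) * (A l + R (∂ l))`, where
`x(l) *` denotes the cone with apex `x(l)`. Barycentric subdivision and the usual chain homotopies
have this form. -/
def coneRecList (init : ListChain Q) (A : List P → ListChain Q) (x : List P → Q) :
    List P → ListChain Q
  | [] => init
  | y :: l => cone (x (y :: l)) (A (y :: l) +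
      ∑ i : Fin (y :: l).length, coneRecList init A x ((y :: l).eraseIdx i))
termination_by l => l.length
decreasing_by
  have := length_eraseIdx_add_one i.2
  omega

/-- The linear extension of `coneRecList`. -/
def coneRec (init : ListChain Q) (A : ListChain P →ₗ[ZMod 2] ListChain Q) (x : List P → Q) :
    ListChain P →ₗ[ZMod 2] ListChain Q :=
  lift (coneRecList init (fun l => A (of l)) x)

section coneRec

variable (init : ListChain Q) (A : ListChain P →ₗ[ZMod 2] ListChain Q) (x : List P → Q)

theorem coneRec_nil : coneRec init A x (of []) = init := by
  rw [coneRec, lift_of, coneRecList]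

theorem coneRec_of {l : List P} (hl : l ≠ []) :
    coneRec init A x (of l) = cone (x l) (A (of l) + coneRec init A x (bdry (of l))) := by
  cases l with
  | nil => exact absurd rfl hl
  | cons y l =>
    rw [bdry_of, map_sum]
    simp only [coneRec, lift_of]
    rw [coneRecList]

theorem coneRec_mem_inSet {init : ListChain Q} {A : ListChain P →ₗ[ZMod 2] ListChain Q}
    {x : List P → Q} {B : Set P} {C : Set Q} (hinit : init ∈ On (InSet C))
    (hx : ∀ l, l ≠ [] → InSet B l → x l ∈ C) (hA : ∀ l, InSet B l → A (of l) ∈ On (InSet C)) :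
    ∀ l, InSet B l → coneRec init A x (of l) ∈ On (InSet C) := by
  intro l
  induction hn : l.length using Nat.strong_induction_on generalizing l with
  | _ n ih =>
    intro hl
    rcases eq_or_ne l [] with rfl | h0
    · rwa [coneRec_nil]
    · rw [coneRec_of _ _ _ h0]
      refine cone_mem_on (p := InSet C) _ (fun l' hl' => ?_) (Submodule.add_mem _ (hA l hl) ?_)
      · intro y hy
        rcases List.mem_cons.1 hy with rfl | hy
        · exact hx l h0 hl
        · exact hl' y hy
      · rw [bdry_of, map_sum]
        refine Submodule.sum_mem _ fun i _ => ?_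
        have := length_eraseIdx_add_one i.2
        exact ih _ (by omega) _ rfl (hl.eraseIdx i)

end coneRec

/-! ### Subdivision operators -/

/-- The subdivision with barycentre function `b`: `S [] = []` and `S l = b(l) * S (∂ l)`. -/
def subdiv (b : List P → P) : ListChain P →ₗ[ZMod 2] ListChain P := coneRec (of []) 0 b

section subdiv

variable (b : List P → P)

theorem subdiv_nil : subdiv b (of []) = of [] := coneRec_nil _ _ _

theorem subdiv_of {l : List P} (hl : l ≠ []) :
    subdiv b (of l) = cone (b l) (subdiv b (bdry (of l))) := by
  rw [subdiv, coneRec_of _ _ _ hl, LinearMap.zero_apply, zero_add]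

theorem bdry_subdiv (c : ListChain P) : bdry (subdiv b c) = subdiv b (bdry c) := by
  have key : ∀ (n : ℕ) (l : List P), l.length = n →
      bdry (subdiv b (of l)) = subdiv b (bdry (of l)) := by
    intro n
    induction n with
    | zero =>
      intro l hl
      rw [List.length_eq_zero_iff.1 hl, subdiv_nil, bdry_nil, map_zero]
    | succ n ih =>
      intro l hl
      have h0 : l ≠ [] := by rintro rfl; simp at hl
      have : bdry (subdiv b (bdry (of l))) = subdiv b (bdry (bdry (of l))) := by
        rw [bdry_of, map_sum, map_sum, map_sum, map_sum]
        refine Finset.sum_congr rfl fun i _ => ih _ ?_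
        have := length_eraseIdx_add_one i.2
        omega
      rw [subdiv_of b h0, bdry_cone, this, bdry_bdry, map_zero, map_zero, add_zero]
  have : bdry.comp (subdiv b) = (subdiv b).comp bdry := hom_ext fun l => key _ l rfl
  exact LinearMap.congr_fun this c

theorem subdiv_mem_inSet {b : List P → P} {C : Set P} (hb : ∀ l, l ≠ [] → InSet C l → b l ∈ C) :
    ∀ l, InSet C l → subdiv b (of l) ∈ On (InSet C) :=
  coneRec_mem_inSet (of_mem_on (inSet_nil C)) hb (fun _ _ => Submodule.zero_mem _)

theorem subdiv_mem_length {n : ℕ} : ∀ l : List P, l.length = n →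
    subdiv b (of l) ∈ On (fun l => l.length = n) := by
  induction n with
  | zero =>
    intro l hl
    rw [List.length_eq_zero_iff.1 hl, subdiv_nil]
    exact of_mem_on rfl
  | succ n ih =>
    intro l hl
    have h0 : l ≠ [] := by rintro rfl; simp at hl
    rw [subdiv_of b h0, bdry_of, map_sum]
    refine cone_mem_on (p := fun l => l.length = n) _ (by simp)
      (Submodule.sum_mem _ fun i _ => ih _ ?_)
    have := length_eraseIdx_add_one i.2
    omega

end subdiv

/-! ### Chain homotopies -/

/-- The chain homotopy between two chain maps `A` and `B` obtained by coning with apex `x(l)`. -/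
def homotopy (A B : ListChain P →ₗ[ZMod 2] ListChain Q) (x : List P → Q) :
    ListChain P →ₗ[ZMod 2] ListChain Q := coneRec 0 (A + B) x

section homotopy

variable {A B : ListChain P →ₗ[ZMod 2] ListChain Q} (x : List P → Q)

theorem homotopy_nil : homotopy A B x (of []) = 0 := coneRec_nil _ _ _

theorem homotopy_of {l : List P} (hl : l ≠ []) :
    homotopy A B x (of l) = cone (x l) (A (of l) + B (of l) + homotopy A B x (bdry (of l))) := by
  rw [homotopy, coneRec_of _ _ _ hl, LinearMap.add_apply]

theorem bdry_homotopy (hA : ∀ c, bdry (A c) = A (bdry c)) (hB : ∀ c, bdry (B c) = B (bdry c))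
    (h0 : A (of []) = B (of [])) (c : ListChain P) :
    bdry (homotopy A B x c) = A c + B c + homotopy A B x (bdry c) := by
  have key : ∀ (n : ℕ) (l : List P), l.length = n →
      bdry (homotopy A B x (of l)) = A (of l) + B (of l) + homotopy A B x (bdry (of l)) := by
    intro n
    induction n with
    | zero =>
      intro l hl
      rw [List.length_eq_zero_iff.1 hl, homotopy_nil, bdry_nil, map_zero, h0, add_self, map_zero,
        add_zero]
    | succ n ih =>
      intro l hl
      have hl0 : l ≠ [] := by rintro rfl; simp at hl
      have : bdry (homotopy A B x (bdry (of l))) =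
          A (bdry (of l)) + B (bdry (of l)) + homotopy A B x (bdry (bdry (of l))) := by
        rw [bdry_of]
        simp only [map_sum]
        rw [← Finset.sum_add_distrib, ← Finset.sum_add_distrib]
        refine Finset.sum_congr rfl fun i _ => ih _ ?_
        have := length_eraseIdx_add_one i.2
        omega
      rw [homotopy_of x hl0, bdry_cone, map_add, this, map_add bdry, hA, hB, bdry_bdry, map_zero,
        add_zero, add_self, map_zero, add_zero]
  have : bdry.comp (homotopy A B x) = A + B + (homotopy A B x).comp bdry :=
    hom_ext fun l => key _ l rfl
  exact LinearMap.congr_fun this c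

theorem homotopy_mem_inSet {x : List P → Q} {D : Set P} {C : Set Q}
    (hx : ∀ l, l ≠ [] → InSet D l → x l ∈ C)
    (hA : ∀ l, InSet D l → A (of l) ∈ On (InSet C))
    (hB : ∀ l, InSet D l → B (of l) ∈ On (InSet C)) :
    ∀ l, InSet D l → homotopy A B x (of l) ∈ On (InSet C) :=
  coneRec_mem_inSet (Submodule.zero_mem _) hx
    (fun l hl => Submodule.add_mem _ (hA l hl) (hB l hl))

theorem homotopy_mem_length
    (hA : ∀ n l, l.length = n → A (of l) ∈ On (fun l => l.length = n))
    (hB : ∀ n l, l.length = n → B (of l) ∈ On (fun l => l.length = n)) {n : ℕ} :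
    ∀ l : List P, l.length = n → homotopy A B x (of l) ∈ On (fun l => l.length = n + 1) := by
  induction n with
  | zero =>
    intro l hl
    rw [List.length_eq_zero_iff.1 hl, homotopy_nil]
    exact Submodule.zero_mem _
  | succ n ih =>
    intro l hl
    have h0 : l ≠ [] := by rintro rfl; simp at hl
    rw [homotopy_of x h0, bdry_of, map_sum]
    refine cone_mem_on (p := fun l => l.length = n + 1) _ (by simp) (Submodule.add_mem _
      (Submodule.add_mem _ (hA _ l hl) (hB _ l hl)) (Submodule.sum_mem _ fun i _ => ih _ ?_))
    have := length_eraseIdx_add_one i.2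
    omega

end homotopy

/-! ### Symmetric functions of lists -/

/-- The value of a symmetric function on the boundary of a list does not depend on the order. -/
theorem apply_bdry_perm {M : Type*} [AddCommGroup M] [Module (ZMod 2) M]
    (f : ListChain P →ₗ[ZMod 2] M) (hf : ∀ l l' : List P, l.Perm l' → f (of l) = f (of l'))
    {l l' : List P} (h : l.Perm l') : f (bdry (of l)) = f (bdry (of l')) := by
  induction h generalizing f with
  | nil => rfl
  | cons x h ih =>
    simp only [bdry_cons, map_add]
    rw [hf _ _ h]
    congr 1
    exact ih (f.comp (cone x)) fun l l' h => by simpa using hf _ _ (h.cons x)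
  | swap x y l =>
    simp only [bdry_cons, map_add, cone_of]
    have : f.comp ((cone y).comp (cone x)) = f.comp ((cone x).comp (cone y)) :=
      hom_ext fun l => by simpa using hf _ _ (List.Perm.swap x y l)
    have := LinearMap.congr_fun this (bdry (of l))
    simp only [LinearMap.comp_apply] at this
    rw [this]
    abel
  | trans _ _ h1 h2 => exact (h1 f hf).trans (h2 f hf)

/-- A symmetric function which vanishes on the lists with a repetition vanishes on the boundaries
of such lists: the two faces omitting a repeated point cancel. -/
theorem apply_bdry_eq_zero_of_not_nodup {M : Type*} [AddCommGroup M] [Module (ZMod 2) M]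
    (f : ListChain P →ₗ[ZMod 2] M) (hf : ∀ l l' : List P, l.Perm l' → f (of l) = f (of l'))
    (h0 : ∀ l : List P, ¬ l.Nodup → f (of l) = 0) {l : List P} (hl : ¬ l.Nodup) :
    f (bdry (of l)) = 0 := by
  obtain ⟨x, hx⟩ := List.exists_duplicate_iff_not_nodup.2 hl
  obtain ⟨l', h'⟩ : ∃ l', l.Perm (x :: x :: l') := by
    obtain ⟨l', h'⟩ := (List.duplicate_iff_sublist.1 hx).exists_perm_append
    exact ⟨l', h'⟩
  rw [apply_bdry_perm f hf h', bdry_cons, bdry_cons, map_add, map_add, map_add, cone_of,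
    ← add_assoc, add_self, zero_add]
  have key : ∀ c : ListChain P, f (cone x (cone x c)) = 0 := fun c => by
    have : f.comp ((cone x).comp (cone x)) = 0 := hom_ext fun l => by
      simpa using h0 (x :: x :: l) (by simp)
    exact LinearMap.congr_fun this c
  exact key _

theorem subdiv_perm {b : List P → P} (hb : ∀ l l' : List P, l.Perm l' → b l = b l') :
    ∀ l l' : List P, l.Perm l' → subdiv b (of l) = subdiv b (of l') := by
  intro l
  induction hn : l.length using Nat.strong_induction_on generalizing l with
  | _ n ih =>
    intro l' h
    rcases eq_or_ne l [] with rfl | h0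
    · rw [List.nil_perm.1 h]
    have h0' : l' ≠ [] := by rintro rfl; exact h0 (List.perm_nil.1 h)
    rw [subdiv_of b h0, subdiv_of b h0', hb _ _ h]
    congr 1
    -- The restriction of the operator to the shorter lists is symmetric.
    let f : ListChain P →ₗ[ZMod 2] ListChain P :=
      lift fun l => if l.length < n then subdiv b (of l) else 0
    have hf : ∀ l l' : List P, l.Perm l' → f (of l) = f (of l') := fun l₁ l₂ h₁ => by
      simp only [f, lift_of, h₁.length_eq]
      split_ifs with hlt
      · exact ih _ (h₁.length_eq ▸ hlt) l₁ rfl l₂ h₁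
      · rfl
    have hfe : ∀ l₁ : List P, l₁.length = n → f (bdry (of l₁)) = subdiv b (bdry (of l₁)) := by
      intro l₁ h₁
      simp only [bdry_of, map_sum]
      refine Finset.sum_congr rfl fun i _ => ?_
      have := length_eraseIdx_add_one i.2
      simp only [f, lift_of]
      rw [if_pos (by omega)]
    rw [← hfe l hn, ← hfe l' (h.length_eq ▸ hn)]
    exact apply_bdry_perm f hf h

theorem subdiv_eq_zero_of_not_nodup {b : List P → P}
    (hb : ∀ l l' : List P, l.Perm l' → b l = b l') :
    ∀ l : List P, ¬ l.Nodup → subdiv b (of l) = 0 := by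
  intro l
  induction hn : l.length using Nat.strong_induction_on generalizing l with
  | _ n ih =>
    intro h
    have h0 : l ≠ [] := by rintro rfl; simp at h
    rw [subdiv_of b h0]
    let f : ListChain P →ₗ[ZMod 2] ListChain P :=
      lift fun l => if l.length < n then subdiv b (of l) else 0
    have hf : ∀ l l' : List P, l.Perm l' → f (of l) = f (of l') := fun l₁ l₂ h₁ => by
      simp only [f, lift_of, h₁.length_eq, subdiv_perm hb l₁ l₂ h₁]
    have hfe : f (bdry (of l)) = subdiv b (bdry (of l)) := by
      simp only [bdry_of, map_sum]
      refine Finset.sum_congr rfl fun i _ => ?_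
      have := length_eraseIdx_add_one i.2
      simp only [f, lift_of]
      rw [if_pos (by omega)]
    rw [← hfe, apply_bdry_eq_zero_of_not_nodup f hf (fun l₁ h₁ => ?_) h, map_zero]
    simp only [f, lift_of]
    split_ifs with hlt
    · exact ih _ hlt l₁ rfl h₁
    · rfl

end ListChain

/-! ### The alternation cochain -/

open ListChain

/-- Signed labels: the label `(i, true)` stands for `+i` and `(i, false)` for `-i`. -/
abbrev Label : Type := ℕ × Bool

namespace Label

/-- The opposite label. -/
abbrev neg (x : Label) : Label := (x.1, !x.2)

theorem neg_comp_neg : neg ∘ neg = id := by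
  funext x
  simp [neg]

/-- The sign of a label, as an element of `ℤ/2`. -/
def sgn (x : Label) : ZMod 2 := if x.2 then 1 else 0

theorem sgn_neg (x : Label) : sgn (neg x) = 1 + sgn x := by
  rcases x with ⟨i, _ | _⟩
  · rfl
  · rfl

theorem sgn_mul_sgn_neg (x : Label) : sgn x * sgn (neg x) = 0 := by
  rcases x with ⟨i, _ | _⟩
  · rfl
  · rfl

/-- The first label of least absolute value in a list (and `-0` for the empty list). -/
def least : List Label → Label
  | [] => (0, false)
  | [x] => x
  | x :: y :: l => if x.1 ≤ (least (y :: l)).1 then x else least (y :: l)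

theorem least_mem : ∀ {l : List Label}, l ≠ [] → least l ∈ l
  | [x], _ => by simp [least]
  | x :: y :: l, _ => by
    rw [least]
    split_ifs
    · simp
    · exact List.mem_cons_of_mem _ (least_mem (by simp))

theorem least_le : ∀ {l : List Label} {x : Label}, x ∈ l → (least l).1 ≤ x.1
  | [x], z, hz => by
    obtain rfl : z = x := by simpa using hz
    rfl
  | x :: y :: l, z, hz => by
    have h : ∀ w ∈ y :: l, (least (y :: l)).1 ≤ w.1 := fun w hw => least_le hw
    rw [least]
    rcases List.mem_cons.1 hz with rfl | hz
    · split_ifs with h1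
      · rfl
      · omega
    · have := h z hz
      split_ifs with h1 <;> omega

theorem least_map {j : Label → Label} (hj : ∀ x y : Label, (j x).1 ≤ (j y).1 ↔ x.1 ≤ y.1) :
    ∀ {l : List Label}, l ≠ [] → least (l.map j) = j (least l)
  | [x], _ => by simp [least]
  | x :: y :: l, _ => by
    have h : least ((y :: l).map j) = j (least (y :: l)) := least_map hj (by simp)
    rw [List.map_cons] at h
    rw [List.map_cons, List.map_cons, least, least, h]
    simp only [hj]
    split_ifs <;> rfl

/-- The list contains no two opposite labels. -/
def NoCompl (l : List Label) : Prop := ∀ x ∈ l, neg x ∉ l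

theorem NoCompl.of_subset {l l' : List Label} (h : NoCompl l) (hl : l' ⊆ l) : NoCompl l' :=
  fun x hx hx' => h x (hl hx) (hl hx')

theorem NoCompl.eq {l : List Label} (h : NoCompl l) {x y : Label} (hx : x ∈ l) (hy : y ∈ l)
    (hxy : x.1 = y.1) : x = y := by
  refine Prod.ext hxy ?_
  by_contra hne
  refine h x hx ?_
  have : neg x = y := Prod.ext hxy (by
    change (!x.2) = y.2
    cases h1 : x.2 <;> cases h2 : y.2 <;> simp_all)
  rwa [this]

theorem NoCompl.map_neg {l : List Label} (h : NoCompl l) : NoCompl (l.map neg) := by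
  intro x hx hx'
  obtain ⟨y, hy, rfl⟩ := List.mem_map.1 hx
  obtain ⟨z, hz, hzy⟩ := List.mem_map.1 hx'
  have : z = neg y := by
    have := congrArg neg hzy
    simpa [neg] using this
  exact h y hy (this ▸ hz)

/-- The alternation cochain on lists: `1` on the empty list, and on a nonempty list `l` the sign of
the label of least absolute value times the value on the opposite of the boundary of `l`. -/
def fanList : List Label → ZMod 2
  | [] => 1
  | x :: l => sgn (least (x :: l)) *
      ∑ i : Fin (x :: l).length, fanList (((x :: l).eraseIdx i).map neg)
termination_by l => l.length
decreasing_by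
  have := length_eraseIdx_add_one i.2
  rw [List.length_map]
  omega

/-- The linear extension of `fanList`. -/
def fan : ListChain Label →ₗ[ZMod 2] ZMod 2 := lift fanList

theorem fan_nil : fan (of []) = 1 := by
  rw [fan, lift_of, fanList]

theorem fan_of {l : List Label} (hl : l ≠ []) :
    fan (of l) = sgn (least l) * fan (map neg (bdry (of l))) := by
  cases l with
  | nil => exact absurd rfl hl
  | cons x l =>
    rw [bdry_of, map_sum, map_sum]
    simp only [map_of]
    simp only [fan, lift_of]
    rw [fanList]

theorem map_neg_map_neg (c : ListChain Label) : map neg (map neg c) = c := by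
  rw [map_map, neg_comp_neg, ListChain.map_id]

theorem neg_le_neg_iff (x y : Label) : (neg x).1 ≤ (neg y).1 ↔ x.1 ≤ y.1 := Iff.rfl

/-- The coboundary of the alternation cochain is its sum with its image under the antipode. -/
theorem fan_bdry (c : ListChain Label) : fan (bdry c) = fan c + fan (map neg c) := by
  have key : ∀ (n : ℕ) (l : List Label), l.length = n →
      fan (bdry (of l)) = fan (of l) + fan (map neg (of l)) := by
    intro n
    induction n with
    | zero =>
      intro l hl
      rw [List.length_eq_zero_iff.1 hl, map_of, List.map_nil, add_self, bdry_nil, map_zero]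
    | succ n ih =>
      intro l hl
      have h0 : l ≠ [] := by rintro rfl; simp at hl
      have h1 : fan (bdry (bdry (of l))) = fan (bdry (of l)) + fan (map neg (bdry (of l))) := by
        rw [bdry_of]
        simp only [map_sum]
        rw [← Finset.sum_add_distrib]
        refine Finset.sum_congr rfl fun i _ => ih _ ?_
        have := length_eraseIdx_add_one i.2
        omega
      rw [bdry_bdry, map_zero, eq_comm, add_eq_zero_iff] at h1
      have h2 : fan (map neg (of l)) = (1 + sgn (least l)) * fan (bdry (of l)) := by
        rw [map_of, fan_of (by simpa using h0), least_map neg_le_neg_iff h0, sgn_neg, ← map_of,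
          bdry_map, map_neg_map_neg]
      rw [h2, fan_of h0, ← h1, ← add_mul, add_left_comm, add_self, add_zero, one_mul]
  have : fan.comp bdry = fan + fan.comp (map neg) := hom_ext fun l => key _ l rfl
  exact LinearMap.congr_fun this c

theorem fan_map {j : Label → Label} (hj : ∀ x y : Label, (j x).1 ≤ (j y).1 ↔ x.1 ≤ y.1)
    (hs : ∀ x, (j x).2 = x.2) (hn : ∀ x, neg (j x) = j (neg x)) (c : ListChain Label) :
    fan (map j c) = fan c := by
  have key : ∀ (n : ℕ) (l : List Label), l.length = n → fan (map j (of l)) = fan (of l) := by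
    intro n
    induction n with
    | zero =>
      intro l hl
      rw [List.length_eq_zero_iff.1 hl, map_of, List.map_nil]
    | succ n ih =>
      intro l hl
      have h0 : l ≠ [] := by rintro rfl; simp at hl
      have hc : neg ∘ j = j ∘ neg := funext hn
      rw [map_of, fan_of (by simpa using h0), least_map hj h0, fan_of h0, ← map_of, bdry_map,
        map_map, hc, ← map_map]
      congr 1
      · simp only [sgn, hs]
      · rw [bdry_of]
        simp only [map_sum]
        refine Finset.sum_congr rfl fun i _ => ?_
        rw [map_of]
        refine ih _ ?_
        have := length_eraseIdx_add_one i.2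
        rw [List.length_map]
        omega
  have : fan.comp (map j) = fan := hom_ext fun l => key _ l rfl
  exact LinearMap.congr_fun this c

/-- The lists without opposite labels, with absolute values in the interval `[k, M)`: the
(ordered) simplices of the boundary of a crosspolytope. -/
def Octa (k M : ℕ) (l : List Label) : Prop := NoCompl l ∧ ∀ x ∈ l, k ≤ x.1 ∧ x.1 < M

/-- A face which still contains the label of least absolute value does not contribute to the
recursion for the alternation cochain. -/
theorem sgn_mul_fan_eq_zero {b : Label} {l : List Label} (hl : NoCompl l) (hb : b ∈ l)
    (hle : ∀ x ∈ l, b.1 ≤ x.1) : sgn b * fan (of (l.map neg)) = 0 := by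
  have h0 : l ≠ [] := List.ne_nil_of_mem hb
  have : least l = b :=
    hl.eq (least_mem h0) hb (le_antisymm (least_le hb) (hle _ (least_mem h0)))
  rw [fan_of (by simpa using h0), least_map neg_le_neg_iff h0, this, ← mul_assoc,
    sgn_mul_sgn_neg, zero_mul]

/-- The alternation cochain vanishes on the lists that are longer than the number of available
absolute values. -/
theorem fan_eq_zero {M : ℕ} : ∀ {k : ℕ} {l : List Label}, k ≤ M → Octa k M l →
    M < l.length + k → fan (of l) = 0 := by
  intro k l
  induction hn : l.length generalizing k l with
  | zero => intro h1 _ h2; omega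
  | succ n ih =>
    intro hk hl hlt
    have h0 : l ≠ [] := by rintro rfl; simp at hn
    rw [fan_of h0, bdry_of, map_sum, map_sum, Finset.mul_sum]
    refine Finset.sum_eq_zero fun i _ => ?_
    have hsub : l.eraseIdx i ⊆ l := fun x hx => List.mem_of_mem_eraseIdx hx
    have hlen := length_eraseIdx_add_one i.2
    rw [map_of]
    by_cases hb : least l ∈ l.eraseIdx i
    · exact sgn_mul_fan_eq_zero (hl.1.of_subset hsub) hb fun x hx => least_le (hsub hx)
    · have hbl := hl.2 _ (least_mem h0)
      rw [ih (k := (least l).1 + 1) (by rw [List.length_map]; omega) (by omega)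
        ⟨(hl.1.of_subset hsub).map_neg, ?_⟩ (by omega), mul_zero]
      intro x hx
      obtain ⟨y, hy, rfl⟩ := List.mem_map.1 hx
      have h1 := hl.2 y (hsub hy)
      have h2 := least_le (hsub hy)
      have h3 : (least l).1 ≠ y.1 := fun h =>
        hb (hl.1.eq (least_mem h0) (hsub hy) h ▸ hy)
      change _ ≤ y.1 ∧ y.1 < M
      omega

theorem fan_eq_zero_of_on {k M : ℕ} (hk : k ≤ M) {n : ℕ} (hn : M < n + k) {c : ListChain Label}
    (hc : c ∈ On fun l => Octa k M l ∧ l.length = n) : fan c = 0 :=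
  apply_eq_zero_of_on fan (fun _ hl => fan_eq_zero hk hl.1 (by rw [hl.2]; exact hn)) hc

/-! ### The top homology of the boundary of a crosspolytope -/

theorem Octa.cons {k M : ℕ} {b : Bool} {l : List Label} (hk : k < M) (h : Octa k M l)
    (hb : neg (k, b) ∉ l) : Octa k M ((k, b) :: l) := by
  refine ⟨?_, ?_⟩
  · intro x hx hx'
    rcases List.mem_cons.1 hx with rfl | hx
    · rcases List.mem_cons.1 hx' with h' | h'
      · exact absurd (congrArg Prod.snd h') (by simp)
      · exact hb h'
    · rcases List.mem_cons.1 hx' with h' | h'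
      · refine hb ?_
        rw [← h']
        simpa [neg] using hx
      · exact h.1 x hx h'
  · intro x hx
    rcases List.mem_cons.1 hx with rfl | hx
    · exact ⟨le_rfl, hk⟩
    · exact h.2 x hx

theorem Octa.mono {k k' M : ℕ} {l : List Label} (h : Octa k M l) (hk : k' ≤ k) : Octa k' M l :=
  ⟨h.1, fun x hx => ⟨hk.trans (h.2 x hx).1, (h.2 x hx).2⟩⟩

theorem fan_cone_add_fan_cone {k M : ℕ} {y : ListChain Label} (hy : y ∈ On (Octa (k + 1) M))
    (hk : k < M) (hy0 : bdry y = 0) :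
    fan (cone (k, true) y) + fan (cone (k, false) y) = fan y := by
  have h2 : fan (map neg y) = fan y := by
    have := fan_bdry y
    rw [hy0, map_zero, eq_comm, add_eq_zero_iff] at this
    exact this.symm
  rw [← h2, ← map_add]
  refine eqOn_of_on (fan.comp (cone (k, true) + cone (k, false))) (fan.comp (map neg))
    (fun l hl => ?_) hy
  have hlk : ∀ b, (k, b) ∉ l := fun b hb => by
    have := (hl.2 _ hb).1
    simp at this
  have hle : ∀ b, least ((k, b) :: l) = (k, b) := fun b =>
    ((hl.mono (Nat.le_succ k)).cons hk (hlk _)).1.eq (least_mem (by simp)) (by simp)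
      (le_antisymm (least_le (x := (k, b)) (by simp))
        (((hl.mono (Nat.le_succ k)).cons hk (hlk _)).2 _ (least_mem (by simp))).1)
  have hlt : ∀ b, fan (of ((k, b) :: l)) = sgn (k, b) * fan (of (l.map neg)) := fun b => by
    rw [fan_of (by simp), hle, bdry_cons, map_add, map_add, mul_add, map_of, bdry_of, map_sum,
      map_sum, map_sum, Finset.mul_sum, Finset.sum_eq_zero, add_zero]
    intro i _
    rw [cone_of, map_of]
    refine sgn_mul_fan_eq_zero (NoCompl.of_subset (l := (k, b) :: l)
      ((hl.mono (Nat.le_succ k)).cons hk (hlk _)).1 ?_) (by simp) ?_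
    · exact List.cons_subset_cons _ fun x hx => List.mem_of_mem_eraseIdx hx
    · intro x hx
      rcases List.mem_cons.1 hx with rfl | hx
      · rfl
      · have := (hl.2 x (List.mem_of_mem_eraseIdx hx)).1
        change k ≤ x.1
        omega
  simp only [LinearMap.comp_apply, LinearMap.add_apply, map_add, cone_of, map_of, hlt]
  simp [sgn]

/-- In the boundary of a crosspolytope with `M - k` pairs of vertices, a cycle of top dimension on
which the alternation cochain vanishes is a boundary. Any such cycle is homologous to the
suspension of a cycle of the equator, which has the same value of the alternation cochain. -/
theorem exists_bdry_of_fan_eq_zero {M : ℕ} : ∀ (n k : ℕ) (c : ListChain Label), k + n = M →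
    (c ∈ On fun l => Octa k M l ∧ l.length = n) → bdry c = 0 → fan c = 0 →
    ∃ w ∈ On (fun l => Octa k M l ∧ l.length = n + 1), bdry w = c := by
  intro n
  induction n with
  | zero =>
    intro k c _ hc _ hF
    refine ⟨0, Submodule.zero_mem _, ?_⟩
    have : c = fan c • of [] := by
      refine eqOn_of_on LinearMap.id (LinearMap.toSpanSingleton _ _ (of []) ∘ₗ fan) ?_ hc
      rintro l ⟨_, hl⟩
      rw [List.length_eq_zero_iff.1 hl]
      simp [fan_nil]
    rw [this, hF, zero_smul, map_zero]
  | succ n ih =>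
    intro k c hkn hc hc0 hF
    have hk : k < M := by omega
    set p : Label := (k, true) with hp
    set q : Label := (k, false) with hq
    classical
    -- `c = a + a'`, where `a` collects the lists containing `p`.
    set a : ListChain Label := c.filter fun l => p ∈ l with ha
    set a' : ListChain Label := c.filter fun l => ¬ p ∈ l with ha'
    have hsum : a + a' = c := Finsupp.filter_add_filter_not c _
    have haOn : a ∈ On fun l => (Octa k M l ∧ l.length = n + 1) ∧ p ∈ l := by
      refine on_and ?_ ?_
      · exact (Finsupp.mem_supported _ _).2 fun l hl =>
          (Finsupp.mem_supported _ _).1 hc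
            (Finset.mem_filter.1 (Finsupp.support_filter (fun l => p ∈ l) c ▸ hl)).1
      · exact (Finsupp.mem_supported _ _).2 fun l hl =>
          (Finset.mem_filter.1 (Finsupp.support_filter (fun l => p ∈ l) c ▸ hl)).2
    have haOn' : a' ∈ On fun l => (Octa k M l ∧ l.length = n + 1) ∧ p ∉ l := by
      refine on_and ?_ ?_
      · exact (Finsupp.mem_supported _ _).2 fun l hl =>
          (Finsupp.mem_supported _ _).1 hc
            (Finset.mem_filter.1 (Finsupp.support_filter (fun l => ¬ p ∈ l) c ▸ hl)).1
      · exact (Finsupp.mem_supported _ _).2 fun l hl =>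
          (Finset.mem_filter.1 (Finsupp.support_filter (fun l => ¬ p ∈ l) c ▸ hl)).2
    have hbd : bdry a' = bdry a := by
      rw [← add_eq_zero_iff, ← map_add, add_comm, hsum, hc0]
    set y := bdry a with hy
    have hyOn : y ∈ On fun l => Octa (k + 1) M l ∧ l.length = n := by
      have h1 : y ∈ On fun l => (Octa k M l ∧ l.length = n) ∧ q ∉ l := by
        refine bdry_mem_on (fun l hl i hi => ?_) haOn
        have hsub : l.eraseIdx i ⊆ l := fun x hx => List.mem_of_mem_eraseIdx hx
        have := length_eraseIdx_add_one hi
        exact ⟨⟨⟨hl.1.1.1.of_subset hsub, fun x hx => hl.1.1.2 x (hsub hx)⟩, by omega⟩,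
          fun h => hl.1.1.1 p hl.2 (hsub h)⟩
      have h2 : y ∈ On fun l => p ∉ l := by
        rw [← hbd]
        exact bdry_mem_on (fun l hl i _ h => hl.2 (List.mem_of_mem_eraseIdx h)) haOn'
      refine on_mono ?_ (on_and h1 h2)
      rintro l ⟨⟨⟨h3, h4⟩, h5⟩, h6⟩
      refine ⟨⟨h3.1, fun x hx => ⟨?_, (h3.2 x hx).2⟩⟩, h4⟩
      have h7 := (h3.2 x hx).1
      rcases h7.eq_or_lt with h8 | h8
      · rcases x with ⟨i, _ | _⟩
        · obtain rfl : k = i := h8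
          exact absurd hx h5
        · obtain rfl : k = i := h8
          exact absurd hx h6
      · exact h8
    have hy0 : bdry y = 0 := bdry_bdry a
    have hyp : ∀ b, ∀ l, Octa (k + 1) M l → neg (k, b) ∉ l := fun b l hl h => by
      have := (hl.2 _ h).1
      simp at this
    have hcy : ∀ b, cone (k, b) y ∈ On fun l => Octa k M l ∧ l.length = n + 1 := fun b =>
      cone_mem_on _ (fun l hl => ⟨(hl.1.mono (Nat.le_succ k)).cons hk (hyp b l hl.1),
        by simp [hl.2]⟩) hyOn
    -- The two halves of `c` are completed to cycles in the stars of `p` and `q`.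
    set w₁ := cone p (a + cone p y) + cone q (a' + cone q y) with hw₁
    have hw₁On : w₁ ∈ On fun l => Octa k M l ∧ l.length = n + 1 + 1 := by
      have h3 : ∀ b, cone (k, b) (cone (k, b) y) ∈ On fun l =>
          Octa k M l ∧ l.length = n + 1 + 1 := fun b => by
        refine cone_mem_on (p := fun l => (Octa k M l ∧ l.length = n + 1) ∧ neg (k, b) ∉ l) _
          (fun l hl => ⟨hl.1.1.cons hk hl.2, by simp [hl.1.2]⟩) ?_
        refine cone_mem_on _ (fun l hl => ⟨⟨(hl.1.mono (Nat.le_succ k)).cons hk (hyp b l hl.1),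
          by simp [hl.2]⟩, ?_⟩) hyOn
        intro h
        rcases List.mem_cons.1 h with h | h
        · exact absurd (congrArg Prod.snd h) (by simp)
        · exact hyp b l hl.1 h
      rw [hw₁, map_add, map_add]
      refine Submodule.add_mem _ (Submodule.add_mem _ ?_ (h3 _)) (Submodule.add_mem _ ?_ (h3 _))
      · refine cone_mem_on _ (fun l hl => ⟨hl.1.1.cons hk ?_, by simp [hl.1.2]⟩) haOn
        exact hl.1.1.1 p hl.2
      · exact cone_mem_on _ (fun l hl => ⟨hl.1.1.cons hk hl.2, by simp [hl.1.2]⟩) haOn'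
    have hbw₁ : bdry w₁ = c + (cone p y + cone q y) := by
      have h1 : bdry (a + cone p y) = 0 := by
        rw [map_add, bdry_cone, hy0, map_zero, add_zero, add_self]
      have h2 : bdry (a' + cone q y) = 0 := by
        rw [map_add, bdry_cone, hy0, map_zero, add_zero, hbd, add_self]
      rw [hw₁, map_add, bdry_cone, bdry_cone, h1, h2, map_zero, map_zero, ← hsum]
      abel
    have hFy : fan y = 0 := by
      have h1 := congrArg fan hbw₁
      have h2 : fan (map neg w₁) = 0 :=
        fan_eq_zero_of_on hk.le (n := n + 1 + 1) (by omega)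
          (map_mem_on neg (fun l hl => ⟨⟨hl.1.1.map_neg, fun x hx => by
            obtain ⟨z, hz, rfl⟩ := List.mem_map.1 hx
            exact hl.1.2 z hz⟩, by simp [hl.2]⟩) hw₁On)
      rw [fan_bdry, fan_eq_zero_of_on hk.le (by omega) hw₁On, h2, map_add, hF, map_add,
        fan_cone_add_fan_cone (on_mono (fun l hl => hl.1) hyOn) hk hy0] at h1
      simpa using h1.symm
    obtain ⟨w₂, hw₂, hbw₂⟩ := ih (k + 1) y (by omega) hyOn hy0 hFy
    refine ⟨w₁ + (cone p w₂ + cone q w₂), Submodule.add_mem _ hw₁On (Submodule.add_mem _ ?_ ?_), ?_⟩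
    · exact cone_mem_on _ (fun l hl => ⟨(hl.1.mono (Nat.le_succ k)).cons hk (hyp _ l hl.1),
        by simp [hl.2]⟩) hw₂
    · exact cone_mem_on _ (fun l hl => ⟨(hl.1.mono (Nat.le_succ k)).cons hk (hyp _ l hl.1),
        by simp [hl.2]⟩) hw₂
    · have h1 : bdry (cone p w₂ + cone q w₂) = cone p y + cone q y := by
        rw [map_add, bdry_cone, bdry_cone, hbw₂, add_add_add_comm, add_self, zero_add]
      rw [map_add, hbw₁, h1, add_assoc, add_self, add_zero]

end Label

/-! ### Barycentric subdivision in a normed space -/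

namespace ListChain

section Barycentric

variable {E : Type*} [NormedAddCommGroup E] [NormedSpace ℝ E]

/-- The barycentre of a list of points. -/
def bary (l : List E) : E := (l.length : ℝ)⁻¹ • l.sum

/-- Any two points of the list have distance at most `ε`. -/
def Small {E : Type*} [PseudoMetricSpace E] (ε : ℝ) (l : List E) : Prop :=
  ∀ x ∈ l, ∀ y ∈ l, dist x y ≤ ε

theorem Small.eraseIdx {E : Type*} [PseudoMetricSpace E] {ε : ℝ} {l : List E} (h : Small ε l)
    (i : ℕ) : Small ε (l.eraseIdx i) :=
  fun x hx y hy => h x (List.mem_of_mem_eraseIdx hx) y (List.mem_of_mem_eraseIdx hy)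

theorem Small.mono {E : Type*} [PseudoMetricSpace E] {ε ε' : ℝ} {l : List E} (h : Small ε l)
    (hε : ε ≤ ε') : Small ε' l :=
  fun x hx y hy => (h x hx y hy).trans hε

theorem norm_sum_sub_le {d : ℝ} {x : E} : ∀ l : List E, (∀ y ∈ l, dist y x ≤ d) →
    ‖l.sum - (l.length : ℝ) • x‖ ≤ l.length * d
  | [], _ => by simp
  | y :: l, h => by
    have h1 := norm_sum_sub_le l fun z hz => h z (List.mem_cons_of_mem _ hz)
    have h2 : ‖y - x‖ ≤ d := by simpa [dist_eq_norm] using h y (by simp)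
    have h3 : (y :: l).sum - ((y :: l).length : ℝ) • x =
        (y - x) + (l.sum - (l.length : ℝ) • x) := by
      rw [List.sum_cons, List.length_cons]
      push_cast
      rw [add_smul, one_smul]
      abel
    rw [h3, List.length_cons]
    push_cast
    calc _ ≤ _ := norm_add_le _ _
      _ ≤ d + l.length * d := add_le_add h2 h1
      _ = _ := by ring

theorem dist_bary_le {d : ℝ} {n : ℕ} {l : List E} (hl : l.length = n + 1) (h : Small d l)
    {x : E} (hx : x ∈ l) : dist x (bary l) ≤ n / (n + 1) * d := by
  obtain ⟨s, t, rfl⟩ := List.append_of_mem hx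
  have hs := norm_sum_sub_le (x := x) (d := d) s fun y hy => h y (by simp [hy]) x hx
  have ht := norm_sum_sub_le (x := x) (d := d) t fun y hy => h y (by simp [hy]) x hx
  have hst : s.length + t.length = n := by
    have h1 : s.length + (t.length + 1) = n + 1 := by simpa using hl
    omega
  have hst' : (s.length : ℝ) + t.length = n := by exact_mod_cast hst
  have hn : (0 : ℝ) < n + 1 := by positivity
  have key : bary (s ++ x :: t) - x =
      ((n : ℝ) + 1)⁻¹ • ((s.sum - (s.length : ℝ) • x) + (t.sum - (t.length : ℝ) • x)) := by
    have h1 : (s.sum - (s.length : ℝ) • x) + (t.sum - (t.length : ℝ) • x) =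
        (s ++ x :: t).sum - ((n : ℝ) + 1) • x := by
      rw [← hst', List.sum_append, List.sum_cons, add_smul, add_smul, one_smul]
      abel
    rw [h1, bary, hl, smul_sub, smul_smul, inv_mul_cancel₀ hn.ne', one_smul]
    push_cast
    rfl
  rw [dist_comm, dist_eq_norm, key, norm_smul, norm_inv, Real.norm_of_nonneg hn.le]
  calc _ ≤ ((n : ℝ) + 1)⁻¹ * (s.length * d + t.length * d) := by
        gcongr
        exact (norm_add_le _ _).trans (add_le_add hs ht)
    _ = ((n : ℝ) + 1)⁻¹ * ((s.length + t.length) * d) := by ring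
    _ = _ := by rw [hst']; ring

theorem bary_mem {C : Set E} (hC : Convex ℝ C) {l : List E} (h0 : l ≠ []) (hl : InSet C l) :
    bary l ∈ C := by
  have hn : (0 : ℝ) < l.length := by
    exact_mod_cast List.length_pos_iff.2 h0
  have h1 : bary l = ∑ i : Fin l.length, (l.length : ℝ)⁻¹ • l.get i := by
    rw [bary, ← Finset.smul_sum]
    congr 1
    rw [← List.sum_ofFn, List.ofFn_get]
  rw [h1]
  refine hC.sum_mem (fun i _ => by positivity) ?_ fun i _ => hl _ (List.get_mem l i)
  rw [Finset.sum_const, Finset.card_univ, Fintype.card_fin, nsmul_eq_mul, mul_inv_cancel₀ hn.ne']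

theorem subdiv_bary_small {d : ℝ} {n : ℕ} : ∀ {l : List E}, l.length = n + 1 → Small d l →
    subdiv bary (of l) ∈ On (Small (n / (n + 1) * d)) := by
  induction n with
  | zero =>
    intro l hl h
    refine on_mono ?_ (subdiv_mem_length bary l hl)
    intro l' hl'
    obtain ⟨x, rfl⟩ := List.length_eq_one_iff.1 hl'
    intro y hy z hz
    obtain rfl := List.mem_singleton.1 hy
    obtain rfl := List.mem_singleton.1 hz
    simp
  | succ n ih =>
    intro l hl h
    have h0 : l ≠ [] := by rintro rfl; simp at hl
    have hd : 0 ≤ d := dist_nonneg.trans (h _ (List.head_mem h0) _ (List.head_mem h0))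
    have hκ : (n : ℝ) / (n + 1) * d ≤ ((n + 1 : ℕ) : ℝ) / ((n + 1 : ℕ) + 1) * d := by
      gcongr ?_ * d
      push_cast
      rw [div_le_div_iff₀ (by positivity) (by positivity)]
      nlinarith
    have hκ0 : 0 ≤ ((n + 1 : ℕ) : ℝ) / ((n + 1 : ℕ) + 1) * d := by positivity
    rw [subdiv_of _ h0, bdry_of, map_sum]
    refine cone_mem_on (p := fun l' => Small (n / (n + 1) * d) l' ∧
      InSet (Metric.closedBall (bary l) (((n + 1 : ℕ) : ℝ) / ((n + 1 : ℕ) + 1) * d)) l') _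
      (fun l' hl' => ?_) (Submodule.sum_mem _ fun i _ => ?_)
    · intro x hx y hy
      rcases List.mem_cons.1 hx with rfl | hx <;> rcases List.mem_cons.1 hy with rfl | hy
      · simpa using hκ0
      · rw [dist_comm]
        exact hl'.2 y hy
      · exact hl'.2 x hx
      · exact (hl'.1 x hx y hy).trans hκ
    · have := length_eraseIdx_add_one i.2
      refine on_and (ih (by omega) (h.eraseIdx _)) ?_
      refine subdiv_mem_inSet (fun l₁ h₁ h₂ => bary_mem (convex_closedBall _ _) h₁ h₂) _ ?_
      intro x hx
      exact dist_bary_le hl h (List.mem_of_mem_eraseIdx hx)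

/-- The iterated barycentric subdivision. -/
def iterSubdiv (N : ℕ) : ListChain E →ₗ[ZMod 2] ListChain E := (subdiv bary) ^ N

theorem iterSubdiv_zero (c : ListChain E) : iterSubdiv 0 c = c := by
  simp [iterSubdiv]

theorem iterSubdiv_succ (N : ℕ) (c : ListChain E) :
    iterSubdiv (N + 1) c = subdiv bary (iterSubdiv N c) := by
  rw [iterSubdiv, pow_succ', Module.End.mul_apply, iterSubdiv]

theorem bdry_iterSubdiv (N : ℕ) (c : ListChain E) :
    bdry (iterSubdiv N c) = iterSubdiv N (bdry c) := by
  induction N with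
  | zero => rw [iterSubdiv_zero, iterSubdiv_zero]
  | succ N ih => rw [iterSubdiv_succ, iterSubdiv_succ, bdry_subdiv, ih]

theorem iterSubdiv_nil (N : ℕ) : iterSubdiv N (of ([] : List E)) = of [] := by
  induction N with
  | zero => rw [iterSubdiv_zero]
  | succ N ih => rw [iterSubdiv_succ, ih, subdiv_nil]

theorem iterSubdiv_mem_inSet {C : Set E} (hC : Convex ℝ C) (N : ℕ) {c : ListChain E}
    (hc : c ∈ On (InSet C)) : iterSubdiv N c ∈ On (InSet C) := by
  induction N with
  | zero => rwa [iterSubdiv_zero]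
  | succ N ih =>
    rw [iterSubdiv_succ]
    exact map_mem_of_on _ _ (subdiv_mem_inSet fun l h0 hl => bary_mem hC h0 hl) ih

theorem iterSubdiv_mem_length {n : ℕ} (N : ℕ) {c : ListChain E}
    (hc : c ∈ On fun l => l.length = n) : iterSubdiv N c ∈ On fun l => l.length = n := by
  induction N with
  | zero => rwa [iterSubdiv_zero]
  | succ N ih =>
    rw [iterSubdiv_succ]
    exact map_mem_of_on _ _ (fun l hl => subdiv_mem_length _ l hl) ih

/-- Iterated barycentric subdivisions get arbitrarily fine. -/
theorem exists_iterSubdiv_small (n : ℕ) (d : ℝ) {ε : ℝ} (hε : 0 < ε) :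
    ∃ N₀ : ℕ, ∀ N, N₀ ≤ N → ∀ l : List E, l.length = n → Small d l →
      iterSubdiv N (of l) ∈ On (Small ε) := by
  rcases n with _ | n
  · refine ⟨0, fun N _ l hl _ => ?_⟩
    rw [List.length_eq_zero_iff.1 hl, iterSubdiv_nil]
    exact of_mem_on fun x hx => absurd hx List.not_mem_nil
  have hκ0 : (0 : ℝ) ≤ n / (n + 1) := by positivity
  have hκ1 : (n : ℝ) / (n + 1) < 1 := by
    rw [div_lt_one (by positivity)]
    linarith
  have key : ∀ N, ∀ l : List E, l.length = n + 1 → Small d l →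
      iterSubdiv N (of l) ∈ On fun l => l.length = n + 1 ∧ Small ((n / (n + 1)) ^ N * d) l := by
    intro N l hl h
    induction N with
    | zero =>
      rw [iterSubdiv_zero]
      exact of_mem_on ⟨hl, by simpa using h⟩
    | succ N ih =>
      rw [iterSubdiv_succ]
      refine map_mem_of_on _ _ (fun l' hl' => ?_) ih
      refine on_and (subdiv_mem_length _ _ hl'.1) ?_
      have := subdiv_bary_small hl'.1 hl'.2
      rwa [← mul_assoc, ← pow_succ'] at this
  have hlim : Filter.Tendsto (fun N : ℕ => ((n : ℝ) / (n + 1)) ^ N * d) Filter.atTop (nhds 0) := by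
    simpa using (tendsto_pow_atTop_nhds_zero_of_lt_one hκ0 hκ1).mul_const d
  obtain ⟨N₀, hN₀⟩ := Filter.eventually_atTop.1 (hlim.eventually (ge_mem_nhds hε))
  exact ⟨N₀, fun N hN _ hl h => on_mono (fun _ hl' => hl'.2.mono (hN₀ N hN)) (key N _ hl h)⟩

end Barycentric

/-! ### Normalization of ordered simplicial chains -/

section Pick

variable {P : Type*} [Nonempty P]

/-- A chosen element of a list, depending only on the set of its elements. -/
def pick (l : List P) : P := Classical.epsilon fun v => v ∈ l

theorem pick_mem {l : List P} (h : l ≠ []) : pick l ∈ l :=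
  Classical.epsilon_spec (p := fun v => v ∈ l) (List.exists_mem_of_ne_nil l h)

theorem pick_perm {l l' : List P} (h : l.Perm l') : pick l = pick l' := by
  unfold pick
  congr 1
  funext v
  exact propext h.mem_iff

/-- A chain map on ordered simplicial chains which is symmetric and kills the degenerate lists. -/
def normalize : ListChain P →ₗ[ZMod 2] ListChain P := subdiv pick

theorem normalize_mem_inSet (C : Set P) : ∀ l, InSet C l → normalize (of l) ∈ On (InSet C) :=
  subdiv_mem_inSet fun _ h0 hl => hl _ (pick_mem h0)

theorem normalize_perm {l l' : List P} (h : l.Perm l') : normalize (of l) = normalize (of l') :=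
  subdiv_perm (fun _ _ => pick_perm) l l' h

theorem normalize_eq_zero {l : List P} (h : ¬ l.Nodup) : normalize (of l) = 0 :=
  subdiv_eq_zero_of_not_nodup (fun _ _ => pick_perm) l h

theorem bdry_normalize (c : ListChain P) : bdry (normalize c) = normalize (bdry c) :=
  bdry_subdiv _ c

theorem normalize_nil : normalize (of ([] : List P)) = of [] := subdiv_nil _

theorem normalize_mem_length {n : ℕ} (l : List P) (hl : l.length = n) :
    normalize (of l) ∈ On fun l => l.length = n :=
  subdiv_mem_length _ l hl

end Pick

end ListChain

/-! ### The polyhedron of a simplicial complex -/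

section Polyhedron

variable {V : Type} [Fintype V]

/-- The closed simplex of `V → ℝ` with vertex set `s`. -/
def cell (s : Finset V) : Set (V → ℝ) := {x | x ∈ stdSimplex ℝ V ∧ ∀ v, x v ≠ 0 → v ∈ s}

theorem convex_cell (s : Finset V) : Convex ℝ (cell s) := by
  intro x hx y hy a b ha hb hab
  refine ⟨convex_stdSimplex ℝ V hx.1 hy.1 ha hb hab, fun v hv => ?_⟩
  by_contra hs
  have h1 : x v = 0 := by_contra fun h => hs (hx.2 v h)
  have h2 : y v = 0 := by_contra fun h => hs (hy.2 v h)
  apply hv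
  simp [h1, h2]

theorem cell_mono {s t : Finset V} (h : s ⊆ t) : cell s ⊆ cell t :=
  fun _ hx => ⟨hx.1, fun v hv => h (hx.2 v hv)⟩

theorem isCompact_cell (s : Finset V) : IsCompact (cell s) := by
  have h : cell s = stdSimplex ℝ V ∩ ⋂ v ∈ {v | v ∉ s}, {x | x v = 0} := by
    ext x
    simp only [cell, Set.mem_ofPred_eq, Set.mem_inter_iff, Set.mem_iInter]
    refine and_congr_right fun _ => forall_congr' fun v => ?_
    rw [not_imp_comm]
  rw [h]
  refine (isCompact_stdSimplex ℝ V).inter_right (isClosed_biInter fun v _ => ?_)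
  exact isClosed_eq (continuous_apply v) continuous_const

theorem abs_le_one_of_mem_cell {s : Finset V} {x : V → ℝ} (hx : x ∈ cell s) (v : V) :
    0 ≤ x v ∧ x v ≤ 1 :=
  ⟨hx.1.1 v, (mem_Icc_of_mem_stdSimplex hx.1 v).2⟩

theorem small_of_inSet_cell {s : Finset V} {l : List (V → ℝ)} (h : InSet (cell s) l) :
    Small 1 l := by
  intro x hx y hy
  refine (dist_pi_le_iff zero_le_one).2 fun v => ?_
  have h1 := abs_le_one_of_mem_cell (h x hx) v
  have h2 := abs_le_one_of_mem_cell (h y hy) v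
  rw [Real.dist_eq, abs_le]
  constructor <;> linarith

theorem sum_eq_one_of_mem_cell {s : Finset V} {x : V → ℝ} (hx : x ∈ cell s) :
    ∑ v ∈ s, x v = 1 := by
  rw [← hx.1.2]
  exact Finset.sum_subset (Finset.subset_univ s) fun v _ hv => by_contra fun h => hv (hx.2 v h)

/-- The polyhedron `|K|`, as a subset of `V → ℝ`. -/
def poly (K : AbstractSimplicialComplex V) : Set (V → ℝ) := {x | ∃ s ∈ K.faces, x ∈ cell s}

theorem isCompact_poly (K : AbstractSimplicialComplex V) : IsCompact (poly K) := by
  have h : poly K = ⋃ s ∈ K.faces, cell s := by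
    ext x
    simp [poly]
  rw [h]
  exact (Set.toFinite K.faces).isCompact_biUnion fun s _ => isCompact_cell s

/-- The list is contained in a closed simplex of `K`. -/
def InFace (K : AbstractSimplicialComplex V) (l : List (V → ℝ)) : Prop :=
  ∃ s ∈ K.faces, InSet (cell s) l

theorem InFace.inSet {K : AbstractSimplicialComplex V} {l : List (V → ℝ)} (h : InFace K l) :
    InSet (poly K) l := by
  obtain ⟨s, hs, hl⟩ := h
  exact fun x hx => ⟨s, hs, hl x hx⟩

/-- Truncation of the barycentric coordinates at `η`, followed by normalization. -/
def shrink (η : ℝ) (x : V → ℝ) : V → ℝ := fun v => max (x v - η) 0 / ∑ w, max (x w - η) 0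

theorem shrink_apply_ne_zero {η : ℝ} {x : V → ℝ} {v : V} (h : shrink η x v ≠ 0) : η < x v := by
  by_contra h'
  apply h
  rw [shrink, max_eq_right (by linarith), zero_div]

theorem sum_max_bounds {η : ℝ} (hη : 0 ≤ η) {x : V → ℝ} (hx : x ∈ stdSimplex ℝ V) :
    1 - Fintype.card V * η ≤ ∑ w, max (x w - η) 0 ∧ ∑ w, max (x w - η) 0 ≤ 1 := by
  constructor
  · calc 1 - Fintype.card V * η = ∑ w : V, (x w - η) := by
          rw [Finset.sum_sub_distrib, hx.2, Finset.sum_const, Finset.card_univ, nsmul_eq_mul]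
      _ ≤ _ := Finset.sum_le_sum fun w _ => le_max_left _ _
  · rw [← hx.2]
    refine Finset.sum_le_sum fun w _ => max_le (by linarith) (hx.1 w)

theorem shrink_mem {η : ℝ} (hη : 0 ≤ η) (hη' : Fintype.card V * η < 1) {x : V → ℝ}
    (hx : x ∈ stdSimplex ℝ V) : shrink η x ∈ stdSimplex ℝ V := by
  have h := (sum_max_bounds hη hx).1
  have hS : 0 < ∑ w, max (x w - η) 0 := by linarith
  refine ⟨fun v => div_nonneg (le_max_right _ _) hS.le, ?_⟩
  simp only [shrink]
  rw [← Finset.sum_div, div_self hS.ne']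

theorem dist_shrink_le {η : ℝ} (hη : 0 ≤ η) (hη' : Fintype.card V * η < 1) {x : V → ℝ}
    (hx : x ∈ stdSimplex ℝ V) : dist (shrink η x) x ≤ (Fintype.card V + 1) * η := by
  obtain ⟨h1, h2⟩ := sum_max_bounds hη hx
  set S := ∑ w, max (x w - η) 0 with hS
  have hS0 : 0 < S := by linarith
  refine (dist_pi_le_iff (by positivity)).2 fun v => ?_
  have h3 : shrink η x v ≤ 1 := (mem_Icc_of_mem_stdSimplex (shrink_mem hη hη' hx) v).2
  have h4 : 0 ≤ shrink η x v := (shrink_mem hη hη' hx).1 v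
  have h5 : shrink η x v * S = max (x v - η) 0 := by
    rw [shrink, ← hS, div_mul_cancel₀ _ hS0.ne']
  have h6 : max (x v - η) 0 ≤ x v := max_le (by linarith) (hx.1 v)
  have h7 : x v - η ≤ max (x v - η) 0 := le_max_left _ _
  have h8 : shrink η x v * (1 - S) ≤ 1 * (Fintype.card V * η) :=
    mul_le_mul h3 (by linarith) (by linarith) zero_le_one
  have h9 : 0 ≤ shrink η x v * (1 - S) := mul_nonneg h4 (by linarith)
  rw [Real.dist_eq, abs_le]
  constructor <;> nlinarith

/-- Points of `|K|` can be moved slightly so that every sufficiently small list of points ends up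
in a single simplex: truncate the small barycentric coordinates. -/
theorem exists_shrink (K : AbstractSimplicialComplex V) {ε : ℝ} (hε : 0 < ε) :
    ∃ δ > 0, ∃ ρ : (V → ℝ) → (V → ℝ), (∀ x ∈ poly K, dist (ρ x) x ≤ ε) ∧
      (∀ x ∈ poly K, ρ x ∈ poly K) ∧
      ∀ l, l ≠ [] → InSet (poly K) l → Small δ l → InFace K (l.map ρ) := by
  set n : ℝ := (Fintype.card V : ℝ) with hn
  have hn0 : 0 ≤ n := by positivity
  set η : ℝ := min ε (1 / 2) / (n + 1) with hη
  have hm : 0 < min ε (1 / 2) := lt_min hε (by norm_num)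
  have hη0 : 0 < η := div_pos hm (by positivity)
  have hη1 : (n + 1) * η = min ε (1 / 2) := by
    rw [hη]
    field_simp
  have h1 : n * η < 1 := by
    have := min_le_right ε (1 / 2)
    nlinarith
  refine ⟨η, hη0, shrink η, ?_, ?_, ?_⟩
  · rintro x ⟨s, hs, hx⟩
    exact (dist_shrink_le hη0.le h1 hx.1).trans (hη1.trans_le (min_le_left _ _))
  · rintro x ⟨s, hs, hx⟩
    refine ⟨s, hs, shrink_mem hη0.le h1 hx.1, fun v hv => hx.2 v ?_⟩
    exact (hη0.trans (shrink_apply_ne_zero hv)).ne'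
  · intro l h0 hl hsm
    obtain ⟨s, hs, hx₀⟩ := hl _ (List.head_mem h0)
    refine ⟨s, hs, fun y hy => ?_⟩
    obtain ⟨x, hx, rfl⟩ := List.mem_map.1 hy
    obtain ⟨t, ht, hxt⟩ := hl x hx
    refine ⟨shrink_mem hη0.le h1 hxt.1, fun v hv => hx₀.2 v ?_⟩
    have h2 := shrink_apply_ne_zero hv
    have h3 : dist (x v) (l.head h0 v) ≤ η :=
      (dist_le_pi_dist _ _ v).trans (hsm x hx _ (List.head_mem h0))
    rw [Real.dist_eq] at h3
    have h4 := (abs_le.1 h3).2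
    exact (by linarith : 0 < l.head h0 v).ne'

/-! ### Approximation of small chains by simplicial chains -/

variable [Nonempty V]

/-- A vertex of the carrier of `x`. -/
def nearVert (x : V → ℝ) : V := Classical.epsilon fun v => x v ≠ 0

theorem nearVert_mem {s : Finset V} {x : V → ℝ} (hx : x ∈ cell s) : nearVert x ∈ s := by
  refine hx.2 _ (Classical.epsilon_spec (p := fun v => x v ≠ 0) ?_)
  by_contra! h
  have := hx.1.2
  simp [h] at this

variable [DecidableEq V]

/-- The vertex `v`, as a point of `V → ℝ`. -/
def vert (v : V) : V → ℝ := Pi.single v 1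

theorem vert_mem_cell {s : Finset V} {v : V} (hv : v ∈ s) : vert v ∈ cell s := by
  refine ⟨single_mem_stdSimplex ℝ v, fun w hw => ?_⟩
  by_contra hws
  apply hw
  rw [vert, Pi.single_eq_of_ne]
  rintro rfl
  exact hws hv

/-- The chain map sending an ordered simplicial chain with vertices in `V` to the `N`-fold
subdivision of its normalization. -/
def realize (N : ℕ) : ListChain V →ₗ[ZMod 2] ListChain (V → ℝ) :=
  iterSubdiv N ∘ₗ map vert ∘ₗ normalize

theorem realize_apply (N : ℕ) (c : ListChain V) :
    realize N c = iterSubdiv N (map vert (normalize c)) := rfl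

theorem bdry_realize (N : ℕ) (c : ListChain V) : bdry (realize N c) = realize N (bdry c) := by
  rw [realize_apply, bdry_iterSubdiv, bdry_map, bdry_normalize, realize_apply]

theorem realize_nil (N : ℕ) : realize N (of ([] : List V)) = of [] := by
  rw [realize_apply, normalize_nil, map_of, List.map_nil, iterSubdiv_nil]

theorem realize_mem_inSet (N : ℕ) {s : Finset V} {l : List V} (hl : ∀ v ∈ l, v ∈ s) :
    realize N (of l) ∈ On (InSet (cell s)) := by
  refine iterSubdiv_mem_inSet (convex_cell s) N (map_mem_on (p := InSet (s : Set V)) _ ?_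
    (normalize_mem_inSet _ _ hl))
  intro l' hl' x hx
  obtain ⟨v, hv, rfl⟩ := List.mem_map.1 hx
  exact vert_mem_cell (hl' v hv)

theorem realize_mem_length (N : ℕ) {n : ℕ} {l : List V} (hl : l.length = n) :
    realize N (of l) ∈ On fun l => l.length = n := by
  refine iterSubdiv_mem_length N (map_mem_on (p := fun l => l.length = n) _ ?_
    (normalize_mem_length _ hl))
  intro l' hl'
  simpa using hl'

theorem headD_mem {P : Type*} {C : Set P} (d : P) {l : List P} (h0 : l ≠ []) (hl : InSet C l) :
    l.headD d ∈ C := by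
  cases l with
  | nil => exact absurd rfl h0
  | cons x l => exact hl x (by simp)

theorem bdry_id {P : Type*} (c : ListChain P) :
    bdry (LinearMap.id (R := ZMod 2) c) = LinearMap.id (R := ZMod 2) (bdry c) := rfl

theorem id_mem_length {P : Type*} (n : ℕ) (l : List P) (hl : l.length = n) :
    LinearMap.id (R := ZMod 2) (of l) ∈ On fun l => l.length = n :=
  of_mem_on hl

theorem map_mem_length {P Q : Type*} (f : P → Q) (n : ℕ) (l : List P) (hl : l.length = n) :
    map f (of l) ∈ On fun l => l.length = n := by
  rw [map_of]
  exact of_mem_on (by simpa using hl)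

/-- Every sufficiently small cycle of `|K|` is homologous, through small chains, to the
subdivisions of a simplicial chain of `K`. -/
theorem exists_simplicial_approx (K : AbstractSimplicialComplex V) (n : ℕ) (hn : n ≠ 0) {ε : ℝ}
    (hε : 0 < ε) : ∃ δ > 0, ∃ N₀ : ℕ, ∀ c ∈ On (fun l => InSet (poly K) l ∧ Small δ l ∧
      l.length = n), bdry c = 0 →
      ∃ d ∈ On (fun l : List V => (∃ s ∈ K.faces, ∀ v ∈ l, v ∈ s) ∧ l.length = n),
        ∀ N, N₀ ≤ N → ∃ w ∈ On (fun l => InSet (poly K) l ∧ Small ε l ∧ l.length = n + 1),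
          bdry w = c + realize N d := by
  obtain ⟨δ₀, hδ₀, ρ, hρ, hρK, hρF⟩ := exists_shrink K (ε := ε / 8) (by positivity)
  obtain ⟨N₀, hN₀⟩ := exists_iterSubdiv_small (E := V → ℝ) (n + 1) 1 hε
  refine ⟨min δ₀ (ε / 8), lt_min hδ₀ (by positivity), N₀, fun c hc hc0 => ?_⟩
  have hδ := min_le_right δ₀ (ε / 8)
  have hδ' := min_le_left δ₀ (ε / 8)
  set δ := min δ₀ (ε / 8)
  have hne : ∀ {P : Type} {l : List P}, l.length = n → l ≠ [] := by
    rintro P l hl rfl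
    exact hn (by simpa using hl.symm)
  -- The first homotopy moves the chain by `ρ`.
  set D₁ := homotopy (LinearMap.id (R := ZMod 2)) (map ρ) fun l => l.headD 0 with hD₁
  have hb₁ : bdry (D₁ c) = c + map ρ c := by
    rw [hD₁, bdry_homotopy _ (fun c => bdry_id c) (fun c => bdry_map ρ c) (by rw [map_of]; rfl),
      hc0, map_zero, add_zero, LinearMap.id_apply]
  have hw₁ : D₁ c ∈ On fun l => InSet (poly K) l ∧ Small ε l ∧ l.length = n + 1 := by
    refine map_mem_of_on D₁ _ (fun l hl => ?_) hc
    have h1 : D₁ (of l) ∈ On (InSet {y | y ∈ poly K ∧ ∃ x ∈ l, dist y x ≤ ε / 8}) := by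
      refine homotopy_mem_inSet (D := {x | x ∈ l}) (fun l' h0 hl' => ?_) (fun l' hl' => ?_)
        (fun l' hl' => ?_) l (fun _ h => h)
      · have := headD_mem 0 h0 hl'
        exact ⟨hl.1 _ this, _, this, by rw [dist_self]; positivity⟩
      · exact of_mem_on fun x hx => ⟨hl.1 x (hl' x hx), x, hl' x hx, by rw [dist_self]; positivity⟩
      · rw [map_of]
        refine of_mem_on fun y hy => ?_
        obtain ⟨x, hx, rfl⟩ := List.mem_map.1 hy
        have hxK := hl.1 x (hl' x hx)
        exact ⟨hρK x hxK, x, hl' x hx, hρ x hxK⟩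
    refine on_mono ?_ (on_and h1 (homotopy_mem_length _ id_mem_length (map_mem_length ρ) l hl.2.2))
    rintro l' ⟨h2, h3⟩
    refine ⟨fun x hx => (h2 x hx).1, fun x hx y hy => ?_, h3⟩
    obtain ⟨-, x', hx', hxx⟩ := h2 x hx
    obtain ⟨-, y', hy', hyy⟩ := h2 y hy
    calc dist x y ≤ dist x x' + dist x' y' + dist y' y := dist_triangle4 _ _ _ _
      _ ≤ ε / 8 + δ + ε / 8 := by
        have := hl.2.1 x' hx' y' hy'
        rw [dist_comm y' y]
        gcongr
      _ ≤ ε := by linarith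
  set c₁ := map ρ c with hc₁
  have hc₁0 : bdry c₁ = 0 := by rw [hc₁, bdry_map, hc0, map_zero]
  have hc₁On : c₁ ∈ On fun l => InFace K l ∧ Small (3 * ε / 8) l ∧ l.length = n := by
    refine map_mem_on _ (fun l hl => ⟨hρF l (hne hl.2.2) hl.1 (hl.2.1.mono hδ'), ?_, ?_⟩) hc
    · intro x hx y hy
      obtain ⟨x', hx', rfl⟩ := List.mem_map.1 hx
      obtain ⟨y', hy', rfl⟩ := List.mem_map.1 hy
      calc dist (ρ x') (ρ y') ≤ dist (ρ x') x' + dist x' y' + dist y' (ρ y') :=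
            dist_triangle4 _ _ _ _
        _ ≤ ε / 8 + δ + ε / 8 := by
          have h1 := hl.2.1 x' hx' y' hy'
          have h2 := hρ x' (hl.1 x' hx')
          have h3 := hρ y' (hl.1 y' hy')
          rw [dist_comm y']
          gcongr
        _ ≤ 3 * ε / 8 := by linarith
    · simpa using hl.2.2
  refine ⟨map nearVert c₁, map_mem_on _ (fun l hl => ?_) hc₁On, fun N hN => ?_⟩
  · obtain ⟨⟨s, hs, hls⟩, -, hlen⟩ := hl
    refine ⟨⟨s, hs, fun v hv => ?_⟩, by simpa using hlen⟩
    obtain ⟨x, hx, rfl⟩ := List.mem_map.1 hv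
    exact nearVert_mem (hls x hx)
  -- The second homotopy subdivides the resulting chain, all of whose lists lie in simplices.
  set D₂ := homotopy (LinearMap.id (R := ZMod 2)) (iterSubdiv N)
    (fun l : List (V → ℝ) => l.headD 0) with hD₂
  have hb₂ : bdry (D₂ c₁) = c₁ + iterSubdiv N c₁ := by
    rw [hD₂, bdry_homotopy _ (fun c => bdry_id c) (fun c => bdry_iterSubdiv N c)
      (iterSubdiv_nil N).symm, hc₁0, map_zero, add_zero, LinearMap.id_apply]
  have hw₂ : D₂ c₁ ∈ On fun l => InSet (poly K) l ∧ Small ε l ∧ l.length = n + 1 := by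
    refine map_mem_of_on D₂ _ (fun l hl => ?_) hc₁On
    obtain ⟨⟨s, hs, hls⟩, hsm, hlen⟩ := hl
    have h0 := hne hlen
    have h1 : D₂ (of l) ∈ On (InSet (cell s ∩ Metric.closedBall (l.head h0) (3 * ε / 8))) := by
      have hconv : Convex ℝ (cell s ∩ Metric.closedBall (l.head h0) (3 * ε / 8)) :=
        (convex_cell s).inter (convex_closedBall _ _)
      exact homotopy_mem_inSet (fun l' h0 hl' => headD_mem 0 h0 hl') (fun l' hl' => of_mem_on hl')
        (fun l' hl' => iterSubdiv_mem_inSet hconv N (of_mem_on hl')) l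
        (fun x hx => ⟨hls x hx, hsm x hx _ (List.head_mem h0)⟩)
    refine on_mono ?_ (on_and h1 (homotopy_mem_length _ id_mem_length
      (fun n l hl => iterSubdiv_mem_length N (of_mem_on hl)) l hlen))
    rintro l' ⟨h2, h3⟩
    refine ⟨fun x hx => ⟨s, hs, (h2 x hx).1⟩, fun x hx y hy => ?_, h3⟩
    have h4 : dist x (l.head h0) ≤ 3 * ε / 8 := (h2 x hx).2
    have h5 : dist y (l.head h0) ≤ 3 * ε / 8 := (h2 y hy).2
    have := dist_triangle_right x y (l.head h0)
    linarith
  -- The third homotopy, before subdivision, moves the chain to the vertices of `K`.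
  set D₃ := homotopy (LinearMap.id (R := ZMod 2)) (map vert ∘ₗ normalize ∘ₗ map nearVert)
    (fun l : List (V → ℝ) => l.headD 0) with hD₃
  have hb₃ : bdry (D₃ c₁) = c₁ + map vert (normalize (map nearVert c₁)) := by
    rw [hD₃, bdry_homotopy _ (fun c => bdry_id c) (fun c => ?_) ?_, hc₁0, map_zero, add_zero]
    · rfl
    · simp only [LinearMap.comp_apply]
      rw [map_of, List.map_nil, normalize_nil, map_of]
      rfl
    · simp only [LinearMap.comp_apply]
      rw [bdry_map, bdry_normalize, bdry_map]
  have hw₃ : iterSubdiv N (D₃ c₁) ∈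
      On fun l => InSet (poly K) l ∧ Small ε l ∧ l.length = n + 1 := by
    have h1 : D₃ c₁ ∈ On fun l => InFace K l ∧ l.length = n + 1 := by
      refine map_mem_of_on D₃ _ (fun l hl => ?_) hc₁On
      obtain ⟨⟨s, hs, hls⟩, -, hlen⟩ := hl
      have h1 : D₃ (of l) ∈ On (InSet (cell s)) := by
        refine homotopy_mem_inSet (fun l' h0 hl' => headD_mem 0 h0 hl')
          (fun l' hl' => of_mem_on hl') (fun l' hl' => ?_) l hls
        simp only [LinearMap.comp_apply]
        rw [map_of]
        refine map_mem_on (p := InSet (s : Set V)) _ (fun l₂ hl₂ x hx => ?_)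
          (normalize_mem_inSet _ _ ?_)
        · obtain ⟨v, hv, rfl⟩ := List.mem_map.1 hx
          exact vert_mem_cell (hl₂ v hv)
        · intro v hv
          obtain ⟨x, hx, rfl⟩ := List.mem_map.1 hv
          exact nearVert_mem (hl' x hx)
      refine on_mono (fun l' hl' => ⟨⟨s, hs, hl'.1⟩, hl'.2⟩) (on_and h1 (homotopy_mem_length _
        id_mem_length (fun n l hl => ?_) l hlen))
      simp only [LinearMap.comp_apply]
      rw [map_of]
      exact map_mem_on (p := fun l => l.length = n) _ (fun l hl => by simpa using hl)
        (normalize_mem_length _ (by simpa using hl))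
    refine map_mem_of_on _ _ (fun l hl => ?_) h1
    obtain ⟨⟨s, hs, hls⟩, hlen⟩ := hl
    refine on_mono ?_ (on_and (on_and (iterSubdiv_mem_inSet (convex_cell s) N (of_mem_on hls))
      (hN₀ N hN l hlen (small_of_inSet_cell hls))) (iterSubdiv_mem_length N (of_mem_on hlen)))
    rintro l' ⟨⟨h2, h3⟩, h4⟩
    exact ⟨fun x hx => ⟨s, hs, h2 x hx⟩, h3, h4⟩
  refine ⟨D₁ c + D₂ c₁ + iterSubdiv N (D₃ c₁),
    Submodule.add_mem _ (Submodule.add_mem _ hw₁ hw₂) hw₃, ?_⟩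
  rw [map_add, map_add, hb₁, hb₂, bdry_iterSubdiv, hb₃, map_add, realize_apply]
  have h1 := add_self c₁
  have h2 := add_self (iterSubdiv N c₁)
  calc _ = c + (c₁ + c₁) + (iterSubdiv N c₁ + iterSubdiv N c₁) +
        iterSubdiv N (map vert (normalize (map nearVert c₁))) := by abel
    _ = _ := by rw [h1, h2, add_zero, add_zero]

end Polyhedron

section Fundamental

variable {V : Type} [Fintype V] [LinearOrder V]

/-! ### The fundamental cycle -/

/-- The sum of the `m`-simplices of `K`, as an ordered simplicial chain. -/
def fund (K : AbstractSimplicialComplex V) (m : ℕ) : ListChain V :=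
  ∑ s : Simplices K m, of s.1.sort

/-- Every face of `K` is a face of an `m`-simplex. -/
def IsPure (K : AbstractSimplicialComplex V) (m : ℕ) : Prop :=
  ∀ s ∈ K.faces, ∃ t ∈ K.faces, s ⊆ t ∧ t.card = m + 1

variable {K : AbstractSimplicialComplex V} {m : ℕ}

theorem IsPure.card_le (hK : IsPure K m) {s : Finset V} (hs : s ∈ K.faces) : s.card ≤ m + 1 := by
  obtain ⟨t, -, hst, ht⟩ := hK s hs
  exact ht ▸ Finset.card_le_card hst

/-- An `m`-simplex of a pure `m`-dimensional complex is a maximal face. -/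
theorem IsPure.eq_of_subset (hK : IsPure K m) {s t : Finset V} (hs : s ∈ K.faces)
    (ht : t.card = m + 1) (hts : t ⊆ s) : t = s :=
  Finset.eq_of_subset_of_card_le hts (ht ▸ hK.card_le hs)

variable [Nonempty V]

theorem normalize_eq_sum_of_length {d : ListChain V}
    (hK : IsPure K m) [Fintype (Simplices K m)]
    (hd : d ∈ On fun l : List V => (∃ s ∈ K.faces, ∀ v ∈ l, v ∈ s) ∧ l.length = m + 1) :
    ∃ n : Simplices K m → ZMod 2, normalize d = ∑ s, n s • normalize (of s.1.sort) := by
  have h : normalize d ∈ Submodule.span (ZMod 2)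
      (Set.range fun s : Simplices K m => normalize (of s.1.sort)) := by
    refine map_mem_of_on normalize _ (fun l hl => ?_) hd
    obtain ⟨⟨s, hs, hls⟩, hlen⟩ := hl
    by_cases hnd : l.Nodup
    · have hcard : l.toFinset.card = m + 1 := by rw [List.toFinset_card_of_nodup hnd, hlen]
      have hsub : l.toFinset ⊆ s := fun v hv => hls v (List.mem_toFinset.1 hv)
      have heq := hK.eq_of_subset hs hcard hsub
      have hperm : l.Perm s.sort := by
        rw [← heq]
        exact (List.perm_of_nodup_nodup_toFinset_eq hnd (Finset.sort_nodup _ _)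
          (Finset.sort_toFinset _ _).symm)
      rw [normalize_perm hperm]
      exact Submodule.subset_span ⟨⟨s, hs, heq ▸ hcard⟩, rfl⟩
    · rw [normalize_eq_zero hnd]
      exact Submodule.zero_mem _
  obtain ⟨n, hn⟩ := (Submodule.mem_span_range_iff_exists_fun (ZMod 2)).1 h
  exact ⟨n, hn.symm⟩

theorem normalize_eq_zero_of_length {d : ListChain V} (hK : IsPure K m) {n : ℕ} (hn : m + 1 < n)
    (hd : d ∈ On fun l : List V => (∃ s ∈ K.faces, ∀ v ∈ l, v ∈ s) ∧ l.length = n) :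
    normalize d = 0 :=
  apply_eq_zero_of_on normalize (fun l hl => by
    obtain ⟨⟨s, hs, hls⟩, hlen⟩ := hl
    refine normalize_eq_zero fun hnd => ?_
    have h1 : l.toFinset.card = n := by rw [List.toFinset_card_of_nodup hnd, hlen]
    have h2 : l.toFinset ⊆ s := fun v hv => hls v (List.mem_toFinset.1 hv)
    have := (Finset.card_le_card h2).trans (hK.card_le hs)
    omega) hd

/-! ### A local degree, by Sperner labellings -/

section Sperner

variable (σ : Finset V) (x : V → ℝ)

/-- The Sperner label of `y` with respect to an interior point `x` of `σ`: a vertex `v` of `σ`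
for which `y v / x v` is maximal. -/
def spernerLabel (y : V → ℝ) : V :=
  Classical.epsilon fun v => v ∈ σ ∧ ∀ w ∈ σ, y w / x w ≤ y v / x v

open Classical in
/-- The indicator function of the orderings of `σ`. -/
def orderingCochain : ListChain V →ₗ[ZMod 2] ZMod 2 :=
  lift fun l => if l.Perm σ.sort then 1 else 0

/-- The cochain counting the lists whose Sperner labels are the vertices of `σ`. -/
def spernerCochain : ListChain (V → ℝ) →ₗ[ZMod 2] ZMod 2 :=
  orderingCochain σ ∘ₗ map (spernerLabel σ x)

variable {σ x}

theorem spernerLabel_spec (hσ : σ.Nonempty) (y : V → ℝ) : spernerLabel σ x y ∈ σ ∧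
    ∀ w ∈ σ, y w / x w ≤ y (spernerLabel σ x y) / x (spernerLabel σ x y) :=
  Classical.epsilon_spec (p := fun v => v ∈ σ ∧ ∀ w ∈ σ, y w / x w ≤ y v / x v)
    (Finset.exists_max_image σ (fun v => y v / x v) hσ)

theorem perm_of_spernerCochain_ne_zero {l : List (V → ℝ)} (h : spernerCochain σ x (of l) ≠ 0) :
    (l.map (spernerLabel σ x)).Perm σ.sort := by
  by_contra h'
  apply h
  rw [spernerCochain, LinearMap.comp_apply, map_of, orderingCochain, lift_of, if_neg h']

theorem spernerCochain_bdry (hσ : σ.Nonempty) {l : List (V → ℝ)} (hl : l.length = σ.card + 1) :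
    spernerCochain σ x (bdry (of l)) = 0 := by
  rw [spernerCochain, LinearMap.comp_apply, ← bdry_map, map_of]
  refine apply_bdry_eq_zero_of_not_nodup _ (fun l l' h => ?_) (fun l h => ?_) fun hnd => ?_
  · rw [orderingCochain, lift_of, lift_of]
    congr 1
    exact propext ⟨h.symm.trans, h.trans⟩
  · rw [orderingCochain, lift_of, if_neg fun h' => h (h'.nodup_iff.2 (Finset.sort_nodup _ _))]
  · have h1 := List.toFinset_card_of_nodup hnd
    have h2 : (l.map (spernerLabel σ x)).toFinset ⊆ σ := fun v hv => by
      obtain ⟨y, -, rfl⟩ := List.mem_map.1 (List.mem_toFinset.1 hv)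
      exact (spernerLabel_spec hσ y).1
    have h3 := Finset.card_le_card h2
    rw [h1, List.length_map, hl] at h3
    omega

theorem exists_one_le_of_mem_cell (hσ : σ.Nonempty) (hx : x ∈ cell σ) (hx0 : ∀ v ∈ σ, 0 < x v)
    {y : V → ℝ} (hy : y ∈ cell σ) : ∃ v ∈ σ, 1 ≤ y v / x v := by
  by_contra! h
  have h1 : ∑ v ∈ σ, y v < ∑ v ∈ σ, x v := Finset.sum_lt_sum_of_nonempty hσ fun v hv => by
    have := h v hv
    rwa [div_lt_one (hx0 v hv)] at this
  rw [sum_eq_one_of_mem_cell hx, sum_eq_one_of_mem_cell hy] at h1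
  exact lt_irrefl _ h1

theorem le_apply_spernerLabel (hσ : σ.Nonempty) (hx : x ∈ cell σ) (hx0 : ∀ v ∈ σ, 0 < x v)
    {y : V → ℝ} (hy : y ∈ cell σ) : x (spernerLabel σ x y) ≤ y (spernerLabel σ x y) := by
  obtain ⟨v, hv, h1⟩ := exists_one_le_of_mem_cell hσ hx hx0 hy
  obtain ⟨h2, h3⟩ := spernerLabel_spec (x := x) hσ y
  have := h1.trans (h3 v hv)
  rwa [one_le_div (hx0 _ h2)] at this

theorem spernerCochain_face (hσ : σ.Nonempty) (hx : x ∈ cell σ) (hx0 : ∀ v ∈ σ, 0 < x v)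
    {v : V} (hv : v ∈ σ) {l : List (V → ℝ)} (hl : InSet (cell (σ.erase v)) l) :
    spernerCochain σ x (of l) = 0 := by
  by_contra h
  have h1 : v ∈ l.map (spernerLabel σ x) :=
    (perm_of_spernerCochain_ne_zero h).mem_iff.2 ((Finset.mem_sort _).2 hv)
  obtain ⟨y, hy, rfl⟩ := List.mem_map.1 h1
  have h2 := hl y hy
  have h3 := le_apply_spernerLabel hσ hx hx0 (cell_mono (Finset.erase_subset _ _) h2)
  have h4 := hx0 _ hv
  exact absurd (h2.2 _ (h4.trans_le h3).ne') (by simp)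

theorem spernerLabel_vert (hσ : σ.Nonempty) (hx0 : ∀ v ∈ σ, 0 < x v) {v : V} (hv : v ∈ σ) :
    spernerLabel σ x (vert v) = v := by
  by_contra h
  have h1 := (spernerLabel_spec (x := x) hσ (vert v)).2 v hv
  have h2 : vert v (spernerLabel σ x (vert v)) = 0 := Pi.single_eq_of_ne h _
  have h3 : vert v v = 1 := Pi.single_eq_same _ _
  rw [h2, h3, zero_div] at h1
  exact absurd h1 (not_le.2 (div_pos one_pos (hx0 v hv)))

/-- Sperner's lemma for the subdivisions of `σ`. -/
theorem spernerCochain_realize (hσ : σ.Nonempty) (hx : x ∈ cell σ) (hx0 : ∀ v ∈ σ, 0 < x v)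
    (N : ℕ) : spernerCochain σ x (realize N (of σ.sort)) = 1 := by
  set D := homotopy (map vert) (realize N) fun l : List V => (l.map vert).headD 0 with hD
  have hb : bdry (D (of σ.sort)) = _ :=
    bdry_homotopy _ (fun c => bdry_map vert c) (fun c => bdry_realize N c)
      (by rw [realize_nil, map_of, List.map_nil]) _
  have hDσ : ∀ (s : Finset V) (l : List V), (∀ v ∈ l, v ∈ s) → D (of l) ∈ On (InSet (cell s)) := by
    intro s
    have hvert : ∀ l : List V, InSet (s : Set V) l → InSet (cell s) (l.map vert) := by
      intro l hl y hy
      obtain ⟨v, hv, rfl⟩ := List.mem_map.1 hy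
      exact vert_mem_cell (hl v hv)
    refine homotopy_mem_inSet (D := (s : Set V)) (fun l h0 hl => ?_) (fun l hl => ?_)
      (fun l hl => realize_mem_inSet N hl)
    · exact headD_mem 0 (by simpa using h0) (hvert l hl)
    · rw [map_of]
      exact of_mem_on (hvert l hl)
  have h1 : spernerCochain σ x (bdry (D (of σ.sort))) = 0 := by
    have hlen : D (of σ.sort) ∈ On fun l => l.length = σ.card + 1 :=
      homotopy_mem_length _ (map_mem_length vert) (fun n l hl => realize_mem_length N hl) _
        (Finset.length_sort (· ≤ ·))
    rw [← LinearMap.comp_apply]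
    refine apply_eq_zero_of_on _ (fun l hl => ?_) hlen
    rw [LinearMap.comp_apply]
    exact spernerCochain_bdry hσ hl
  have h2 : spernerCochain σ x (D (bdry (of σ.sort))) = 0 := by
    rw [bdry_of, map_sum, map_sum]
    refine Finset.sum_eq_zero fun i _ => ?_
    obtain ⟨v, hv⟩ : ∃ v, v = (σ.sort (· ≤ ·))[i] := ⟨_, rfl⟩
    have hmem : v ∈ σ := by
      rw [hv]
      exact (Finset.mem_sort (· ≤ ·)).1 (List.getElem_mem i.2)
    have hsub : ∀ w ∈ σ.sort.eraseIdx i, w ∈ σ.erase v := by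
      intro w hw
      rw [← (Finset.sort_nodup σ (· ≤ ·)).erase_getElem i i.2,
        (Finset.sort_nodup σ (· ≤ ·)).mem_erase_iff, Finset.mem_sort] at hw
      rw [Finset.mem_erase, hv]
      exact hw
    have h4 := hDσ (σ.erase v) _ hsub
    exact apply_eq_zero_of_on _ (fun l hl => spernerCochain_face hσ hx hx0 hmem hl) h4
  have h3 : spernerCochain σ x (map vert (of σ.sort)) = 1 := by
    rw [spernerCochain, LinearMap.comp_apply, map_of, map_of, orderingCochain, lift_of, if_pos]
    rw [List.map_map, List.map_congr_left (g := id), List.map_id]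
    intro v hv
    exact spernerLabel_vert hσ hx0 ((Finset.mem_sort _).1 hv)
  rw [hb, map_add, map_add, h2, h3, add_zero, add_eq_zero_iff] at h1
  exact h1.symm

/-- A small list with all Sperner labels is close to `x`. -/
theorem dist_le_of_spernerCochain_ne_zero (hσ : σ.Nonempty) (hx : x ∈ cell σ)
    (hx0 : ∀ v ∈ σ, 0 < x v) {ε : ℝ} {l : List (V → ℝ)} (hl : InSet (cell σ) l) (hsm : Small ε l)
    (h : spernerCochain σ x (of l) ≠ 0) : ∀ y ∈ l, dist y x ≤ σ.card * ε := by
  intro y hy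
  have hε : 0 ≤ ε := dist_nonneg.trans (hsm y hy y hy)
  have hc : (1 : ℝ) ≤ σ.card := by exact_mod_cast hσ.card_pos
  have hle : ∀ v ∈ σ, x v - ε ≤ y v := by
    intro v hv
    have h1 : v ∈ l.map (spernerLabel σ x) :=
      (perm_of_spernerCochain_ne_zero h).mem_iff.2 ((Finset.mem_sort _).2 hv)
    obtain ⟨z, hz, rfl⟩ := List.mem_map.1 h1
    have h2 := le_apply_spernerLabel hσ hx hx0 (hl z hz)
    have h3 := (dist_le_pi_dist z y (spernerLabel σ x z)).trans (hsm z hz y hy)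
    rw [Real.dist_eq] at h3
    have := (abs_le.1 h3).2
    linarith
  refine (dist_pi_le_iff (by positivity)).2 fun v => ?_
  by_cases hv : v ∈ σ
  · have h1 : ∑ w ∈ σ.erase v, (x w - ε) ≤ ∑ w ∈ σ.erase v, y w :=
      Finset.sum_le_sum fun w hw => hle w (Finset.mem_of_mem_erase hw)
    rw [Finset.sum_sub_distrib, Finset.sum_const, nsmul_eq_mul, Finset.card_erase_of_mem hv,
      Nat.cast_sub hσ.card_pos] at h1
    have h2 := Finset.add_sum_erase σ x hv
    have h3 := Finset.add_sum_erase σ y hv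
    rw [sum_eq_one_of_mem_cell hx] at h2
    rw [sum_eq_one_of_mem_cell (hl y hy)] at h3
    have h4 := hle v hv
    push_cast at h1
    rw [Real.dist_eq, abs_le]
    constructor <;> nlinarith
  · have h1 : y v = 0 := by_contra fun h => hv ((hl y hy).2 v h)
    have h2 : x v = 0 := by_contra fun h => hv (hx.2 v h)
    rw [h1, h2, dist_self]
    positivity

end Sperner

open Classical in
/-- The restriction of the Sperner cochain to the lists in the ball of radius `r` about `x`. -/
def localCochain (σ : Finset V) (x : V → ℝ) (r : ℝ) : ListChain (V → ℝ) →ₗ[ZMod 2] ZMod 2 :=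
  lift fun l => if InSet (Metric.ball x r) l then spernerCochain σ x (of l) else 0

/-- For an interior point `x` of an `m`-simplex and a small ball `B` about `x`, there is a cochain
on small lists of points of `|K|` which is a cocycle, vanishes on the lists that are not contained
in `B`, and takes the value `1` on the fundamental cycle. -/
theorem exists_localCochain (hK : IsPure K m) (σ : Simplices K m) {x : V → ℝ} {r : ℝ}
    (hx : x ∈ cell σ.1) (hx0 : ∀ v ∈ σ.1, 0 < x v) (hr : 0 < r)
    (hball : ∀ y ∈ Metric.ball x r, ∀ v ∈ σ.1, 0 < y v) :
    ∃ ε > 0, ∃ b : ListChain (V → ℝ) →ₗ[ZMod 2] ZMod 2,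
      (∀ l, InSet (poly K) l → Small ε l → l.length = m + 2 → b (bdry (of l)) = 0) ∧
      (∀ l, (∃ y ∈ l, y ∉ Metric.ball x r) → b (of l) = 0) ∧
      ∃ N₀ : ℕ, ∀ N, N₀ ≤ N → b (realize N (fund K m)) = 1 := by
  have hcard : σ.1.card = m + 1 := σ.2.2
  have hσ : σ.1.Nonempty := Finset.card_pos.1 (by omega)
  have hbK : ∀ y ∈ poly K, y ∈ Metric.ball x r → y ∈ cell σ.1 := by
    rintro y ⟨s, hs, hy⟩ hyr
    have hsub : σ.1 ⊆ s := fun v hv => hy.2 v (hball y hyr v hv).ne'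
    rw [hK.eq_of_subset hs hcard hsub]
    exact hy
  set ε : ℝ := r / (m + 3) with hε
  have hε0 : 0 < ε := by positivity
  have hεr : ((m : ℝ) + 1) * ε + ε < r := by
    have : ((m : ℝ) + 3) * ε = r := by
      rw [hε]
      field_simp
    nlinarith
  have hcl : ∀ l, InSet (cell σ.1) l → Small ε l → spernerCochain σ.1 x (of l) ≠ 0 →
      ∀ y ∈ l, dist y x ≤ (m + 1) * ε := by
    intro l hl hsm h y hy
    have := dist_le_of_spernerCochain_ne_zero hσ hx hx0 hl hsm h y hy
    rw [hcard] at this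
    exact_mod_cast this
  have hzero : ∀ l, (∃ y ∈ l, y ∉ Metric.ball x r) → localCochain σ.1 x r (of l) = 0 := by
    rintro l ⟨y, hy, hyr⟩
    rw [localCochain, lift_of, if_neg fun h => hyr (h y hy)]
  refine ⟨ε, hε0, localCochain σ.1 x r, ?_, hzero, ?_⟩
  · intro l hl hsm hlen
    by_cases hin : InSet (Metric.ball x r) l
    · have h1 := spernerCochain_bdry (x := x) hσ (l := l) (by omega)
      rw [bdry_of, map_sum] at h1 ⊢
      rw [← h1]
      refine Finset.sum_congr rfl fun i _ => ?_
      rw [localCochain, lift_of, if_pos (hin.eraseIdx i)]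
    · -- A face inside the ball with all labels would force the remaining point into the ball.
      obtain ⟨y, hy, hyr⟩ : ∃ y ∈ l, y ∉ Metric.ball x r := by
        by_contra! h
        exact hin h
      rw [bdry_of, map_sum]
      refine Finset.sum_eq_zero fun i _ => ?_
      rw [localCochain, lift_of]
      split_ifs with hi
      · by_contra h
        have hsub : ∀ z ∈ l.eraseIdx i, z ∈ l := fun z hz => List.mem_of_mem_eraseIdx hz
        obtain ⟨z, hz⟩ : ∃ z, z ∈ l.eraseIdx i := by
          refine List.exists_mem_of_ne_nil _ fun h0 => ?_
          have := length_eraseIdx_add_one i.2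
          rw [h0, List.length_nil] at this
          omega
        have h1 := hcl _ (fun z hz => hbK z (hl z (hsub z hz)) (hi z hz)) (hsm.eraseIdx i) h z hz
        have h2 := hsm y hy z (hsub z hz)
        apply hyr
        rw [Metric.mem_ball]
        have := dist_triangle y z x
        linarith
      · rfl
  · obtain ⟨N₀, hN₀⟩ := exists_iterSubdiv_small (E := V → ℝ) (m + 1) 1 hε0
    refine ⟨N₀, fun N hN => ?_⟩
    have hsmall : realize N (of σ.1.sort) ∈ On fun l => InSet (cell σ.1) l ∧ Small ε l := by
      refine on_and (realize_mem_inSet N fun v hv => (Finset.mem_sort _).1 hv) ?_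
      rw [realize_apply]
      refine map_mem_of_on (p := fun l => InSet (cell σ.1) l ∧ l.length = m + 1) _ _
        (fun l hl => hN₀ N hN l hl.2 (small_of_inSet_cell hl.1)) (map_mem_on
          (p := fun l => InSet (σ.1 : Set V) l ∧ l.length = m + 1) _ (fun l hl => ⟨?_, ?_⟩)
          (on_and (normalize_mem_inSet _ _ fun v hv => (Finset.mem_sort _).1 hv)
          (normalize_mem_length _ ((Finset.length_sort _).trans hcard))))
      · intro y hy
        obtain ⟨v, hv, rfl⟩ := List.mem_map.1 hy
        exact vert_mem_cell (hl.1 v hv)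
      · simpa using hl.2
    rw [fund, map_sum, map_sum, Finset.sum_eq_single σ]
    · rw [← spernerCochain_realize hσ hx hx0 N]
      refine eqOn_of_on _ _ (fun l hl => ?_) hsmall
      rw [localCochain, lift_of]
      split_ifs with h
      · rfl
      · by_contra hne
        refine h fun y hy => ?_
        have := hcl l hl.1 hl.2 (Ne.symm hne) y hy
        rw [Metric.mem_ball]
        linarith
    · intro s _ hs
      refine apply_eq_zero_of_on (localCochain σ.1 x r) (fun l hl => ?_)
        (on_and (realize_mem_inSet N (s := s.1) fun v hv => (Finset.mem_sort _).1 hv)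
          (realize_mem_length N ((Finset.length_sort _).trans s.2.2)))
      obtain ⟨y, hy⟩ : ∃ y, y ∈ l :=
        List.exists_mem_of_length_pos (by rw [hl.2]; omega)
      refine hzero l ⟨y, hy, fun hyr => hs ?_⟩
      have hsub : σ.1 ⊆ s.1 := fun v hv => (hl.1 y hy).2 v (hball y hyr v hv).ne'
      exact Subtype.ext (hK.eq_of_subset s.2.1 hcard hsub).symm
    · intro h
      exact absurd (Finset.mem_univ σ) h

end Fundamental

section Involution

variable {V : Type} [Fintype V]

theorem exists_dist_le_of_continuousOn {K : AbstractSimplicialComplex V} {F : Type*}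
    [PseudoMetricSpace F] {f : (V → ℝ) → F} (hf : ContinuousOn f (poly K)) {ε : ℝ} (hε : 0 < ε) :
    ∃ δ > 0, ∀ x ∈ poly K, ∀ y ∈ poly K, dist x y ≤ δ → dist (f x) (f y) ≤ ε := by
  obtain ⟨δ, hδ, h⟩ := Metric.uniformContinuousOn_iff.1
    ((isCompact_poly K).uniformContinuousOn_of_continuous hf) ε hε
  exact ⟨δ / 2, by positivity, fun x hx y hy hxy => (h x hx y hy (by linarith)).le⟩

theorem exists_pos_forall_le {ι : Type*} [Finite ι] {f : ι → ℝ} (hf : ∀ i, 0 < f i) :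
    ∃ ε > 0, ∀ i, ε ≤ f i := by
  rcases isEmpty_or_nonempty ι with h | h
  · exact ⟨1, one_pos, fun i => h.elim i⟩
  · obtain ⟨i, hi⟩ := Finite.exists_min f
    exact ⟨f i, hf i, hi⟩

/-- The map `A` restricts to a continuous involution of the polyhedron of `K`. -/
structure InvolutionOn (K : AbstractSimplicialComplex V) (A : (V → ℝ) → (V → ℝ)) : Prop where
  mapsTo : ∀ x ∈ poly K, A x ∈ poly K
  continuousOn : ContinuousOn A (poly K)
  apply_apply : ∀ x ∈ poly K, A (A x) = x

variable [LinearOrder V] [Nonempty V] {K : AbstractSimplicialComplex V} {m : ℕ}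
  {A : (V → ℝ) → (V → ℝ)}

theorem InvolutionOn.map_map (hA : InvolutionOn K A) {c : ListChain (V → ℝ)}
    (hc : c ∈ On (InSet (poly K))) : map A (map A c) = c := by
  rw [← LinearMap.comp_apply]
  refine eqOn_of_on (map A ∘ₗ map A) LinearMap.id (fun l hl => ?_) hc
  rw [LinearMap.comp_apply, map_of, map_of, List.map_map, LinearMap.id_apply,
    List.map_congr_left (g := id), List.map_id]
  exact fun x hx => hA.apply_apply x (hl x hx)

theorem InvolutionOn.exists_small (hA : InvolutionOn K A) {ε : ℝ} (hε : 0 < ε) (n : ℕ) :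
    ∃ δ > 0, δ ≤ ε ∧ ∀ c ∈ On (fun l => InSet (poly K) l ∧ Small δ l ∧ l.length = n),
      map A c ∈ On (fun l => InSet (poly K) l ∧ Small ε l ∧ l.length = n) := by
  obtain ⟨δ, hδ, h⟩ := exists_dist_le_of_continuousOn hA.continuousOn hε
  refine ⟨min δ ε, lt_min hδ hε, min_le_right _ _, fun c hc => map_mem_on _ (fun l hl => ?_) hc⟩
  refine ⟨fun y hy => ?_, fun y hy z hz => ?_, by simpa using hl.2.2⟩
  · obtain ⟨x, hx, rfl⟩ := List.mem_map.1 hy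
    exact hA.mapsTo x (hl.1 x hx)
  · obtain ⟨x, hx, rfl⟩ := List.mem_map.1 hy
    obtain ⟨w, hw, rfl⟩ := List.mem_map.1 hz
    exact h x (hl.1 x hx) w (hl.1 w hw) ((hl.2.1 x hx w hw).trans (min_le_left _ _))

theorem small_mem_mono {ε ε' : ℝ} (h : ε ≤ ε') {n : ℕ} {c : ListChain (V → ℝ)}
    (hc : c ∈ On (fun l => InSet (poly K) l ∧ Small ε l ∧ l.length = n)) :
    c ∈ On (fun l => InSet (poly K) l ∧ Small ε' l ∧ l.length = n) :=
  on_mono (fun _ hl => ⟨hl.1, hl.2.1.mono h, hl.2.2⟩) hc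

/-! ### Invariance of the fundamental cycle -/

/-- For every `m`-simplex `τ` there is a point `x` in the interior of some `m`-simplex which `A`
maps to the interior of `τ`. The associated local cochain vanishes on the image under `A` of the
complement of the interior of `τ`. -/
theorem InvolutionOn.exists_localCochain (hA : InvolutionOn K A) (hK : IsPure K m)
    (τ : Simplices K m) :
    ∃ ε > 0, ∃ b : ListChain (V → ℝ) →ₗ[ZMod 2] ZMod 2,
      (∀ l, InSet (poly K) l → Small ε l → l.length = m + 2 → b (bdry (of l)) = 0) ∧
      (∀ l, (∃ y ∈ l, y ∈ poly K ∧ ∃ v ∈ τ.1, A y v ≤ 0) → b (of l) = 0) ∧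
      ∃ N₀ : ℕ, ∀ N, N₀ ≤ N → b (realize N (fund K m)) = 1 := by
  have hcenter : ∀ s : Simplices K m, ∃ y ∈ cell s.1, ∀ v ∈ s.1, 0 < y v := by
    intro s
    have hc : (0 : ℝ) < s.1.card := by
      rw [s.2.2]
      positivity
    refine ⟨fun v => if v ∈ s.1 then (s.1.card : ℝ)⁻¹ else 0, ⟨⟨fun v => ?_, ?_⟩, fun v hv => ?_⟩,
      fun v hv => ?_⟩
    · dsimp only
      split_ifs <;> positivity
    · rw [Finset.sum_ite_mem, Finset.univ_inter, Finset.sum_const, nsmul_eq_mul,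
        mul_inv_cancel₀ hc.ne']
    · by_contra h
      exact hv (if_neg h)
    · dsimp only
      rw [if_pos hv]
      positivity
  obtain ⟨y₀, hy₀, hy₀p⟩ := hcenter τ
  have hy₀K : y₀ ∈ poly K := ⟨τ.1, τ.2.1, hy₀⟩
  have hx₀K := hA.mapsTo _ hy₀K
  set x₀ := A y₀ with hx₀
  obtain ⟨s, hs, hx₀s⟩ := hx₀K
  obtain ⟨t, ht, hst, htc⟩ := hK s hs
  have hx₀t : x₀ ∈ cell t := cell_mono hst hx₀s
  -- Near `x₀`, points are mapped to the interior of `τ`.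
  obtain ⟨r₁, hr₁, hnear⟩ : ∃ r > 0, ∀ y ∈ poly K, dist y x₀ < r → ∀ v ∈ τ.1, 0 < A y v := by
    have h1 : ∀ᶠ y in nhdsWithin x₀ (poly K), ∀ v ∈ τ.1, 0 < A y v := by
      refine (Filter.eventually_all_finset τ.1).2 fun v hv => ?_
      have h2 : Filter.Tendsto (fun y => A y v) (nhdsWithin x₀ (poly K)) (nhds (A x₀ v)) :=
        ((continuous_apply v).tendsto _).comp (hA.continuousOn x₀ ⟨s, hs, hx₀s⟩)
      refine h2.eventually (lt_mem_nhds ?_)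
      rw [hx₀, hA.apply_apply y₀ hy₀K]
      exact hy₀p v hv
    obtain ⟨r, hr, h2⟩ := Metric.mem_nhdsWithin_iff.1 h1
    exact ⟨r, hr, fun y hy hyr => h2 ⟨hyr, hy⟩⟩
  obtain ⟨c, hc, hcp⟩ := hcenter ⟨t, ht, htc⟩
  set θ : ℝ := min (1 / 2) (r₁ / 4) with hθ
  have hθ0 : 0 < θ := lt_min (by norm_num) (by positivity)
  have hθ1 : θ ≤ 1 / 2 := min_le_left _ _
  have hθ2 : θ ≤ r₁ / 4 := min_le_right _ _
  set x : V → ℝ := (1 - θ) • x₀ + θ • c with hx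
  have hxt : x ∈ cell t := convex_cell t hx₀t hc (by linarith) hθ0.le (by ring)
  have hxp : ∀ v ∈ t, 0 < x v := by
    intro v hv
    have h1 := hcp v hv
    have h2 := (abs_le_one_of_mem_cell hx₀t v).1
    have h3 : x v = (1 - θ) * x₀ v + θ * c v := rfl
    rw [h3]
    have : 0 ≤ (1 - θ) * x₀ v := mul_nonneg (by linarith) h2
    have : 0 < θ * c v := mul_pos hθ0 h1
    linarith
  have hxx₀ : dist x x₀ ≤ r₁ / 4 := by
    have h1 : x - x₀ = θ • (c - x₀) := by
      rw [hx, sub_smul, one_smul, smul_sub]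
      abel
    have h2 : dist c x₀ ≤ 1 := small_of_inSet_cell (s := t) (l := [c, x₀])
      (by
        intro y hy
        rcases List.mem_pair.1 hy with rfl | rfl
        · exact hc
        · exact hx₀t) c (by simp) x₀ (by simp)
    rw [dist_eq_norm, h1, norm_smul, Real.norm_of_nonneg hθ0.le, ← dist_eq_norm]
    nlinarith
  obtain ⟨r₂, hr₂, hpos⟩ : ∃ r > 0, ∀ y ∈ Metric.ball x r, ∀ v ∈ t, 0 < y v := by
    have h1 : ∀ᶠ y in nhds x, ∀ v ∈ t, 0 < y v :=
      (Filter.eventually_all_finset t).2 fun v hv =>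
        ((continuous_apply v).tendsto x).eventually (lt_mem_nhds (hxp v hv))
    obtain ⟨r, hr, h2⟩ := Metric.mem_nhds_iff.1 h1
    exact ⟨r, hr, fun y hy => h2 hy⟩
  obtain ⟨ε, hε, b, hb1, hb2, hb3⟩ := _root_.exists_localCochain hK ⟨t, ht, htc⟩ hxt hxp
    (lt_min hr₂ (by positivity : 0 < r₁ / 2))
    (fun y hy => hpos y (Metric.ball_subset_ball (min_le_left _ _) hy))
  refine ⟨ε, hε, b, hb1, ?_, hb3⟩
  rintro l ⟨y, hy, hyK, v, hv, hyv⟩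
  refine hb2 l ⟨y, hy, fun hyr => not_lt.2 hyv (hnear y hyK ?_ v hv)⟩
  have h1 : dist y x < r₁ / 2 := hyr.trans_le (min_le_right _ _)
  have := dist_triangle y x x₀
  linarith

theorem realize_fund_mem (N : ℕ) :
    realize N (fund K m) ∈ On fun l => InSet (poly K) l ∧ l.length = m + 1 := by
  rw [fund, map_sum]
  refine Submodule.sum_mem _ fun s _ => on_mono (fun l hl => ⟨fun x hx => ⟨s.1, s.2.1, hl.1 x hx⟩,
    hl.2⟩) (on_and (realize_mem_inSet N (s := s.1) fun v hv => (Finset.mem_sort _).1 hv)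
    (realize_mem_length N ((Finset.length_sort (· ≤ ·)).trans s.2.2)))

/-- The subdivisions of the fundamental cycle get arbitrarily fine. -/
theorem exists_realize_fund_small (K : AbstractSimplicialComplex V) (m : ℕ) {ε : ℝ} (hε : 0 < ε) :
    ∃ N₀ : ℕ, ∀ N, N₀ ≤ N →
      realize N (fund K m) ∈ On fun l => InFace K l ∧ Small ε l ∧ l.length = m + 1 := by
  obtain ⟨N₀, hN₀⟩ := exists_iterSubdiv_small (E := V → ℝ) (m + 1) 1 hε
  refine ⟨N₀, fun N hN => ?_⟩
  rw [fund, map_sum]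
  refine Submodule.sum_mem _ fun s _ => ?_
  have h1 : map vert (normalize (of s.1.sort)) ∈ On fun l => InSet (cell s.1) l ∧
      l.length = m + 1 := by
    refine map_mem_on (p := fun l => InSet (s.1 : Set V) l ∧ l.length = m + 1) _
      (fun l hl => ⟨?_, by simpa using hl.2⟩) (on_and
        (normalize_mem_inSet _ _ fun v hv => (Finset.mem_sort _).1 hv)
        (normalize_mem_length _ ((Finset.length_sort (· ≤ ·)).trans s.2.2)))
    intro y hy
    obtain ⟨v, hv, rfl⟩ := List.mem_map.1 hy
    exact vert_mem_cell (hl.1 v hv)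
  rw [realize_apply]
  refine on_mono (p := fun l => (InSet (cell s.1) l ∧ Small ε l) ∧ l.length = m + 1)
    (fun l hl => ⟨⟨s.1, s.2.1, hl.1.1⟩, hl.1.2, hl.2⟩) (on_and (on_and ?_ ?_) ?_)
  · exact iterSubdiv_mem_inSet (convex_cell _) N (on_mono (fun l hl => hl.1) h1)
  · exact map_mem_of_on _ _ (fun l hl => hN₀ N hN l hl.2 (small_of_inSet_cell hl.1)) h1
  · exact iterSubdiv_mem_length N (on_mono (fun l hl => hl.2) h1)

/-- The involution preserves the fundamental class: the fundamental cycle and its image are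
homologous through small chains. Otherwise the image would be homologous to a simplicial cycle
missing some `m`-simplex `τ`, and then the fundamental cycle would be homologous to a cycle missing
the nonempty open set of points mapped to the interior of `τ`. -/
theorem InvolutionOn.exists_bdry_eq_fund (hA : InvolutionOn K A) (hK : IsPure K m)
    (hcyc : bdry (fund K m) = 0) {ε : ℝ} (hε : 0 < ε) :
    ∃ N₀ : ℕ, ∀ N, N₀ ≤ N → ∃ w ∈ On (fun l => InSet (poly K) l ∧ Small ε l ∧ l.length = m + 2),
      bdry w = realize N (fund K m) + map A (realize N (fund K m)) := by
  choose ε₁ hε₁ b hb1 hb2 N₁ hN₁ using fun τ => hA.exists_localCochain hK τ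
  obtain ⟨ε₂, hε₂, hε₂le⟩ := exists_pos_forall_le hε₁
  obtain ⟨ε₃, hε₃, -, hAε₃⟩ := hA.exists_small hε₂ (m + 2)
  obtain ⟨δ, hδ, N₂, happ⟩ := exists_simplicial_approx K (m + 1) (Nat.succ_ne_zero m)
    (lt_min hε hε₃)
  obtain ⟨δ', hδ', -, hAδ'⟩ := hA.exists_small hδ (m + 1)
  obtain ⟨N₃, hN₃⟩ := exists_realize_fund_small K m hδ'
  refine ⟨Finset.univ.sup N₁ + N₂ + N₃, fun N hN => ?_⟩
  have hNN₁ : ∀ τ, N₁ τ ≤ N := fun τ => by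
    have := Finset.le_sup (f := N₁) (Finset.mem_univ τ)
    omega
  set z := realize N (fund K m) with hz
  have hz0 : bdry z = 0 := by rw [hz, bdry_realize, hcyc, map_zero]
  have hzOn : z ∈ On fun l => InSet (poly K) l ∧ Small δ' l ∧ l.length = m + 1 :=
    on_mono (fun l hl => ⟨hl.1.inSet, hl.2⟩) (hN₃ N (by omega))
  have hAz0 : bdry (map A z) = 0 := by rw [bdry_map, hz0, map_zero]
  obtain ⟨d, hd, happ⟩ := happ _ (hAδ' z hzOn) hAz0
  obtain ⟨w, hw, hbw⟩ := happ N (by omega)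
  obtain ⟨n, hn⟩ := normalize_eq_sum_of_length hK hd
  have hreal : realize N d = ∑ s, n s • realize N (of s.1.sort) := by
    rw [realize_apply, hn]
    simp only [map_sum, map_smul, realize_apply]
  have hone : ∀ τ, n τ = 1 := by
    intro τ
    by_contra hne
    have hn0 : n τ = 0 := by
      generalize n τ = a at hne
      revert a
      decide
    have h1 : b τ (bdry (map A w)) = 0 := by
      have hAw := hAε₃ w (small_mem_mono (min_le_right _ _) hw)
      rw [← LinearMap.comp_apply]
      refine apply_eq_zero_of_on _ (fun l hl => ?_) hAw
      rw [LinearMap.comp_apply]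
      exact hb1 τ l hl.1 (hl.2.1.mono (hε₂le τ)) hl.2.2
    have h2 : b τ (map A (realize N d)) = 0 := by
      rw [hreal, map_sum, map_sum]
      refine Finset.sum_eq_zero fun s _ => ?_
      by_cases hs : s = τ
      · rw [hs, hn0, zero_smul, map_zero, map_zero]
      · rw [map_smul, map_smul, ← LinearMap.comp_apply (b τ), apply_eq_zero_of_on _ (fun l hl => ?_)
          (on_and (realize_mem_inSet N (s := s.1) fun v hv => (Finset.mem_sort _).1 hv)
            (realize_mem_length N ((Finset.length_sort (· ≤ ·)).trans s.2.2))), smul_zero]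
        rw [LinearMap.comp_apply, map_of]
        obtain ⟨y, hy⟩ : ∃ y, y ∈ l := List.exists_mem_of_length_pos (by rw [hl.2]; omega)
        have hyK : y ∈ poly K := ⟨s.1, s.2.1, hl.1 y hy⟩
        refine hb2 τ _ ⟨A y, List.mem_map_of_mem hy, hA.mapsTo y hyK, ?_⟩
        rw [hA.apply_apply y hyK]
        by_contra! h
        have hsub : τ.1 ⊆ s.1 := fun v hv => (hl.1 y hy).2 v (h v hv).ne'
        exact hs (Subtype.ext (hK.eq_of_subset s.2.1 τ.2.2 hsub).symm)
    have h3 : bdry (map A w) = z + map A (realize N d) := by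
      rw [bdry_map, hbw, map_add, hA.map_map (on_mono (fun l hl => hl.1) hzOn)]
    rw [h3, map_add, h2, hN₁ τ N (hNN₁ τ), add_zero] at h1
    exact one_ne_zero h1
  refine ⟨w, small_mem_mono (min_le_left _ _) hw, ?_⟩
  rw [hbw, hreal, add_comm, hz, fund, map_sum]
  congr 1
  exact Finset.sum_congr rfl fun s _ => by rw [hone, one_smul]

/-! ### Independence of the labelling -/

/-- An equivariant labelling of `|K|` by signed labels with absolute values in `[lo, hi)`, such
that points of distance at most `η` do not have opposite labels. -/
structure IsLabelling (K : AbstractSimplicialComplex V) (A : (V → ℝ) → (V → ℝ))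
    (ℓ : (V → ℝ) → Label) (lo hi : ℕ) (η : ℝ) : Prop where
  map_eq : ∀ x ∈ poly K, ℓ (A x) = Label.neg (ℓ x)
  mem : ∀ x ∈ poly K, lo ≤ (ℓ x).1 ∧ (ℓ x).1 < hi
  ne_neg : ∀ x ∈ poly K, ∀ y ∈ poly K, dist x y ≤ η → Label.neg (ℓ x) ≠ ℓ y

theorem IsLabelling.octa {ℓ : (V → ℝ) → Label} {lo hi : ℕ} {η : ℝ}
    (h : IsLabelling K A ℓ lo hi η) {l : List (V → ℝ)} (hl : InSet (poly K) l) (hsm : Small η l) :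
    Label.Octa lo hi (l.map ℓ) := by
  refine ⟨fun a ha ha' => ?_, fun a ha => ?_⟩
  · obtain ⟨x, hx, rfl⟩ := List.mem_map.1 ha
    obtain ⟨y, hy, hxy⟩ := List.mem_map.1 ha'
    exact h.ne_neg x (hl x hx) y (hl y hy) (hsm x hx y hy) hxy.symm
  · obtain ⟨x, hx, rfl⟩ := List.mem_map.1 ha
    exact h.mem x (hl x hx)

section

variable {ℓ₁ ℓ₂ : (V → ℝ) → Label}

/-- The homotopy between two labellings. -/
def labelHomotopy (ℓ₁ ℓ₂ : (V → ℝ) → Label) : ListChain (V → ℝ) →ₗ[ZMod 2] ListChain Label :=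
  homotopy (map ℓ₁) (map ℓ₂) fun l => (l.map ℓ₁).headD default

theorem bdry_labelHomotopy (c : ListChain (V → ℝ)) :
    bdry (labelHomotopy ℓ₁ ℓ₂ c) = map ℓ₁ c + map ℓ₂ c + labelHomotopy ℓ₁ ℓ₂ (bdry c) :=
  bdry_homotopy _ (bdry_map ℓ₁) (bdry_map ℓ₂)
    (by rw [map_of, map_of, List.map_nil, List.map_nil]) c

theorem labelHomotopy_map (h₁ : ∀ x ∈ poly K, ℓ₁ (A x) = Label.neg (ℓ₁ x))
    (h₂ : ∀ x ∈ poly K, ℓ₂ (A x) = Label.neg (ℓ₂ x)) {c : ListChain (V → ℝ)}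
    (hc : c ∈ On (InSet (poly K))) :
    labelHomotopy ℓ₁ ℓ₂ (map A c) = map Label.neg (labelHomotopy ℓ₁ ℓ₂ c) := by
  have key : ∀ (n : ℕ) (l : List (V → ℝ)), l.length = n → InSet (poly K) l →
      labelHomotopy ℓ₁ ℓ₂ (of (l.map A)) = map Label.neg (labelHomotopy ℓ₁ ℓ₂ (of l)) := by
    intro n
    induction n with
    | zero =>
      intro l hl _
      rw [List.length_eq_zero_iff.1 hl, List.map_nil, labelHomotopy, homotopy_nil, map_zero]
    | succ n ih =>
      intro l hl hlK
      have h0 : l ≠ [] := by rintro rfl; simp at hl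
      have e : ∀ ℓ : (V → ℝ) → Label, (∀ x ∈ poly K, ℓ (A x) = Label.neg (ℓ x)) →
          (l.map A).map ℓ = (l.map ℓ).map Label.neg := by
        intro ℓ h
        rw [List.map_map, List.map_map]
        exact List.map_congr_left fun x hx => h x (hlK x hx)
      have hhead : ((l.map ℓ₁).map Label.neg).headD default =
          Label.neg ((l.map ℓ₁).headD default) := by
        cases l with
        | nil => exact absurd rfl h0
        | cons x l => rfl
      have hb : labelHomotopy ℓ₁ ℓ₂ (bdry (of (l.map A))) =
          map Label.neg (labelHomotopy ℓ₁ ℓ₂ (bdry (of l))) := by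
        rw [← map_of, bdry_map, bdry_of]
        simp only [map_sum]
        refine Finset.sum_congr rfl fun i _ => ?_
        rw [map_of]
        have := length_eraseIdx_add_one i.2
        exact ih _ (by omega) (hlK.eraseIdx i)
      rw [labelHomotopy] at hb ⊢
      rw [homotopy_of _ (by simpa using h0), homotopy_of _ h0, map_cone, map_add (map Label.neg),
        map_add (map Label.neg), hb, map_of, map_of, map_of, map_of, map_of, map_of, e _ h₁, e _ h₂,
        hhead]
  rw [← LinearMap.comp_apply, ← LinearMap.comp_apply]
  refine eqOn_of_on _ _ (fun l hl => ?_) hc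
  rw [LinearMap.comp_apply, LinearMap.comp_apply, map_of]
  exact key _ l rfl hl

theorem fan_labelHomotopy_eq_zero {k k' : ℕ} {η : ℝ} (h₁ : IsLabelling K A ℓ₁ 0 k η)
    (h₂ : IsLabelling K A ℓ₂ k k' η) {n : ℕ} (hn : k' ≤ n) {c : ListChain (V → ℝ)}
    (hc : c ∈ On fun l => InSet (poly K) l ∧ Small η l ∧ l.length = n) :
    Label.fan (labelHomotopy ℓ₁ ℓ₂ c) = 0 := by
  refine Label.fan_eq_zero_of_on (Nat.zero_le k') (n := n + 1) (by omega)
    (map_mem_of_on _ _ (fun l hl => ?_) hc)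
  have h3 : labelHomotopy ℓ₁ ℓ₂ (of l) ∈
      On (InSet {a | ∃ x ∈ l, a = ℓ₁ x ∨ a = ℓ₂ x}) := by
    refine homotopy_mem_inSet (D := {x | x ∈ l}) (fun l' h0 hl' => ?_) (fun l' hl' => ?_)
      (fun l' hl' => ?_) l (fun _ h => h)
    · refine headD_mem _ (by simpa using h0) fun a ha => ?_
      obtain ⟨x, hx, rfl⟩ := List.mem_map.1 ha
      exact ⟨x, hl' x hx, Or.inl rfl⟩
    · rw [map_of]
      refine of_mem_on fun a ha => ?_
      obtain ⟨x, hx, rfl⟩ := List.mem_map.1 ha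
      exact ⟨x, hl' x hx, Or.inl rfl⟩
    · rw [map_of]
      refine of_mem_on fun a ha => ?_
      obtain ⟨x, hx, rfl⟩ := List.mem_map.1 ha
      exact ⟨x, hl' x hx, Or.inr rfl⟩
  have h4 : labelHomotopy ℓ₁ ℓ₂ (of l) ∈ On fun l => l.length = n + 1 :=
    homotopy_mem_length _ (map_mem_length ℓ₁) (map_mem_length ℓ₂) l hl.2.2
  refine on_mono ?_ (on_and h3 h4)
  rintro l' ⟨h5, h6⟩
  refine ⟨⟨fun a ha ha' => ?_, fun a ha => ?_⟩, h6⟩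
  · obtain ⟨x, hx, hax⟩ := h5 a ha
    obtain ⟨y, hy, hay⟩ := h5 _ ha'
    have hxK := hl.1 x hx
    have hyK := hl.1 y hy
    have hxy := hl.2.1 x hx y hy
    have m1 := h₁.mem x hxK
    have m2 := h₂.mem x hxK
    have m3 := h₁.mem y hyK
    have m4 := h₂.mem y hyK
    have hfst : (Label.neg a).1 = a.1 := rfl
    rcases hax with rfl | rfl <;> rcases hay with hay | hay
    · exact h₁.ne_neg x hxK y hyK hxy hay
    · have := congrArg Prod.fst hay
      omega
    · have := congrArg Prod.fst hay
      omega
    · exact h₂.ne_neg x hxK y hyK hxy hay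
  · obtain ⟨x, hx, rfl | rfl⟩ := h5 a ha
    · have := h₁.mem x (hl.1 x hx)
      have := h₂.mem x (hl.1 x hx)
      omega
    · have := h₂.mem x (hl.1 x hx)
      omega

theorem fan_labelHomotopy_bdry (h₁ : ∀ x ∈ poly K, ℓ₁ (A x) = Label.neg (ℓ₁ x))
    (h₂ : ∀ x ∈ poly K, ℓ₂ (A x) = Label.neg (ℓ₂ x)) {c : ListChain (V → ℝ)}
    (hc : c ∈ On (InSet (poly K))) :
    Label.fan (labelHomotopy ℓ₁ ℓ₂ (c + map A c)) = Label.fan (map ℓ₁ c) +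
      Label.fan (map ℓ₂ c) + Label.fan (labelHomotopy ℓ₁ ℓ₂ (bdry c)) := by
  rw [map_add, labelHomotopy_map h₁ h₂ hc, map_add, ← Label.fan_bdry, bdry_labelHomotopy, map_add,
    map_add]

/-- If `u` is a small chain of dimension `> m` such that `u + A u` is a cycle, then it bounds a
small chain `w`, with the same property, and the values of the cochain `fan ∘ labelHomotopy` on
`u + A u` and on `w + A w` agree. Iterating, one reaches the dimensions where this cochain
vanishes. -/
theorem fan_labelHomotopy_add_eq_zero (hA : InvolutionOn K A) (hK : IsPure K m) {η : ℝ}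
    (hη : 0 < η) (h₁ : IsLabelling K A ℓ₁ 0 (m + 1) η)
    (h₂ : IsLabelling K A ℓ₂ (m + 1) (2 * m + 2) η) :
    ∀ j n : ℕ, m + 2 ≤ n → 2 * m + 2 ≤ n + j → ∃ δ > 0, δ ≤ η ∧
      ∀ u ∈ On (fun l => InSet (poly K) l ∧ Small δ l ∧ l.length = n),
        bdry (u + map A u) = 0 → Label.fan (labelHomotopy ℓ₁ ℓ₂ (u + map A u)) = 0 := by
  intro j
  induction j with
  | zero =>
    intro n _ hn
    obtain ⟨δ, hδ, hδη, hAδ⟩ := hA.exists_small hη n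
    refine ⟨δ, hδ, hδη, fun u hu _ => ?_⟩
    rw [map_add, map_add, fan_labelHomotopy_eq_zero h₁ h₂ hn (small_mem_mono hδη hu),
      fan_labelHomotopy_eq_zero h₁ h₂ hn (hAδ u hu), add_zero]
  | succ j ih =>
    intro n hmn hn
    obtain ⟨δ₁, hδ₁, hδ₁η, ih⟩ := ih (n + 1) (by omega) (by omega)
    obtain ⟨δ₂, hδ₂, N, happ⟩ := exists_simplicial_approx K n (by omega) hδ₁
    obtain ⟨δ, hδ, hδδ₂, hAδ⟩ := hA.exists_small hδ₂ n
    refine ⟨min δ η, lt_min hδ hη, min_le_right _ _, fun u hu hu0 => ?_⟩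
    have huδ := small_mem_mono (min_le_left δ η) hu
    obtain ⟨d, hd, happ⟩ := happ (u + map A u)
      (Submodule.add_mem _ (small_mem_mono hδδ₂ huδ) (hAδ u huδ)) hu0
    obtain ⟨w, hw, hbw⟩ := happ N le_rfl
    rw [realize_apply, normalize_eq_zero_of_length hK (by omega) hd, map_zero, map_zero,
      add_zero] at hbw
    have hwη := small_mem_mono hδ₁η hw
    have hw1 : Label.fan (map ℓ₁ w) = 0 :=
      Label.fan_eq_zero_of_on (Nat.zero_le (m + 1)) (n := n + 1) (by omega)
        (map_mem_on _ (fun l hl => ⟨h₁.octa hl.1 hl.2.1, by simpa using hl.2.2⟩) hwη)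
    have hw2 : Label.fan (map ℓ₂ w) = 0 :=
      Label.fan_eq_zero_of_on (by omega) (n := n + 1) (by omega)
        (map_mem_on _ (fun l hl => ⟨h₂.octa hl.1 hl.2.1, by simpa using hl.2.2⟩) hwη)
    have hwK : w ∈ On (InSet (poly K)) := on_mono (fun l hl => hl.1) hw
    have h4 := fan_labelHomotopy_bdry h₁.map_eq h₂.map_eq hwK
    rw [hw1, hw2, zero_add, zero_add, hbw] at h4
    rw [← h4]
    refine ih w hw ?_
    rw [map_add, bdry_map, hbw, map_add, hA.map_map (on_mono (fun l hl => hl.1) hu),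
      add_comm (map A u), add_self]

/-- The alternation number of the fundamental cycle does not depend on the labelling. -/
theorem fan_map_fund_eq (hA : InvolutionOn K A) (hK : IsPure K m) (hcyc : bdry (fund K m) = 0)
    {η : ℝ} (hη : 0 < η) (h₁ : IsLabelling K A ℓ₁ 0 (m + 1) η)
    (h₂ : IsLabelling K A ℓ₂ (m + 1) (2 * m + 2) η) :
    ∃ N₀ : ℕ, ∀ N, N₀ ≤ N → Label.fan (map ℓ₁ (realize N (fund K m))) =
      Label.fan (map ℓ₂ (realize N (fund K m))) := by
  obtain ⟨δ, hδ, hδη, hu⟩ := fan_labelHomotopy_add_eq_zero hA hK hη h₁ h₂ m (m + 2)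
    le_rfl (by omega)
  obtain ⟨N₀, hN₀⟩ := hA.exists_bdry_eq_fund hK hcyc hδ
  refine ⟨N₀, fun N hN => ?_⟩
  obtain ⟨w, hw, hbw⟩ := hN₀ N hN
  set z := realize N (fund K m) with hz
  have hzK : z ∈ On (InSet (poly K)) := on_mono (fun l hl => hl.1) (realize_fund_mem N)
  have hwK : w ∈ On (InSet (poly K)) := on_mono (fun l hl => hl.1) hw
  have hwη := small_mem_mono hδη hw
  have hz0 : bdry z = 0 := by rw [hz, bdry_realize, hcyc, map_zero]
  have h3 := fan_labelHomotopy_bdry h₁.map_eq h₂.map_eq hzK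
  rw [hz0, map_zero, map_zero, add_zero, ← hbw] at h3
  have h4 := fan_labelHomotopy_bdry h₁.map_eq h₂.map_eq hwK
  have hw1 : Label.fan (map ℓ₁ w) = 0 :=
    Label.fan_eq_zero_of_on (Nat.zero_le (m + 1)) (n := m + 2) (by omega)
      (map_mem_on _ (fun l hl => ⟨h₁.octa hl.1 hl.2.1, by simpa using hl.2.2⟩) hwη)
  have hw2 : Label.fan (map ℓ₂ w) = 0 :=
    Label.fan_eq_zero_of_on (by omega) (n := m + 2) (by omega)
      (map_mem_on _ (fun l hl => ⟨h₂.octa hl.1 hl.2.1, by simpa using hl.2.2⟩) hwη)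
  rw [hw1, hw2, zero_add, zero_add, hu w hw] at h4
  · rw [← add_eq_zero_iff, ← h3, ← h4]
  · rw [map_add, bdry_map, hbw, map_add, hA.map_map hzK, add_comm (map A z), add_self]

end

end Involution

/-! ### Singular chains -/

section Singular
variable {Y Z : Type} [TopologicalSpace Y] [TopologicalSpace Z]

/-- The singular simplex `σ`, as an element of the singular chain module. -/
def sing {n : ℕ} (σ : C(stdSimplex ℝ (Fin (n + 1)), Y)) :
    (singularChains (TopCat.of Y)).X n :=
  (SSet.ιChainComplex (R := Coeff) (TopCat.toSSet.obj (TopCat.of Y))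
    ((TopCat.toSSetObjEquiv (TopCat.of Y) (.op (SimplexCategory.mk n))).symm σ)).hom (1 : ZMod 2)

theorem d_sing {n : ℕ} (σ : C(stdSimplex ℝ (Fin (n + 2)), Y)) :
    ((singularChains (TopCat.of Y)).d (n + 1) n).hom (sing σ) =
      ∑ i : Fin (n + 2),
        sing (σ.comp ⟨stdSimplex.map i.succAbove, stdSimplex.continuous_map _⟩) := by
  have h := SSet.ιChainComplex_d (R := Coeff) (TopCat.toSSet.obj (TopCat.of Y))
    ((TopCat.toSSetObjEquiv (TopCat.of Y) (.op (SimplexCategory.mk (n + 1)))).symm σ)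
  have h2 := congrArg (fun f => f.hom (1 : ZMod 2)) h
  simp only [ModuleCat.hom_comp, LinearMap.comp_apply, ModuleCat.hom_sum, LinearMap.sum_apply] at h2
  refine h2.trans (Finset.sum_congr rfl fun i _ => ?_)
  have sgn : ∀ {M : ModuleCat.{0} (ZMod 2)} (g : Coeff ⟶ M) (k : ℕ),
      ((-1 : ℤ) ^ k • g).hom (1 : ZMod 2) = g.hom (1 : ZMod 2) := by
    intro M g k
    rcases neg_one_pow_eq_or ℤ k with h | h
    · rw [h, one_smul]
    · rw [h, neg_smul, one_smul, ModuleCat.hom_neg, LinearMap.neg_apply, neg_eq_iff_add_eq_zero,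
        add_self]
  rw [sgn]
  rfl

/-- The map of singular chain complexes induced by a continuous map. -/
def singMap (f : C(Y, Z)) : singularChains (TopCat.of Y) ⟶ singularChains (TopCat.of Z) :=
  ((AlgebraicTopology.singularChainComplexFunctor (ModuleCat.{0} (ZMod 2))).obj Coeff).map
    (TopCat.ofHom f)

theorem singMap_sing {n : ℕ} (f : C(Y, Z)) (σ : C(stdSimplex ℝ (Fin (n + 1)), Y)) :
    ((singMap f).f n).hom (sing σ) = sing (f.comp σ) := by
  have h := SSet.ι_chainComplexMap_f _ _ (TopCat.toSSet.map (TopCat.ofHom f)) Coeff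
    ((TopCat.toSSetObjEquiv (TopCat.of Y) (.op (SimplexCategory.mk n))).symm σ)
  exact congrArg (fun f => f.hom (1 : ZMod 2)) h

section Fundamental

variable {V : Type} [Fintype V] [LinearOrder V] {K : AbstractSimplicialComplex V} {m : ℕ}

theorem fundamentalChain_comp_singMap_apply (f : C(Realization K, Y)) :
    (fundamentalChain K m ≫ (singMap f).f m).hom (1 : ZMod 2) =
      ∑ s, sing (f.comp (simplexMap K m s)) := by
  rw [fundamentalChain, Preadditive.sum_comp, ModuleCat.hom_sum, LinearMap.sum_apply]
  exact Finset.sum_congr rfl fun s _ => singMap_sing f (simplexMap K m s)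

theorem fundamentalChain_comp_singMap_comp_d (hK : IsModTwoCycle K m) (f : C(Realization K, Y)) :
    (fundamentalChain K m ≫ (singMap f).f m) ≫
      (singularChains (TopCat.of Y)).d m ((ComplexShape.down ℕ).next m) = 0 := by
  rw [Category.assoc, HomologicalComplex.Hom.comm, ← Category.assoc, fundamentalChain_comp_d hK,
    Limits.zero_comp]

theorem singularHomologyMap_fundamentalClass (hK : IsModTwoCycle K m) (f : C(Realization K, Y)) :
    singularHomologyMap m f (fundamentalClass hK) =
      ((singularChains (TopCat.of Y)).liftCycles (fundamentalChain K m ≫ (singMap f).f m) _ rfl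
        (fundamentalChain_comp_singMap_comp_d hK f) ≫
          (singularChains (TopCat.of Y)).homologyπ m).hom (1 : ZMod 2) := by
  have h1 : (singularChains (TopCat.of (Realization K))).liftCycles (fundamentalChain K m) _ rfl
      (fundamentalChain_comp_d hK) ≫ (singularChains (TopCat.of (Realization K))).homologyπ m ≫
      HomologicalComplex.homologyMap (singMap f) m =
      (singularChains (TopCat.of Y)).liftCycles (fundamentalChain K m ≫ (singMap f).f m) _ rfl
        (fundamentalChain_comp_singMap_comp_d hK f) ≫
        (singularChains (TopCat.of Y)).homologyπ m := by
    rw [HomologicalComplex.homologyπ_naturality, ← Category.assoc,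
      HomologicalComplex.liftCycles_comp_cyclesMap]
  rw [← h1]
  rfl

/-- Two maps agree on the fundamental class if the images of the sum of all `m`-simplices differ by
a boundary. -/
theorem singularHomologyMap_fundamentalClass_eq (hK : IsModTwoCycle K m)
    (f g : C(Realization K, Y)) (y : (singularChains (TopCat.of Y)).X (m + 1))
    (hy : ((singularChains (TopCat.of Y)).d (m + 1) m).hom y =
      ∑ s, sing (f.comp (simplexMap K m s)) + ∑ s, sing (g.comp (simplexMap K m s))) :
    singularHomologyMap m f (fundamentalClass hK) =
      singularHomologyMap m g (fundamentalClass hK) := by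
  have hsum : fundamentalChain K m ≫ (singMap f).f m + fundamentalChain K m ≫ (singMap g).f m =
      ModuleCat.ofHom (LinearMap.toSpanSingleton (ZMod 2) _ y) ≫
        (singularChains (TopCat.of Y)).d (m + 1) m := by
    ext
    rw [ModuleCat.hom_add, LinearMap.add_apply, fundamentalChain_comp_singMap_apply,
      fundamentalChain_comp_singMap_apply, ← hy, ModuleCat.hom_comp,
      LinearMap.comp_apply, ModuleCat.hom_ofHom, LinearMap.toSpanSingleton_apply, one_smul]
  have hzero : (singularChains (TopCat.of Y)).liftCycles (fundamentalChain K m ≫ (singMap f).f m)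
        _ rfl (fundamentalChain_comp_singMap_comp_d hK f) ≫
          (singularChains (TopCat.of Y)).homologyπ m +
      (singularChains (TopCat.of Y)).liftCycles (fundamentalChain K m ≫ (singMap g).f m)
        _ rfl (fundamentalChain_comp_singMap_comp_d hK g) ≫
          (singularChains (TopCat.of Y)).homologyπ m = 0 := by
    have h3 : (singularChains (TopCat.of Y)).liftCycles (fundamentalChain K m ≫ (singMap f).f m)
        _ rfl (fundamentalChain_comp_singMap_comp_d hK f) +
      (singularChains (TopCat.of Y)).liftCycles (fundamentalChain K m ≫ (singMap g).f m)
        _ rfl (fundamentalChain_comp_singMap_comp_d hK g) =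
      (singularChains (TopCat.of Y)).liftCycles
        (fundamentalChain K m ≫ (singMap f).f m + fundamentalChain K m ≫ (singMap g).f m) _ rfl
        (by rw [Preadditive.add_comp, fundamentalChain_comp_singMap_comp_d hK,
          fundamentalChain_comp_singMap_comp_d hK, add_zero]) := by
      rw [← cancel_mono ((singularChains (TopCat.of Y)).iCycles m)]
      simp
    rw [← Preadditive.add_comp, h3]
    exact (singularChains (TopCat.of Y)).liftCycles_homologyπ_eq_zero_of_boundary _ _ rfl _ hsum
  have h := congrArg (fun q => q.hom (1 : ZMod 2)) hzero
  rw [singularHomologyMap_fundamentalClass, singularHomologyMap_fundamentalClass]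
  exact add_eq_zero_iff.1 h

end Fundamental

end Singular

/-! ### Singular chains from chains of lists -/

section Real

variable {E E' Y : Type} [AddCommGroup E] [Module ℝ E] [TopologicalSpace E]
  [ContinuousAdd E] [ContinuousSMul ℝ E]
  [AddCommGroup E'] [Module ℝ E'] [TopologicalSpace E']
  [ContinuousAdd E'] [ContinuousSMul ℝ E'] [TopologicalSpace Y]

/-- The affine map from the standard simplex whose vertices are the points of the list. It is meant
for lists of length `n + 1`; shorter lists are continued by zero. -/
def affineSimplex (n : ℕ) (l : List E) (w : stdSimplex ℝ (Fin (n + 1))) : E :=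
  ∑ i : Fin (n + 1), w i • l.getD i 0

theorem continuous_affineSimplex (n : ℕ) (l : List E) : Continuous (affineSimplex n l) := by
  refine continuous_finsetSum _ fun i _ => Continuous.smul ?_ continuous_const
  exact (continuous_apply i).comp continuous_subtype_val

theorem affineSimplex_map {P : Type} {n : ℕ} (f : P → E) {l : List P} (hl : l.length = n + 1)
    (w : stdSimplex ℝ (Fin (n + 1))) :
    affineSimplex n (l.map f) w = ∑ i : Fin (n + 1), w i • f (l[i.1]'(i.2.trans_eq hl.symm)) := by
  refine Finset.sum_congr rfl fun i _ => ?_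
  rw [List.getD_eq_getElem _ _ (by rw [List.length_map, hl]; exact i.2), List.getElem_map]

theorem affineSimplex_mem {n : ℕ} {C : Set E} (hC : Convex ℝ C) {l : List E}
    (hl : l.length = n + 1) (h : InSet C l) (w : stdSimplex ℝ (Fin (n + 1))) :
    affineSimplex n l w ∈ C := by
  refine hC.sum_mem (fun i _ => w.2.1 i) w.2.2 fun i _ => ?_
  rw [List.getD_eq_getElem _ _ (i.2.trans_eq hl.symm)]
  exact h _ (List.getElem_mem _)

theorem affineSimplex_face {n : ℕ} {l : List E} (hl : l.length = n + 2) (i : Fin (n + 2))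
    (w : stdSimplex ℝ (Fin (n + 1))) :
    affineSimplex (n + 1) l (stdSimplex.map i.succAbove w) = affineSimplex n (l.eraseIdx i) w := by
  have h : ∀ j : Fin (n + 2), (stdSimplex.map i.succAbove w) j =
      ∑ k with i.succAbove k = j, w k := fun j => by
    rw [stdSimplex.map_coe, FunOnFinite.linearMap_apply_apply]
  rw [affineSimplex, Fin.sum_univ_succAbove _ i]
  have h0 : (stdSimplex.map i.succAbove w) i = 0 := by
    rw [h]
    refine Finset.sum_eq_zero fun k hk => ?_
    exact absurd (Finset.mem_filter.1 hk).2 (Fin.succAbove_ne i k)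
  rw [h0, zero_smul, zero_add]
  refine Finset.sum_congr rfl fun j _ => ?_
  have hj : (stdSimplex.map i.succAbove w) (i.succAbove j) = w j := by
    rw [h]
    refine (Finset.sum_eq_single j (fun k hk hkj => ?_) fun hj => ?_)
    · exact absurd (Fin.succAbove_right_injective (Finset.mem_filter.1 hk).2) hkj
    · simp at hj
  have hlen : (l.eraseIdx i).length = n + 1 := by
    have := length_eraseIdx_add_one (l := l) (i := i) (i.2.trans_eq hl.symm)
    omega
  rw [hj, List.getD_eq_getElem _ _ ((i.succAbove j).2.trans_eq hl.symm),
    List.getD_eq_getElem _ _ (j.2.trans_eq hlen.symm), List.getElem_eraseIdx]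
  congr 1
  by_cases hji : j.1 < i.1
  · simp [hji, Fin.succAbove, Fin.lt_def]
  · simp [hji, Fin.succAbove, Fin.lt_def]

/-- The list is contained in a convex set on which `Ψ` is continuous. -/
def Admissible (Ψ : E → Y) (l : List E) : Prop :=
  ∃ C : Set E, Convex ℝ C ∧ ContinuousOn Ψ C ∧ InSet C l

theorem Admissible.continuous {Ψ : E → Y} {l : List E} (h : Admissible Ψ l) {n : ℕ}
    (hl : l.length = n + 1) : Continuous fun w => Ψ (affineSimplex n l w) := by
  obtain ⟨C, hC, hΨ, hlC⟩ := h
  exact hΨ.comp_continuous (continuous_affineSimplex n l) fun w => affineSimplex_mem hC hl hlC w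

theorem Admissible.eraseIdx {Ψ : E → Y} {l : List E} (h : Admissible Ψ l) (i : ℕ) :
    Admissible Ψ (l.eraseIdx i) := by
  obtain ⟨C, hC, hΨ, hlC⟩ := h
  exact ⟨C, hC, hΨ, hlC.eraseIdx i⟩

open Classical in
/-- The singular chain of `Y` given by composing the affine simplices spanned by the lists of
length `n + 1` with `Ψ`. Lists of other lengths, and those for which the composition is not
continuous, are sent to zero. -/
def toSingular (n : ℕ) (Ψ : E → Y) : ListChain E →ₗ[ZMod 2] (singularChains (TopCat.of Y)).X n :=
  lift fun l => if h : Continuous (fun w => Ψ (affineSimplex n l w)) ∧ l.length = n + 1 then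
    sing ⟨_, h.1⟩ else 0

theorem toSingular_of {n : ℕ} {Ψ : E → Y} {l : List E}
    (h : Continuous fun w => Ψ (affineSimplex n l w)) (hl : l.length = n + 1) :
    toSingular n Ψ (of l) = sing ⟨_, h⟩ := by
  rw [toSingular, lift_of, dif_pos ⟨h, hl⟩]

theorem d_toSingular {n : ℕ} {Ψ : E → Y} {c : ListChain E}
    (hc : c ∈ On fun l => Admissible Ψ l ∧ l.length = n + 2) :
    ((singularChains (TopCat.of Y)).d (n + 1) n).hom (toSingular (n + 1) Ψ c) =
      toSingular n Ψ (bdry c) := by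
  rw [← LinearMap.comp_apply, ← LinearMap.comp_apply (toSingular n Ψ)]
  refine eqOn_of_on _ _ (fun l hl => ?_) hc
  obtain ⟨ha, hl⟩ := hl
  rw [LinearMap.comp_apply, LinearMap.comp_apply, toSingular_of (ha.continuous hl) hl, d_sing,
    bdry_of, map_sum]
  refine Fintype.sum_equiv (finCongr hl.symm) _ _ fun i => ?_
  have hlen : (l.eraseIdx i).length = n + 1 := by
    have := length_eraseIdx_add_one (l := l) (i := i) (i.2.trans_eq hl.symm)
    omega
  rw [finCongr_apply, Fin.val_cast, toSingular_of ((ha.eraseIdx i).continuous hlen) hlen]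
  congr 1
  ext w
  exact congrArg Ψ (affineSimplex_face hl i w)

/-- Two realizations agree if they do so on every affine simplex. -/
theorem toSingular_map_eq {P : Type} {n : ℕ} {Ψ : E → Y} {Ψ' : E' → Y} {f : P → E} {g : P → E'}
    {c : ListChain P} (hc : c ∈ On fun l => l.length = n + 1 ∧ ∀ w : stdSimplex ℝ (Fin (n + 1)),
      Ψ (affineSimplex n (l.map f) w) = Ψ' (affineSimplex n (l.map g) w)) :
    toSingular n Ψ (map f c) = toSingular n Ψ' (map g c) := by
  rw [← LinearMap.comp_apply, ← LinearMap.comp_apply]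
  refine eqOn_of_on _ _ (fun l hl => ?_) hc
  have h : (fun w => Ψ (affineSimplex n (l.map f) w)) =
      fun w => Ψ' (affineSimplex n (l.map g) w) := funext hl.2
  rw [LinearMap.comp_apply, LinearMap.comp_apply, map_of, map_of]
  by_cases hc : Continuous fun w => Ψ (affineSimplex n (l.map f) w)
  · rw [toSingular_of hc (by simpa using hl.1), toSingular_of (h ▸ hc) (by simpa using hl.1)]
    congr 2
  · rw [toSingular, toSingular, lift_of, lift_of, dif_neg fun h' => hc h'.1,
      dif_neg fun h' => hc (h ▸ h'.1)]

end Real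

/-! ### The fundamental cycle is a cycle -/

section Cycle

variable {V : Type} [Fintype V] [LinearOrder V] {K : AbstractSimplicialComplex V} {m : ℕ}

theorem eraseIdx_sort (s : Finset V) (i : Fin s.sort.length) :
    s.sort.eraseIdx i = (s.erase s.sort[i]).sort := by
  have hnd := s.sort_nodup (· ≤ ·)
  refine List.Perm.eq_of_pairwise' (r := (· ≤ ·)) ((s.pairwise_sort (· ≤ ·)).sublist
    (List.eraseIdx_sublist _ _)) (Finset.pairwise_sort _ _) ?_
  refine List.perm_of_nodup_nodup_toFinset_eq (hnd.sublist (List.eraseIdx_sublist _ _))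
    (Finset.sort_nodup _ _) ?_
  rw [Finset.sort_toFinset]
  ext v
  rw [List.mem_toFinset, ← hnd.erase_getElem i.1 i.2, hnd.mem_erase_iff, Finset.mem_erase,
    Finset.mem_sort]
  rfl

theorem bdry_of_sort (s : Finset V) : bdry (of s.sort) = ∑ v ∈ s, of (s.erase v).sort := by
  have hnd := s.sort_nodup (· ≤ ·)
  rw [bdry_of]
  simp_rw [eraseIdx_sort]
  refine (Finset.sum_image (s := Finset.univ) (g := fun i : Fin (s.sort (· ≤ ·)).length =>
    (s.sort (· ≤ ·))[i]) (f := fun v => of (s.erase v).sort)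
    fun i _ j _ h => Fin.ext (hnd.getElem_inj_iff.1 h)).symm.trans
    (Finset.sum_congr ?_ fun _ _ => rfl)
  ext v
  rw [Finset.mem_image, ← Finset.mem_sort (· ≤ ·), List.mem_iff_getElem]
  constructor
  · rintro ⟨i, -, rfl⟩
    exact ⟨i.1, i.2, rfl⟩
  · rintro ⟨i, hi, rfl⟩
    exact ⟨⟨i, hi⟩, Finset.mem_univ _, rfl⟩

theorem bdry_of_sort_eq {s : Finset V} (hs : s.card = m + 1) :
    bdry (of s.sort) = ∑ t : Finset V with t.card = m, if t ⊆ s then of t.sort else 0 := by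
  rw [bdry_of_sort, ← Finset.sum_filter]
  refine Finset.sum_bij (fun v _ => s.erase v) (fun v hv => ?_) (fun v hv w hw h => ?_)
    (fun t ht => ?_) fun _ _ => rfl
  · rw [Finset.mem_filter, Finset.mem_filter, Finset.card_erase_of_mem hv, hs]
    exact ⟨⟨Finset.mem_univ _, rfl⟩, Finset.erase_subset _ _⟩
  · exact Finset.erase_injOn s hv hw h
  · rw [Finset.mem_filter, Finset.mem_filter] at ht
    have h1 : (s \ t).card = 1 := by
      rw [Finset.card_sdiff_of_subset ht.2, hs, ht.1.2]
      omega
    obtain ⟨v, hv⟩ := Finset.card_eq_one.1 h1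
    have hvs : v ∈ s \ t := hv ▸ Finset.mem_singleton_self v
    refine ⟨v, (Finset.mem_sdiff.1 hvs).1, ?_⟩
    rw [Finset.erase_eq, ← hv, Finset.sdiff_sdiff_eq_self ht.2]

/-- The point of the realization given by a `0`-simplex. -/
def vertexPoint (K : AbstractSimplicialComplex V) (s : Simplices K 0) : Realization K :=
  simplexMap K 0 s default

theorem vertexPoint_injective : Function.Injective (vertexPoint K) := by
  intro s t hst
  have h : ∀ s : Simplices K 0, ∀ v, (vertexPoint K s).1 v ≠ 0 → v ∈ s.1 := by
    intro s v hv
    by_contra hvs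
    apply hv
    simp only [vertexPoint, simplexMap, ContinuousMap.coe_mk]
    rw [stdSimplex.map_coe, FunOnFinite.linearMap_apply_apply]
    refine Finset.sum_eq_zero fun i hi => ?_
    exact absurd ((Finset.mem_filter.1 hi).2 ▸ s.1.orderEmbOfFin_mem s.2.2 i) hvs
  obtain ⟨v, hv⟩ : ∃ v, (vertexPoint K s).1 v ≠ 0 := by
    by_contra! h0
    have : ∑ v, (vertexPoint K s).1 v = 1 := (vertexPoint K s).1.2.2
    rw [Finset.sum_eq_zero fun v _ => h0 v] at this
    exact zero_ne_one this
  have h1 := h s v hv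
  have h2 := h t v (hst ▸ hv)
  obtain ⟨x, hx⟩ := Finset.card_eq_one.1 s.2.2
  obtain ⟨y, hy⟩ := Finset.card_eq_one.1 t.2.2
  rw [hx, Finset.mem_singleton] at h1
  rw [hy, Finset.mem_singleton] at h2
  exact Subtype.ext (by rw [hx, hy, ← h1, ← h2])

theorem apply_eq_of_support_singleton {x : stdSimplex ℝ V} {v : V}
    (h : ∀ w, x w ≠ 0 → w ∈ ({v} : Finset V)) : (x : V → ℝ) = Pi.single v 1 := by
  have h0 : ∀ w, w ≠ v → x w = 0 := fun w hw => by
    by_contra h'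
    exact hw (Finset.mem_singleton.1 (h w h'))
  have h1 : ∑ w, x w = 1 := x.2.2
  rw [Finset.sum_eq_single v (fun w _ hw => h0 w hw) (by simp)] at h1
  funext w
  by_cases hw : w = v
  · rw [hw, Pi.single_eq_same]
    exact h1
  · rw [Pi.single_eq_of_ne hw]
    exact h0 w hw

theorem vertexPoint_surjective (hK : IsPure K 0) : Function.Surjective (vertexPoint K) := by
  rintro ⟨x, s, hs, hx⟩
  obtain ⟨t, ht, hst, hcard⟩ := hK s hs
  refine ⟨⟨t, ht, hcard⟩, Subtype.ext (Subtype.ext ?_)⟩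
  obtain ⟨v, rfl⟩ := Finset.card_eq_one.1 hcard
  refine Eq.trans (apply_eq_of_support_singleton (v := v) fun w hw => ?_)
    (apply_eq_of_support_singleton fun w hw => hst (hx w hw)).symm
  by_contra hvs
  apply hw
  simp only [vertexPoint, simplexMap, ContinuousMap.coe_mk]
  rw [stdSimplex.map_coe, FunOnFinite.linearMap_apply_apply]
  refine Finset.sum_eq_zero fun i hi => ?_
  exact absurd ((Finset.mem_filter.1 hi).2 ▸ Finset.orderEmbOfFin_mem _ hcard i) hvs

/-- The points of a `0`-dimensional complex are its `0`-simplices, and a free involution pairs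
them. -/
theorem even_card_simplices (hK : IsPure K 0) {a : C(Realization K, Realization K)}
    (ha : IsFreeInvolution a) : ((Fintype.card (Simplices K 0) : ℕ) : ZMod 2) = 0 := by
  let e : Simplices K 0 ≃ Realization K :=
    Equiv.ofBijective _ ⟨vertexPoint_injective, vertexPoint_surjective hK⟩
  have h : ∑ _s : Simplices K 0, (1 : ZMod 2) = 0 := by
    refine Finset.sum_involution (fun s _ => e.symm (a (e s))) (fun _ _ => rfl) (fun s _ _ h => ?_)
      (fun _ _ => Finset.mem_univ _) fun s _ => ?_
    · exact ha.free (e s) (e.symm_apply_eq.1 h)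
    · simp [ha.involutive]
  simpa using h

/-- Every face with `m` vertices occurs an even number of times in the boundary. For `m = 0`, where
the boundary is the augmentation, this is due to the free involution. -/
theorem bdry_fund (hK : IsModTwoCycle K m) {a : C(Realization K, Realization K)}
    (ha : IsFreeInvolution a) : bdry (fund K m) = 0 := by
  rw [fund, map_sum, Finset.sum_congr rfl fun s _ => bdry_of_sort_eq s.2.2, Finset.sum_comm]
  refine Finset.sum_eq_zero fun t ht => ?_
  have htm := (Finset.mem_filter.1 ht).2
  rw [← Finset.sum_filter, Finset.sum_const]
  have key : (((Finset.univ.filter fun s : Simplices K m => t ⊆ s.1).card : ℕ) : ZMod 2) = 0 := by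
    rcases t.eq_empty_or_nonempty with rfl | hne
    · obtain rfl : m = 0 := by simpa using htm.symm
      rw [Finset.filter_true_of_mem fun s _ => Finset.empty_subset _]
      exact even_card_simplices hK.exists_simplex ha
    · by_cases h : ∃ s : Simplices K m, t ⊆ s.1
      · obtain ⟨s, hs⟩ := h
        have hc : (Finset.univ.filter fun s : Simplices K m => t ⊆ s.1).card =
            {s : Finset V | s ∈ K.faces ∧ s.card = m + 1 ∧ t ⊆ s}.ncard := by
          rw [← Set.ncard_coe_finset]
          refine Set.ncard_congr (fun s _ => s.1) (fun s hs => ?_) (fun s t _ _ h => Subtype.ext h)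
            fun s hs => ⟨⟨s, hs.1, hs.2.1⟩, by simpa using hs.2.2, rfl⟩
          exact ⟨s.2.1, s.2.2, by simpa using hs⟩
        rw [hc]
        exact (ZMod.natCast_eq_zero_iff_even).2
          (hK.even_ncard t ((K.isRelLowerSet_faces s.2.1).2 hs hne) htm)
      · rw [Finset.filter_false_of_mem fun s _ hs => h ⟨s, hs⟩, Finset.card_empty, Nat.cast_zero]
  rw [← Nat.cast_smul_eq_nsmul (ZMod 2), key, zero_smul]

end Cycle

/-! ### Labels of points of the sphere -/

section SphereLabel

variable {m : ℕ}

/-- A coordinate whose absolute value is at least `1 / (m + 1)`. As the choice only depends on the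
absolute values of the coordinates, it is the same for antipodal points. -/
def largeCoord (q : EuclideanSpace ℝ (Fin (m + 1))) : Fin (m + 1) :=
  Classical.epsilon fun i => ((m : ℝ) + 1)⁻¹ ≤ |q i|

theorem le_abs_largeCoord {q : EuclideanSpace ℝ (Fin (m + 1))} (hq : ‖q‖ = 1) :
    ((m : ℝ) + 1)⁻¹ ≤ |q (largeCoord q)| := by
  refine Classical.epsilon_spec (p := fun i => ((m : ℝ) + 1)⁻¹ ≤ |q i|) ?_
  -- Otherwise all squares are below `1 / (m + 1)`, and their sum is below `1`.
  by_contra! h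
  have hm : (1 : ℝ) ≤ m + 1 := by
    have := m.cast_nonneg (α := ℝ)
    linarith
  have h1 : ∑ i, ‖q i‖ ^ 2 = 1 := by rw [← EuclideanSpace.norm_sq_eq, hq, one_pow]
  have h2 : ∀ i ∈ Finset.univ, ‖q i‖ ^ 2 < ((m : ℝ) + 1)⁻¹ := fun i _ => by
    have h3 := h i
    have h4 : ((m : ℝ) + 1)⁻¹ ≤ 1 := inv_le_one_of_one_le₀ hm
    rw [← Real.norm_eq_abs] at h3
    nlinarith [norm_nonneg (q i)]
  have h5 := Finset.sum_lt_sum_of_nonempty Finset.univ_nonempty h2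
  rw [h1, Finset.sum_const, Finset.card_univ, Fintype.card_fin, nsmul_eq_mul, Nat.cast_add,
    Nat.cast_one, mul_inv_cancel₀ (by linarith)] at h5
  exact lt_irrefl _ h5

theorem largeCoord_neg (q : EuclideanSpace ℝ (Fin (m + 1))) : largeCoord (-q) = largeCoord q := by
  simp [largeCoord]

/-- The label of a point of the sphere: a large coordinate, with its sign. -/
def sphereLabel (q : EuclideanSpace ℝ (Fin (m + 1))) : Label :=
  (largeCoord q, decide (0 < q (largeCoord q)))

theorem sphereLabel_neg {q : EuclideanSpace ℝ (Fin (m + 1))} (hq : ‖q‖ = 1) :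
    sphereLabel (-q) = Label.neg (sphereLabel q) := by
  have h1 := le_abs_largeCoord hq
  have h2 : q (largeCoord q) ≠ 0 := abs_pos.1 ((by positivity : 0 < ((m : ℝ) + 1)⁻¹).trans_le h1)
  rw [sphereLabel, sphereLabel, largeCoord_neg, Label.neg]
  refine Prod.ext rfl ?_
  rcases lt_or_gt_of_ne h2 with h | h
  · simp [h, h.le]
  · simp [h, h.le]

/-- The vertex `±eᵢ` of the cross-polytope given by a label, with value zero for the labels that do
not correspond to a coordinate. -/
def labelVec (m : ℕ) (x : Label) : EuclideanSpace ℝ (Fin (m + 1)) :=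
  if h : x.1 < m + 1 then EuclideanSpace.single ⟨x.1, h⟩ (if x.2 then 1 else -1) else 0

theorem inner_labelVec (p : EuclideanSpace ℝ (Fin (m + 1))) {x : Label} (h : x.1 < m + 1) :
    inner ℝ p (labelVec m x) = (if x.2 then 1 else -1) * p ⟨x.1, h⟩ := by
  rw [labelVec, dif_pos h, EuclideanSpace.inner_single_right]
  simp

theorem abs_sub_apply_le (p q : EuclideanSpace ℝ (Fin (m + 1))) (i : Fin (m + 1)) :
    |p i - q i| ≤ ‖p - q‖ := by
  have := PiLp.norm_apply_le (p - q) i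
  simpa using this

theorem le_inner_labelVec {p q : EuclideanSpace ℝ (Fin (m + 1))} (hq : ‖q‖ = 1)
    (h : ‖p - q‖ ≤ ((m : ℝ) + 1)⁻¹ / 2) :
    ((m : ℝ) + 1)⁻¹ / 2 ≤ inner ℝ p (labelVec m (sphereLabel q)) := by
  have h1 := le_abs_largeCoord hq
  have h0 : 0 < ((m : ℝ) + 1)⁻¹ := by positivity
  have h2 := abs_le.1 ((abs_sub_apply_le p q (largeCoord q)).trans h)
  rw [inner_labelVec p (x := sphereLabel q) (largeCoord q).2]
  simp only [sphereLabel, Fin.eta, decide_eq_true_eq]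
  split_ifs with h3
  · rw [abs_of_pos h3] at h1
    linarith
  · rw [abs_of_nonpos (not_lt.1 h3)] at h1
    linarith

theorem sphereLabel_ne_neg {p q : EuclideanSpace ℝ (Fin (m + 1))} (hp : ‖p‖ = 1) (hq : ‖q‖ = 1)
    (h : ‖p - q‖ ≤ ((m : ℝ) + 1)⁻¹ / 2) : Label.neg (sphereLabel p) ≠ sphereLabel q := by
  intro he
  have h0 : 0 < ((m : ℝ) + 1)⁻¹ := by positivity
  have h1 := le_inner_labelVec hq h
  have h2 : ((m : ℝ) + 1)⁻¹ / 2 ≤ inner ℝ p (labelVec m (sphereLabel p)) :=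
    le_inner_labelVec hp (by rw [sub_self, norm_zero]; positivity)
  rw [← he, inner_labelVec p (x := Label.neg (sphereLabel p)) (largeCoord p).2] at h1
  rw [inner_labelVec p (x := sphereLabel p) (largeCoord p).2] at h2
  simp only [Label.neg, sphereLabel] at h1 h2
  by_cases h3 : 0 < p (largeCoord p)
  · simp [h3] at h1 h2
    linarith
  · simp [h3] at h1 h2
    linarith

end SphereLabel

/-! ### Radial projection to the sphere -/

section Radial

variable {m : ℕ}

/-- The radial projection to the unit sphere, with an arbitrary value at the origin. -/
def toSphere (q : EuclideanSpace ℝ (Fin (m + 1))) : Sphere m :=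
  if h : q = 0 then ⟨EuclideanSpace.single 0 1, by simp⟩
  else ⟨‖q‖⁻¹ • q, by
    rw [mem_sphere_zero_iff_norm, norm_smul, norm_inv, norm_norm,
      inv_mul_cancel₀ (norm_ne_zero_iff.2 h)]⟩

theorem toSphere_coe (q : Sphere m) : toSphere (q : EuclideanSpace ℝ (Fin (m + 1))) = q := by
  have h : ‖(q : EuclideanSpace ℝ (Fin (m + 1)))‖ = 1 := mem_sphere_zero_iff_norm.1 q.2
  have h0 : (q : EuclideanSpace ℝ (Fin (m + 1))) ≠ 0 := fun h0 => by simp [h0] at h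
  ext1
  rw [toSphere, dif_neg h0]
  simp [h]

theorem continuousOn_toSphere : ContinuousOn (toSphere (m := m)) {q | q ≠ 0} := by
  rw [continuousOn_iff_continuous_domRestrict, continuous_induced_rng]
  have h : Continuous fun q : {q : EuclideanSpace ℝ (Fin (m + 1)) | q ≠ 0} => ‖q.1‖⁻¹ • q.1 :=
    (continuous_subtype_val.norm.inv₀ fun q => norm_ne_zero_iff.2 q.2).smul continuous_subtype_val
  refine h.congr fun q => ?_
  simp only [Function.comp_apply, Set.domRestrict_apply]
  rw [toSphere, dif_neg q.2]

/-- A list of labels without complementary pairs is realized by a singular simplex of the sphere: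
the corresponding vertices of the cross-polytope lie in an open half-space. -/
theorem admissible_labelVec {l : List Label} (hl : Label.Octa 0 (m + 1) l) :
    Admissible (toSphere (m := m)) (l.map (labelVec m)) := by
  classical
  -- The half-space is given by a vector with the signs of the labels in the list.
  let u : EuclideanSpace ℝ (Fin (m + 1)) :=
    WithLp.toLp 2 fun i => if ((i : ℕ), true) ∈ l then 1 else -1
  have hu : IsLinearMap ℝ fun q : EuclideanSpace ℝ (Fin (m + 1)) => inner ℝ u q :=
    ⟨fun x y => inner_add_right u x y, fun c x => inner_smul_right u x c⟩
  refine ⟨{q | 0 < inner ℝ u q}, convex_halfSpace_gt hu 0, continuousOn_toSphere.mono ?_, ?_⟩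
  · rintro q hq rfl
    simp at hq
  · intro q hq
    obtain ⟨⟨i, b⟩, hx, rfl⟩ := List.mem_map.1 hq
    rw [Set.mem_ofPred_eq, inner_labelVec u (hl.2 _ hx).2]
    cases b with
    | true => simp [u, hx]
    | false =>
      have : (i, true) ∉ l := hl.1 _ hx
      simp [u, this]

end Radial

/-! ### Maps on the realization, as maps on the polyhedron -/

section Extend

variable {V : Type} [Fintype V] {K : AbstractSimplicialComplex V}

/-- A point of the polyhedron, as a point of the realization. -/
def polyPoint {x : V → ℝ} (h : x ∈ poly K) : Realization K :=
  ⟨⟨x, let ⟨_, _, hx⟩ := h; hx.1⟩, let ⟨s, hs, hx⟩ := h; ⟨s, hs, hx.2⟩⟩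

theorem coe_mem_poly (p : Realization K) : (p.1 : V → ℝ) ∈ poly K :=
  let ⟨s, hs, hp⟩ := p.2
  ⟨s, hs, p.1.2, hp⟩

open Classical in
/-- The extension of a function from the realization to `V → ℝ` by a constant. -/
def extendPoly {Z : Type} (f : Realization K → Z) (z : Z) (x : V → ℝ) : Z :=
  if h : x ∈ poly K then f (polyPoint h) else z

theorem extendPoly_of_mem {Z : Type} (f : Realization K → Z) (z : Z) {x : V → ℝ}
    (h : x ∈ poly K) : extendPoly f z x = f (polyPoint h) := dif_pos h

theorem extendPoly_coe {Z : Type} (f : Realization K → Z) (z : Z) (p : Realization K) :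
    extendPoly f z (p.1 : V → ℝ) = f p := extendPoly_of_mem f z (coe_mem_poly p)

theorem continuousOn_extendPoly {Z : Type} [TopologicalSpace Z] {f : Realization K → Z}
    (hf : Continuous f) (z : Z) : ContinuousOn (extendPoly f z) (poly K) := by
  rw [continuousOn_iff_continuous_domRestrict]
  have h : Continuous fun x : poly K => polyPoint x.2 :=
    (continuous_subtype_val.subtype_mk _).subtype_mk _
  exact (hf.comp h).congr fun x => (extendPoly_of_mem f z x.2).symm

theorem involutionOn_extendPoly {a : C(Realization K, Realization K)} (ha : IsFreeInvolution a) :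
    InvolutionOn K (extendPoly (fun p => ((a p).1 : V → ℝ)) 0) where
  mapsTo x hx := by
    rw [extendPoly_of_mem _ _ hx]
    exact coe_mem_poly _
  continuousOn := continuousOn_extendPoly
    (continuous_subtype_val.comp (continuous_subtype_val.comp a.continuous)) _
  apply_apply x hx := by
    rw [extendPoly_of_mem _ _ hx, extendPoly_coe, ha.involutive]
    rfl

end Extend

/-! ### From a map to its combinatorial approximation -/

section Interpolate

variable {V : Type} [Fintype V] [LinearOrder V] {K : AbstractSimplicialComplex V} {m : ℕ}

/-- The family of maps interpolating between a map `Φ` to the sphere, for `t = 0` and `q = 0`, and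
the radial projection of `q`, for `t = 1`. -/
def interpolate (Φ : (V → ℝ) → Sphere m) (p : (V → ℝ) × ℝ × EuclideanSpace ℝ (Fin (m + 1))) :
    Sphere m :=
  toSphere ((1 - p.2.1) • (Φ p.1 : EuclideanSpace ℝ (Fin (m + 1))) + p.2.2)

theorem toSingular_map_vert (φ : C(Realization K, Sphere m)) (z : Sphere m) :
    toSingular m (extendPoly φ z) (map vert (fund K m)) =
      ∑ s, sing (φ.comp (simplexMap K m s)) := by
  rw [fund, map_sum, map_sum]
  refine Finset.sum_congr rfl fun s _ => ?_
  have hlen : s.1.sort.length = m + 1 := (Finset.length_sort (· ≤ ·)).trans s.2.2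
  have h : ∀ w, affineSimplex m (s.1.sort.map vert) w = ((simplexMap K m s w).1 : V → ℝ) := by
    intro w
    rw [affineSimplex_map _ hlen]
    funext v
    simp only [simplexMap, ContinuousMap.coe_mk]
    rw [stdSimplex.map_coe, FunOnFinite.linearMap_apply_apply, Finset.sum_apply, Finset.sum_filter]
    refine Finset.sum_congr rfl fun i _ => ?_
    have hi : s.1.sort[i.1]'(i.2.trans_eq hlen.symm) = s.1.orderEmbOfFin s.2.2 i := rfl
    rw [Pi.smul_apply, smul_eq_mul, vert, hi, Pi.single_apply]
    by_cases hv : s.1.orderEmbOfFin s.2.2 i = v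
    · rw [if_pos hv, if_pos hv.symm, mul_one]
    · rw [if_neg hv, if_neg fun h => hv h.symm, mul_zero]
  have h2 : (fun w => extendPoly φ z (affineSimplex m (s.1.sort.map vert) w)) =
      φ.comp (simplexMap K m s) := by
    funext w
    rw [h, extendPoly_coe]
    rfl
  rw [map_of, toSingular_of (by rw [h2]; exact ContinuousMap.continuous _) (by simpa using hlen)]
  congr 1
  ext1 w
  exact congrFun h2 w

theorem toSingular_interpolate_zero {Φ : (V → ℝ) → Sphere m} {c : ListChain (V → ℝ)}
    (hc : c ∈ On fun l => l.length = m + 1) :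
    toSingular m (interpolate Φ) (map (fun x => (x, 0, 0)) c) = toSingular m Φ c := by
  refine (toSingular_map_eq (Ψ' := Φ) (g := id) (on_mono (fun l hl => ⟨hl, fun w => ?_⟩) hc)).trans
    (by rw [ListChain.map_id])
  rw [affineSimplex_map _ hl, affineSimplex_map _ hl, interpolate]
  simp [Prod.fst_sum, Prod.snd_sum, toSphere_coe]

theorem toSingular_interpolate_one {Φ : (V → ℝ) → Sphere m}
    (g : (V → ℝ) → EuclideanSpace ℝ (Fin (m + 1))) {c : ListChain (V → ℝ)}
    (hc : c ∈ On fun l => l.length = m + 1) :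
    toSingular m (interpolate Φ) (map (fun x => (x, 1, g x)) c) =
      toSingular m toSphere (map g c) := by
  refine toSingular_map_eq (on_mono (fun l hl => ⟨hl, fun w => ?_⟩) hc)
  rw [affineSimplex_map _ hl, affineSimplex_map _ hl, interpolate]
  have h : ∑ i, w i = 1 := w.2.2
  simp [Prod.fst_sum, Prod.snd_sum, h]

theorem inner_pos_of_dist_le {p q : Sphere m} (h : dist p q ≤ ((m : ℝ) + 1)⁻¹ / 2) :
    0 < inner ℝ (p : EuclideanSpace ℝ (Fin (m + 1))) q := by
  have hp : ‖(p : EuclideanSpace ℝ (Fin (m + 1)))‖ = 1 := mem_sphere_zero_iff_norm.1 p.2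
  have hq : ‖(q : EuclideanSpace ℝ (Fin (m + 1)))‖ = 1 := mem_sphere_zero_iff_norm.1 q.2
  have h1 : ‖(p : EuclideanSpace ℝ (Fin (m + 1))) - q‖ ≤ ((m : ℝ) + 1)⁻¹ / 2 := by
    rwa [← dist_eq_norm]
  have h2 : ((m : ℝ) + 1)⁻¹ ≤ 1 := inv_le_one_of_one_le₀ (by simp)
  have h3 := norm_sub_sq_real (p : EuclideanSpace ℝ (Fin (m + 1))) q
  rw [hp, hq] at h3
  nlinarith [norm_nonneg ((p : EuclideanSpace ℝ (Fin (m + 1))) - q)]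

/-- Over a small list, the interpolation between a map and the vertices of the cross-polytope given
by the labels of its values does not meet the origin. -/
theorem exists_convex_interpolate {Φ : (V → ℝ) → Sphere m} (hΦ : ContinuousOn Φ (poly K)) {ε : ℝ}
    (hΦε : ∀ x ∈ poly K, ∀ y ∈ poly K, dist x y ≤ ε → dist (Φ x) (Φ y) ≤ ((m : ℝ) + 1)⁻¹ / 2)
    {l : List (V → ℝ)} (hl0 : l ≠ []) (hl : InFace K l) (hls : Small ε l) :
    ∃ C, Convex ℝ C ∧ ContinuousOn (interpolate Φ) C ∧ ∀ x ∈ l, (x, 0, 0) ∈ C ∧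
      (x, 1, labelVec m (sphereLabel (Φ x).1)) ∈ C := by
  obtain ⟨s, hs, hlc⟩ := hl
  set p₀ := l.head hl0
  have hp₀ : p₀ ∈ l := List.head_mem hl0
  have hp₀K : p₀ ∈ poly K := ⟨s, hs, hlc _ hp₀⟩
  have hc : 0 < ((m : ℝ) + 1)⁻¹ / 2 := by positivity
  have hlin : IsLinearMap ℝ fun p : (V → ℝ) × ℝ × EuclideanSpace ℝ (Fin (m + 1)) =>
      inner ℝ (Φ p₀ : EuclideanSpace ℝ (Fin (m + 1))) p.2.2 - ((m : ℝ) + 1)⁻¹ / 2 * p.2.1 :=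
    ⟨fun x y => by simp [inner_add_right]; ring, fun c x => by simp [inner_smul_right]; ring⟩
  -- On this set, the product of `(1 - t) Φ(p) + q` with `Φ(p₀)` is positive: the first summand
  -- contributes for `t < 1` and the second one for `t > 0`.
  refine ⟨((cell s ∩ Metric.closedBall p₀ ε) ×ˢ (Set.Icc 0 1 ×ˢ Set.univ)) ∩
    {p | 0 ≤ inner ℝ (Φ p₀ : EuclideanSpace ℝ (Fin (m + 1))) p.2.2 -
      ((m : ℝ) + 1)⁻¹ / 2 * p.2.1}, ?_, ?_, ?_⟩
  · exact (((convex_cell s).inter (convex_closedBall _ _)).prod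
      ((convex_Icc 0 1).prod convex_univ)).inter (convex_halfSpace_ge hlin 0)
  · refine continuousOn_toSphere.comp (ContinuousOn.add (ContinuousOn.smul
      (continuous_const.sub (continuous_fst.comp continuous_snd)).continuousOn
      (continuous_subtype_val.comp_continuousOn (hΦ.comp continuousOn_fst ?_)))
      (continuous_snd.comp continuous_snd).continuousOn) ?_
    · exact fun p hp => ⟨s, hs, hp.1.1.1⟩
    · rintro ⟨p, t, q⟩ ⟨⟨⟨hp, hpp⟩, ⟨ht0, ht1⟩, -⟩, hq⟩ h0
      simp only [Set.mem_ofPred_eq] at hq hpp ht0 ht1 h0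
      have h1 := inner_pos_of_dist_le (hΦε p₀ hp₀K p ⟨s, hs, hp⟩ (by rwa [dist_comm]))
      have h2 : inner ℝ (Φ p₀ : EuclideanSpace ℝ (Fin (m + 1)))
          ((1 - t) • (Φ p : EuclideanSpace ℝ (Fin (m + 1))) + q) = 0 := by
        rw [h0, inner_zero_right]
      rw [inner_add_right, inner_smul_right] at h2
      rcases ht0.eq_or_lt with rfl | ht
      · linarith
      · have h3 := mul_pos hc ht
        have h4 := mul_nonneg (sub_nonneg.2 ht1) h1.le
        linarith
  · intro x hx
    have hxp := hls x hx _ hp₀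
    refine ⟨⟨⟨⟨hlc x hx, hxp⟩, by simp⟩, by simp⟩, ⟨⟨hlc x hx, hxp⟩, by simp⟩, ?_⟩
    have h1 := hΦε p₀ hp₀K x ⟨s, hs, hlc x hx⟩ (by rwa [dist_comm])
    rw [Subtype.dist_eq, dist_eq_norm] at h1
    have h2 := le_inner_labelVec (mem_sphere_zero_iff_norm.1 (Φ x).2) h1
    simp only [Set.mem_ofPred_eq, mul_one]
    linarith

variable [Nonempty V]

/-- The image of the fundamental cycle under `φ` is homologous to the cycle of cross-polytope
simplices read off from the labels of the vertices of a fine subdivision. -/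
theorem exists_d_eq_add_toSingular_label (hcyc : bdry (fund K m) = 0)
    (φ : C(Realization K, Sphere m)) (z : Sphere m) :
    ∃ N₀ : ℕ, ∀ N, N₀ ≤ N → ∃ y : (singularChains (TopCat.of (Sphere m))).X (m + 1),
      ((singularChains (TopCat.of (Sphere m))).d (m + 1) m).hom y =
        ∑ s, sing (φ.comp (simplexMap K m s)) + toSingular m toSphere (map (labelVec m)
          (map (fun x => sphereLabel (extendPoly φ z x).1) (realize N (fund K m)))) := by
  set Φ := extendPoly φ z with hΦdef
  have hΦ : ContinuousOn Φ (poly K) := continuousOn_extendPoly φ.continuous z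
  obtain ⟨ε, hε, hΦε⟩ := exists_dist_le_of_continuousOn hΦ
    (ε := ((m : ℝ) + 1)⁻¹ / 2) (by positivity)
  obtain ⟨N₀, hN₀⟩ := exists_realize_fund_small K m hε
  refine ⟨N₀, fun N hN => ?_⟩
  set Z := realize N (fund K m) with hZ
  have hZ0 : bdry Z = 0 := by rw [hZ, bdry_realize, hcyc, map_zero]
  have hZlen : Z ∈ On fun l => l.length = m + 1 := on_mono (fun l hl => hl.2.2) (hN₀ N hN)
  -- The homotopy from the simplices of `K` to their subdivision, inside each simplex.
  set w₀ := homotopy (map vert) (realize N)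
    (fun l : List V => (l.map vert).headD 0) (fund K m) with hw₀
  have hbw₀ : bdry w₀ = map vert (fund K m) + Z := by
    rw [hw₀, bdry_homotopy _ (fun c => bdry_map vert c) (fun c => bdry_realize N c)
      (by rw [map_of, realize_nil]; rfl), hcyc, map_zero, add_zero]
  have hw₀On : w₀ ∈ On fun l => Admissible Φ l ∧ l.length = m + 2 := by
    rw [hw₀, fund, map_sum]
    refine Submodule.sum_mem _ fun s _ => ?_
    have h1 : homotopy (map vert) (realize N) (fun l : List V => (l.map vert).headD 0)
        (of s.1.sort) ∈ On (InSet (cell s.1)) := by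
      have hvert : ∀ l : List V, InSet (s.1 : Set V) l → InSet (cell s.1) (l.map vert) :=
        fun l hl x hx => by
          obtain ⟨v, hv, rfl⟩ := List.mem_map.1 hx
          exact vert_mem_cell (hl v hv)
      refine homotopy_mem_inSet (D := (s.1 : Set V)) (fun l h0 hl => ?_) (fun l hl => ?_)
        (fun l hl => realize_mem_inSet N hl) _ fun v hv => (Finset.mem_sort _).1 hv
      · exact headD_mem _ (by simpa using h0) (hvert l hl)
      · rw [map_of]
        exact of_mem_on (hvert l hl)
    refine on_mono (fun l hl => ⟨⟨_, convex_cell s.1, hΦ.mono fun x hx => ⟨s.1, s.2.1, hx⟩, hl.1⟩,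
      hl.2⟩) (on_and h1 (homotopy_mem_length _ (map_mem_length vert)
        (fun n l hl => realize_mem_length N hl) _
        ((Finset.length_sort (· ≤ ·)).trans s.2.2)))
  -- The homotopy from the map to its combinatorial approximation.
  set f₀ : (V → ℝ) → (V → ℝ) × ℝ × EuclideanSpace ℝ (Fin (m + 1)) := fun x => (x, 0, 0) with hf₀
  set f₁ : (V → ℝ) → (V → ℝ) × ℝ × EuclideanSpace ℝ (Fin (m + 1)) :=
    fun x => (x, 1, labelVec m (sphereLabel (Φ x).1)) with hf₁
  set w₁ := homotopy (map f₀) (map f₁) (fun l => (l.map f₀).headD 0) Z with hw₁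
  have hbw₁ : bdry w₁ = map f₀ Z + map f₁ Z := by
    rw [hw₁, bdry_homotopy _ (fun c => bdry_map f₀ c) (fun c => bdry_map f₁ c)
      (by rw [map_of, map_of]; rfl), hZ0, map_zero, add_zero]
  have hw₁On : w₁ ∈ On fun l => Admissible (interpolate Φ) l ∧ l.length = m + 2 := by
    refine map_mem_of_on _ _ (fun l hl => ?_) (hN₀ N hN)
    have hl0 : l ≠ [] := by
      rintro rfl
      simp at hl
    obtain ⟨C, hC, hΨ, hlC⟩ := exists_convex_interpolate hΦ hΦε hl0 hl.1 hl.2.1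
    have hmem : ∀ f : (V → ℝ) → (V → ℝ) × ℝ × EuclideanSpace ℝ (Fin (m + 1)),
        (∀ x ∈ l, f x ∈ C) → ∀ l', InSet {x | x ∈ l} l' → InSet C (l'.map f) :=
      fun f hf l' hl' y hy => by
        obtain ⟨x, hx, rfl⟩ := List.mem_map.1 hy
        exact hf x (hl' x hx)
    have h1 : homotopy (map f₀) (map f₁) (fun l => (l.map f₀).headD 0) (of l) ∈ On (InSet C) := by
      refine homotopy_mem_inSet (D := {x | x ∈ l}) (fun l' h0 hl' => ?_) (fun l' hl' => ?_)
        (fun l' hl' => ?_) l fun _ h => h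
      · exact headD_mem _ (by simpa using h0) (hmem f₀ (fun x hx => (hlC x hx).1) l' hl')
      · rw [map_of]
        exact of_mem_on (hmem f₀ (fun x hx => (hlC x hx).1) l' hl')
      · rw [map_of]
        exact of_mem_on (hmem f₁ (fun x hx => (hlC x hx).2) l' hl')
    exact on_mono (fun l' hl' => ⟨⟨C, hC, hΨ, hl'.1⟩, hl'.2⟩) (on_and h1
      (homotopy_mem_length _ (map_mem_length f₀) (map_mem_length f₁) l hl.2.2))
  refine ⟨toSingular (m + 1) Φ w₀ + toSingular (m + 1) (interpolate Φ) w₁, ?_⟩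
  rw [map_add, d_toSingular hw₀On, d_toSingular hw₁On, hbw₀, hbw₁, map_add, map_add,
    toSingular_interpolate_zero hZlen, toSingular_interpolate_one _ hZlen, toSingular_map_vert,
    ListChain.map_map]
  have h2 := add_self (toSingular m Φ Z)
  rw [add_assoc, ← add_assoc (toSingular m Φ Z), h2, zero_add]
  rfl

end Interpolate

/-! ### Comparison of two equivariant maps -/

theorem add_add_add_add_eq {M : Type*} [AddCommGroup M] [Module (ZMod 2) M] (u v p q : M) :
    u + p + (v + q) + (p + q) = u + v := by
  rw [show u + p + (v + q) + (p + q) = u + v + (p + p) + (q + q) by abel, add_self, add_self,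
    add_zero, add_zero]

section Compare

variable {V : Type} [Fintype V] [LinearOrder V] {K : AbstractSimplicialComplex V} {m : ℕ}

/-- The label `±i`, shifted to `±(i + k)`. -/
def shiftLabel (k : ℕ) (x : Label) : Label := (x.1 + k, x.2)

theorem fan_map_shiftLabel (k : ℕ) (c : ListChain Label) :
    Label.fan (map (shiftLabel k) c) = Label.fan c :=
  Label.fan_map (j := shiftLabel k) (fun x y => by simp [shiftLabel]) (fun _ => rfl)
    (fun _ => rfl) c

/-- The labels of the values of an equivariant map form a labelling, also after a shift. -/
theorem exists_isLabelling {a : C(Realization K, Realization K)} {φ : C(Realization K, Sphere m)}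
    (hφ : IsEquivariant a φ) (z : Sphere m) (k : ℕ) : ∃ η₀ > 0, ∀ η ≤ η₀,
      IsLabelling K (extendPoly (fun p => ((a p).1 : V → ℝ)) 0)
        (fun x => shiftLabel k (sphereLabel (extendPoly φ z x).1)) k (k + (m + 1)) η := by
  obtain ⟨η₀, hη₀, h⟩ := exists_dist_le_of_continuousOn (continuousOn_extendPoly φ.continuous z)
    (ε := ((m : ℝ) + 1)⁻¹ / 2) (by positivity)
  have hnorm : ∀ q : Sphere m, ‖(q : EuclideanSpace ℝ (Fin (m + 1)))‖ = 1 :=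
    fun q => mem_sphere_zero_iff_norm.1 q.2
  refine ⟨η₀, hη₀, fun η hη => ⟨fun x hx => ?_, fun x _ => ?_, fun x hx y hy hxy heq => ?_⟩⟩
  · rw [extendPoly_of_mem _ _ hx, extendPoly_coe, hφ, extendPoly_of_mem _ _ hx]
    exact congrArg (shiftLabel k) (sphereLabel_neg (hnorm _))
  · have := (largeCoord (extendPoly φ z x).1).2
    simp only [shiftLabel, sphereLabel]
    omega
  · have h1 := h x hx y hy (hxy.trans hη)
    rw [Subtype.dist_eq, dist_eq_norm] at h1
    refine sphereLabel_ne_neg (hnorm _) (hnorm _) h1 ?_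
    have h2 : ((sphereLabel (extendPoly φ z x).1).1 + k) =
      (sphereLabel (extendPoly φ z y).1).1 + k :=
      congrArg Prod.fst heq
    have h3 := congrArg Prod.snd heq
    exact Prod.ext (Nat.add_right_cancel h2) h3

/-- A cycle of labels without opposite pairs, of alternation number zero, is realized by a boundary
in the sphere. -/
theorem exists_d_eq_toSingular_label {c : ListChain Label}
    (hc : c ∈ On fun l => Label.Octa 0 (m + 1) l ∧ l.length = m + 1) (hc0 : bdry c = 0)
    (hfan : Label.fan c = 0) : ∃ y : (singularChains (TopCat.of (Sphere m))).X (m + 1),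
      ((singularChains (TopCat.of (Sphere m))).d (m + 1) m).hom y =
        toSingular m toSphere (map (labelVec m) c) := by
  obtain ⟨w, hw, hbw⟩ := Label.exists_bdry_of_fan_eq_zero (m + 1) 0 c (zero_add _) hc hc0 hfan
  refine ⟨toSingular (m + 1) toSphere (map (labelVec m) w), ?_⟩
  rw [d_toSingular, bdry_map, hbw]
  exact map_mem_on _ (fun l hl => ⟨admissible_labelVec hl.1, by simpa using hl.2⟩) hw

theorem degTwo_eq_of_isEquivariant (hK : IsModTwoCycle K m)
    {a : C(Realization K, Realization K)} (ha : IsFreeInvolution a)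
    {φ ψ : C(Realization K, Sphere m)} (hφ : IsEquivariant a φ) (hψ : IsEquivariant a ψ) :
    degTwo hK φ = degTwo hK ψ := by
  rcases isEmpty_or_nonempty V with hV | hV
  · have : φ = ψ := by
      ext1 p
      exact absurd p.1.2.2 (by simp)
    rw [this]
  have hcyc := bdry_fund hK ha
  set A := extendPoly (K := K) (fun p => ((a p).1 : V → ℝ)) 0
  set z : Sphere m := toSphere 0
  obtain ⟨η₁, hη₁, h₁⟩ := exists_isLabelling hφ z 0
  obtain ⟨η₂, hη₂, h₂⟩ := exists_isLabelling hψ z 0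
  -- The labels for `ψ` are shifted, to make their absolute values different from those for `φ`.
  obtain ⟨η₃, hη₃, h₃⟩ := exists_isLabelling hψ z (m + 1)
  set η := min η₁ (min η₂ η₃)
  have hη : 0 < η := lt_min hη₁ (lt_min hη₂ hη₃)
  replace h₁ := h₁ η (min_le_left _ _)
  replace h₂ := h₂ η ((min_le_right _ _).trans (min_le_left _ _))
  replace h₃ := h₃ η ((min_le_right _ _).trans (min_le_right _ _))
  rw [zero_add] at h₁ h₂
  rw [show m + 1 + (m + 1) = 2 * m + 2 by omega] at h₃
  obtain ⟨N₁, hN₁⟩ := fan_map_fund_eq (involutionOn_extendPoly ha) hK.exists_simplex hcyc hη h₁ h₃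
  obtain ⟨N₂, hN₂⟩ := exists_realize_fund_small K m hη
  obtain ⟨N₃, hN₃⟩ := exists_d_eq_add_toSingular_label hcyc φ z
  obtain ⟨N₄, hN₄⟩ := exists_d_eq_add_toSingular_label hcyc ψ z
  set N := max (max N₁ N₂) (max N₃ N₄)
  replace hN₁ := hN₁ N (by omega)
  replace hN₂ := hN₂ N (by omega)
  obtain ⟨y₁, hy₁⟩ := hN₃ N (by omega)
  obtain ⟨y₂, hy₂⟩ := hN₄ N (by omega)
  set Z := realize N (fund K m)
  have hZ0 : bdry Z = 0 := by rw [bdry_realize, hcyc, map_zero]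
  have hshift : ∀ f : (V → ℝ) → Label, map (fun x => shiftLabel (m + 1) (f x)) Z =
      map (shiftLabel (m + 1)) (map f Z) := fun f => by rw [ListChain.map_map]; rfl
  rw [hshift, fan_map_shiftLabel] at hN₁
  have hOn : ∀ f : (V → ℝ) → Label, IsLabelling K A f 0 (m + 1) η →
      map f Z ∈ On fun l => Label.Octa 0 (m + 1) l ∧ l.length = m + 1 := fun f hf =>
    map_mem_on _ (fun l hl => ⟨hf.octa hl.1.inSet hl.2.1, by simpa using hl.2.2⟩) hN₂
  obtain ⟨y₃, hy₃⟩ := exists_d_eq_toSingular_label (Submodule.add_mem _ (hOn _ h₁) (hOn _ h₂))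
    (by rw [map_add, bdry_map, bdry_map, hZ0, map_zero, map_zero, add_zero])
    (by rw [map_add]; exact add_eq_zero_iff.2 hN₁)
  have key := singularHomologyMap_fundamentalClass_eq hK φ ψ (y₁ + y₂ + y₃) (by
    rw [map_add, map_add, hy₁, hy₂, hy₃, map_add, map_add]
    exact add_add_add_add_eq _ _ _ _)
  rw [degTwo, degTwo, key]

end Compare

end

theorem mainTheorem7 {V : Type} [Fintype V] [LinearOrder V] (K : AbstractSimplicialComplex V)
    (a : C(Realization K, Realization K)) (m : ℕ) :
    (∀ h : IsEssentialCycle K a m, ∀ φ : C(Realization K, Sphere m), IsEquivariant a φ →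
      degTwo h.isModTwoCycle φ = 1) ∧
    (∀ hK : IsModTwoCycle K m, IsFreeInvolution a →
      ∀ φ ψ : C(Realization K, Sphere m), IsEquivariant a φ → IsEquivariant a ψ →
        degTwo hK φ = degTwo hK ψ) := by
  refine ⟨fun h φ hφ => ?_, fun hK ha φ ψ hφ hψ => degTwo_eq_of_isEquivariant hK ha hφ hψ⟩
  obtain ⟨ψ, hψ, hψ1⟩ := h.exists_odd
  rw [degTwo_eq_of_isEquivariant h.isModTwoCycle h.isFreeInvolution hφ hψ, hψ1]
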